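/- **Setting.** Fix a first-order signature of function symbols, *built-in* constraint symbols (among them falsity $\bot$ and a binary equality $\doteq$) and *user-defined* constraint symbols, and countably many variables. *Built-in constraints* $\mathbb B::=\top\mid c_b(\bar t)\mid\mathbb B\wedge\mathbb B'$; *user-defined constraints* $\mathbb U::=\top\mid c_u(\bar t)\mid\mathbb U\wedge\mathbb U'$; *goals* $\mathbb G::=\top\mid c_u(\bar t)\mid c_b(\bar t)\mid\mathbb G\wedge\mathbb G'\mid\mathbb G\vee\mathbb G'$. A goal without $\vee$ is *flat*. $\mathbb G\equiv_G\mathbb G'$ is the congruence generated by associativity and commutativity of $\wedge$, neutrality of $\top$ for $\wedge$, and distributivity of $\wedge$ over $\vee$. A *constraint theory* $CT$ is a set of closed formulas $\forall(\exists\bar x.\mathbb B\to\exists\bar x'.\mathbb B')$; $CT\models\varphi$ means that $\varphi$ (with its free variables read universally) is derivable from $CT$ in intuitionistic first-order logic. We assume that $CT$ is complete, in the sense that for every built-in constraint $\mathbb B$ either $CT\models\exists\mathbb B$ or $CT\models\exists\mathbb B\to\bot$ (existential closures), and that it treats $\doteq$ as equality: $CT\models t\doteq t$ and $CT\models (s\doteq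 t\wedge \mathbb B[x:=s])\to\mathbb B[x:=t]$ for all terms $s,t$, variables $x$ and built-in constraints $\mathbb B$. **States and configurations.** A *state* $\langle\mathbb G;\mathbb V\rangle$ is a goal with a finite set of global variables; it is flat if $\mathbb G$ is. The strictly local variables of $\langle\mathbb U\wedge\mathbb B;\mathbb V\rangle$ are $vars(\mathbb B)\setminus(\mathbb V\cup vars(\mathbb U))$. State equivalence $\equiv$ is the least equivalence relation with: (1) $\langle\mathbb G;\mathbb V\rangle\equiv\langle\mathbb G';\mathbb V\rangle$ if $\mathbb G\equiv_G\mathbb G'$; (2) $\langle\mathbb U\wedge x\doteq t\wedge\mathbb B;\mathbb V\rangle\equiv\langle\mathbb U[x:=t]\wedge x\doteq t\wedge\mathbb B;\mathbb V\rangle$; (3) $\langle\mathbb U\wedge\mathbb B;\mathbb V\rangle\equiv\langle\mathbb U\wedge\mathbb B';\mathbb V\rangle$ if $CT\models\exists\bar s.\mathbb B\leftrightarrow\exists\bar s'.\mathbb B'$, with $\bar s,\bar s'$ the respective strictly local variables; (4) $\langle\mathbb G;\{x\}\cup\mathbb V\rangle\equiv\langle\mathbb G;\mathbb V\rangle$ if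 $x\notin vars(\mathbb G)$; (5) $\langle\mathbb G\wedge\bot;\mathbb V\rangle\equiv\langle\mathbb G'\wedge\bot;\mathbb V'\rangle$. Put $S_\bot=\langle\top\wedge\bot;\emptyset\rangle$. State entailment $\rhd$ is the least preorder on states that contains $\equiv$ and satisfies $\langle\mathbb U\wedge\mathbb B;\mathbb V\rangle\rhd\langle\mathbb U\wedge\mathbb B';\mathbb V\rangle$ if $CT\models\exists\bar s.\mathbb B\to\exists\bar s'.\mathbb B'$, and $\langle\mathbb U\wedge\mathbb B;\{x\}\cup\mathbb V\rangle\rhd\langle\mathbb U\wedge\mathbb B;\mathbb V\rangle$. A *configuration* is a finite, possibly empty disjunction $S_1\vee\dots\vee S_n$ of states, taken up to order. Configuration equivalence is the least equivalence relation with: $S\vee\bar T$ equivalent to $S'\vee\bar T$ if $S\equiv S'$; $S_\bot\vee\bar T$ equivalent to $\bar T$; $\langle\mathbb G_1\vee\mathbb G_2;\mathbb V\rangle\vee\bar T$ equivalent to $\langle\mathbb G_1;\mathbb V\rangle\vee\langle\mathbb G_2;\mathbb V\rangle\vee\bar T$. The class of $\bar T$ is $[\bar T]$. A configuration is *compact*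 if it is not equivalent to any $S_1\vee S_2\vee\bar R$ with $S_1,S_2$ flat states, $S_1\not\equiv S_\bot$ and $S_1\rhd S_2$. **Programs.** A CHR$^\vee$ *program* is a finite set of rules $H_1\setminus H_2\Leftrightarrow G\mid B$ with $H_1,H_2$ user-defined constraints that are not both empty, $G$ a built-in constraint and $B$ a goal; the local variables of the rule are $\bar y_r=vars(B,G)\setminus vars(H_1,H_2)$. A variant of a rule renames its variables to pairwise distinct variables. Transitions are $$[\langle H_1\wedge H_2\wedge G\wedge\mathbb G;\mathbb V\rangle\vee\bar T]\mapsto[\langle H_1\wedge G\wedge B\wedge\mathbb G;\mathbb V\rangle\vee\bar T]$$ for variants $H_1\setminus H_2\Leftrightarrow G\mid B$ of rules of the program such that $\bar y_r$ is disjoint from $vars(H_1,H_2,\mathbb G)\cup\mathbb V$ and $CT\models\exists(G\wedge\mathbb G_b)$, where $\mathbb G_b$ is the built-in part of $\mathbb G$ (user-defined atoms replaced by $\top$). $\mapsto^*$ is the reflexive-transitive closure. A program is *confluent* if $[\bar S]\mapsto^*[\bar T]$ and $[\bar S]\mapsto^*[\bar U]$ always imply $[\bar T]\mapsto^*[\bar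 V]$ and $[\bar U]\mapsto^*[\bar V]$ for some $\bar V$. It is *analytic* if $\bar T$ is compact whenever $[S]\mapsto^*[\bar T]$ for a flat state $S$. The set of *data-sufficient answers* of a state $S$ is the set of all classes $[\langle\top\wedge\mathbb B_1;\mathbb V_1\rangle\vee\dots\vee\langle\top\wedge\mathbb B_n;\mathbb V_n\rangle]$ with $[S]\mapsto^*[\langle\top\wedge\mathbb B_1;\mathbb V_1\rangle\vee\dots\vee\langle\top\wedge\mathbb B_n;\mathbb V_n\rangle]$. **Linear-logic reading.** Goals are read in first-order intuitionistic linear logic by $c_u(\bar t)^L=c_u(\bar t)$, $c_b(\bar t)^L={!}c_b(\bar t)$, $\top^L=\mathbf 1$, $\bot^L=\mathbf 0$, $(\mathbb G\wedge\mathbb G')^L=\mathbb G^L\otimes\mathbb G'^L$, $(\mathbb G\vee\mathbb G')^L=\mathbb G^L\oplus\mathbb G'^L$. A rule is read as ${!}\forall\bigl(H_1^L\otimes H_2^L\otimes G^L\multimap H_1^L\otimes\exists\bar y_r.(B^L\otimes G^L)\bigr)$, and $\bigotimes\mathbb P^L$ is the multiplicative conjunction of the readings of the rules of $\mathbb P$.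 $CT^L$ consists of the translations $\alpha^*$ of the axioms $\alpha\in CT$, where $p(\bar t)^*={!}p(\bar t)$, $\bot^*=\mathbf 0$, $\top^*=\mathbf 1$, $(A\wedge B)^*=A^*\otimes B^*$, $(A\vee B)^*=A^*\oplus B^*$, $(A\to B)^*={!}(A^*\multimap B^*)$, $(\forall x.A)^*={!}\forall x.A^*$, $(\exists x.A)^*=\exists x.A^*$, together with all formulas ${!}\forall\bigl(c_u(\dots,x_j,\dots)\otimes{!}(x_j\doteq y)\multimap c_u(\dots,y,\dots)\otimes{!}(x_j\doteq y)\bigr)$ for user-defined symbols $c_u$ and argument positions $j$. $\alpha\multimapboth\beta$ abbreviates $(\alpha\multimap\beta)\mathbin{\&}(\beta\multimap\alpha)$. **Proposition.** Let $\mathbb P_1,\mathbb P_2$ be analytic, confluent CHR$^\vee$ programs that are logically equivalent under $CT$, i.e. $CT^L\vdash\bigotimes\mathbb P_1^L\multimapboth\bigotimes\mathbb P_2^L$. Then $\mathbb P_1$ and $\mathbb P_2$ are operationally $\mathcal S$-equivalent under $CT$: every state has the same set of data-sufficient answers in $\mathbb P_1$ and in $\mathbb P_2$. -/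

import Mathlib

universe u v w

namespace CHR

/-! ## Terms and substitutions

Terms are Mathlib's first-order terms over the function symbols of a language `L` with variables
named by natural numbers.  The relation symbols of `L` are the symbols of the built-in constraints
other than equality and falsity; `U n` is the type of `n`-ary user-defined constraint symbols.
Quantified formulas use de Bruijn indices: under a quantifier, variable `0` is the bound variable
and variable `n + 1` is the variable `n` of the context. -/

section Terms

variable {L : FirstOrder.Language.{u, v}}

/-- The substitution of the single variable `x` by the term `t`. -/
def single (x : ℕ) (t : L.Term ℕ) : ℕ → L.Term ℕ :=
  fun y => if y = x then t else .var y

/-- The substitution that shifts every variable by one. -/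
def shiftSubst : ℕ → L.Term ℕ := fun n => .var (n + 1)

/-- A substitution, transported under a quantifier. -/
def liftSubst (σ : ℕ → L.Term ℕ) : ℕ → L.Term ℕ
  | 0 => .var 0
  | n + 1 => (σ n).subst shiftSubst

/-- Instantiation of the outermost bound variable by `t`. -/
def instSubst (t : L.Term ℕ) : ℕ → L.Term ℕ
  | 0 => t
  | n + 1 => .var n

/-- Turns the free variable `x` into the bound variable `0` of a quantifier placed in front. -/
def bindSubst (x : ℕ) : ℕ → L.Term ℕ :=
  fun y => if y = x then .var 0 else .var (y + 1)

/-- The variables of a tuple of terms. -/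
def tupleVars {n : ℕ} (ts : Fin n → L.Term ℕ) : Finset ℕ :=
  Finset.univ.biUnion fun i => (ts i).varFinset

end Terms

/-! ## Intuitionistic first-order logic -/

/-- Formulas of intuitionistic first-order logic over the built-in constraints. -/
inductive IForm (L : FirstOrder.Language.{u, v}) : Type (max u v)
  | bot : IForm L
  | top : IForm L
  | eq (s t : L.Term ℕ) : IForm L
  | rel {n : ℕ} (c : L.Relations n) (ts : Fin n → L.Term ℕ) : IForm L
  | and (A B : IForm L) : IForm L
  | or (A B : IForm L) : IForm L
  | imp (A B : IForm L) : IForm L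
  | all (A : IForm L) : IForm L
  | ex (A : IForm L) : IForm L

namespace IForm

variable {L : FirstOrder.Language.{u, v}}

def subst : IForm L → (ℕ → L.Term ℕ) → IForm L
  | bot, _ => bot
  | top, _ => top
  | eq s t, σ => eq (s.subst σ) (t.subst σ)
  | rel c ts, σ => rel c fun i => (ts i).subst σ
  | and A B, σ => and (A.subst σ) (B.subst σ)
  | or A B, σ => or (A.subst σ) (B.subst σ)
  | imp A B, σ => imp (A.subst σ) (B.subst σ)
  | all A, σ => all (A.subst (liftSubst σ))
  | ex A, σ => ex (A.subst (liftSubst σ))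

def shift (A : IForm L) : IForm L := A.subst shiftSubst

/-- `∃ x. A` for a named variable `x`. -/
def exVar (x : ℕ) (A : IForm L) : IForm L := ex (A.subst (bindSubst x))

/-- `∀ x. A` for a named variable `x`. -/
def allVar (x : ℕ) (A : IForm L) : IForm L := all (A.subst (bindSubst x))

/-- `∃ x₁ … xₖ. A` for a finite set of variables. -/
def exVars (s : Finset ℕ) (A : IForm L) : IForm L := s.sort.foldr exVar A

/-- `∀ x₁ … xₖ. A` for a finite set of variables. -/
def allVars (s : Finset ℕ) (A : IForm L) : IForm L := s.sort.foldr allVar A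

/-- Natural deduction for intuitionistic first-order logic. -/
inductive Derives : Set (IForm L) → IForm L → Prop
  | ax {Γ A} : A ∈ Γ → Derives Γ A
  | topI {Γ} : Derives Γ top
  | botE {Γ A} : Derives Γ bot → Derives Γ A
  | andI {Γ A B} : Derives Γ A → Derives Γ B → Derives Γ (and A B)
  | andE₁ {Γ A B} : Derives Γ (and A B) → Derives Γ A
  | andE₂ {Γ A B} : Derives Γ (and A B) → Derives Γ B
  | orI₁ {Γ A B} : Derives Γ A → Derives Γ (or A B)
  | orI₂ {Γ A B} : Derives Γ B → Derives Γ (or A B)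
  | orE {Γ A B C} : Derives Γ (or A B) → Derives (insert A Γ) C → Derives (insert B Γ) C →
      Derives Γ C
  | impI {Γ A B} : Derives (insert A Γ) B → Derives Γ (imp A B)
  | impE {Γ A B} : Derives Γ (imp A B) → Derives Γ A → Derives Γ B
  | allI {Γ A} : Derives (shift '' Γ) A → Derives Γ (all A)
  | allE {Γ A} (t : L.Term ℕ) : Derives Γ (all A) → Derives Γ (A.subst (instSubst t))
  | exI {Γ A} (t : L.Term ℕ) : Derives Γ (A.subst (instSubst t)) → Derives Γ (ex A)
  | exE {Γ A C} : Derives Γ (ex A) → Derives (insert A (shift '' Γ)) (shift C) → Derives Γ C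

end IForm

/-! ## Intuitionistic linear logic -/

/-- Formulas of first-order intuitionistic linear logic over user-defined and built-in atoms. -/
inductive LForm (L : FirstOrder.Language.{u, v}) (U : ℕ → Type w) : Type (max u v w)
  | user {n : ℕ} (c : U n) (ts : Fin n → L.Term ℕ) : LForm L U
  | eq (s t : L.Term ℕ) : LForm L U
  | rel {n : ℕ} (c : L.Relations n) (ts : Fin n → L.Term ℕ) : LForm L U
  | one : LForm L U
  | zero : LForm L U
  | top : LForm L U
  | tensor (A B : LForm L U) : LForm L U
  | lolli (A B : LForm L U) : LForm L U
  | with_ (A B : LForm L U) : LForm L U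
  | plus (A B : LForm L U) : LForm L U
  | bang (A : LForm L U) : LForm L U
  | all (A : LForm L U) : LForm L U
  | ex (A : LForm L U) : LForm L U

namespace LForm

variable {L : FirstOrder.Language.{u, v}} {U : ℕ → Type w}

def subst : LForm L U → (ℕ → L.Term ℕ) → LForm L U
  | user c ts, σ => user c fun i => (ts i).subst σ
  | eq s t, σ => eq (s.subst σ) (t.subst σ)
  | rel c ts, σ => rel c fun i => (ts i).subst σ
  | one, _ => one
  | zero, _ => zero
  | top, _ => top
  | tensor A B, σ => tensor (A.subst σ) (B.subst σ)
  | lolli A B, σ => lolli (A.subst σ) (B.subst σ)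
  | with_ A B, σ => with_ (A.subst σ) (B.subst σ)
  | plus A B, σ => plus (A.subst σ) (B.subst σ)
  | bang A, σ => bang (A.subst σ)
  | all A, σ => all (A.subst (liftSubst σ))
  | ex A, σ => ex (A.subst (liftSubst σ))

def shift (A : LForm L U) : LForm L U := A.subst shiftSubst

def exVar (x : ℕ) (A : LForm L U) : LForm L U := ex (A.subst (bindSubst x))

def allVar (x : ℕ) (A : LForm L U) : LForm L U := all (A.subst (bindSubst x))

def exVars (s : Finset ℕ) (A : LForm L U) : LForm L U := s.sort.foldr exVar A

def allVars (s : Finset ℕ) (A : LForm L U) : LForm L U := s.sort.foldr allVar A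

/-- The sequent calculus of intuitionistic linear logic, without proper axioms. -/
inductive Derives : Multiset (LForm L U) → LForm L U → Prop
  | identity {A} : Derives {A} A
  | cut {Γ Δ A B} : Derives Γ A → Derives (A ::ₘ Δ) B → Derives (Γ + Δ) B
  | tensorL {Γ A B C} : Derives (A ::ₘ B ::ₘ Γ) C → Derives (tensor A B ::ₘ Γ) C
  | tensorR {Γ Δ A B} : Derives Γ A → Derives Δ B → Derives (Γ + Δ) (tensor A B)
  | oneL {Γ A} : Derives Γ A → Derives (one ::ₘ Γ) A
  | oneR : Derives 0 one
  | lolliL {Γ Δ A B C} : Derives Γ A → Derives (B ::ₘ Δ) C → Derives (lolli A B ::ₘ (Γ + Δ)) C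
  | lolliR {Γ A B} : Derives (A ::ₘ Γ) B → Derives Γ (lolli A B)
  | bangR {Γ A} : Derives (Multiset.map bang Γ) A → Derives (Multiset.map bang Γ) (bang A)
  | dereliction {Γ A B} : Derives (A ::ₘ Γ) B → Derives (bang A ::ₘ Γ) B
  | contraction {Γ A B} : Derives (bang A ::ₘ bang A ::ₘ Γ) B → Derives (bang A ::ₘ Γ) B
  | weakening {Γ A B} : Derives Γ B → Derives (bang A ::ₘ Γ) B
  | withL₁ {Γ A B C} : Derives (A ::ₘ Γ) C → Derives (with_ A B ::ₘ Γ) C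
  | withL₂ {Γ A B C} : Derives (B ::ₘ Γ) C → Derives (with_ A B ::ₘ Γ) C
  | withR {Γ A B} : Derives Γ A → Derives Γ B → Derives Γ (with_ A B)
  | topR {Γ} : Derives Γ top
  | plusL {Γ A B C} : Derives (A ::ₘ Γ) C → Derives (B ::ₘ Γ) C → Derives (plus A B ::ₘ Γ) C
  | plusR₁ {Γ A B} : Derives Γ A → Derives Γ (plus A B)
  | plusR₂ {Γ A B} : Derives Γ B → Derives Γ (plus A B)
  | zeroL {A} : Derives {zero} A
  | allL {Γ A B} (t : L.Term ℕ) : Derives (A.subst (instSubst t) ::ₘ Γ) B →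
      Derives (all A ::ₘ Γ) B
  | allR {Γ B} : Derives (Γ.map shift) B → Derives Γ (all B)
  | exL {Γ A B} : Derives (A ::ₘ Γ.map shift) (shift B) → Derives (ex A ::ₘ Γ) B
  | exR {Γ B} (t : L.Term ℕ) : Derives Γ (B.subst (instSubst t)) → Derives Γ (ex B)

/-- `Φ ⊢ A` for a (possibly infinite) set `Φ` of formulas. -/
def DerivesFrom (Φ : Set (LForm L U)) (A : LForm L U) : Prop :=
  ∃ Γ : Multiset (LForm L U), (∀ F ∈ Γ, F ∈ Φ) ∧ Derives Γ A

/-- Element-wise multiplicative conjunction. -/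
def bigTensor (l : List (LForm L U)) : LForm L U := l.foldr tensor one

/-- `A ⊸⊸ B`, that is, `(A ⊸ B) & (B ⊸ A)`. -/
def biLolli (A B : LForm L U) : LForm L U := with_ (lolli A B) (lolli B A)

end LForm

/-- The translation `(·)*` of intuitionistic logic into intuitionistic linear logic. -/
def IForm.star {L : FirstOrder.Language.{u, v}} (U : ℕ → Type w) : IForm L → LForm L U
  | .bot => .zero
  | .top => .one
  | .eq s t => .bang (.eq s t)
  | .rel c ts => .bang (.rel c ts)
  | .and A B => .tensor (A.star U) (B.star U)
  | .or A B => .plus (A.star U) (B.star U)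
  | .imp A B => .bang (.lolli (A.star U) (B.star U))
  | .all A => .bang (.all (A.star U))
  | .ex A => .ex (A.star U)

/-! ## Constraints and goals -/

/-- Built-in constraints. -/
inductive BC (L : FirstOrder.Language.{u, v}) : Type (max u v)
  | top : BC L
  | bot : BC L
  | eq (s t : L.Term ℕ) : BC L
  | rel {n : ℕ} (c : L.Relations n) (ts : Fin n → L.Term ℕ) : BC L
  | and (B B' : BC L) : BC L

/-- User-defined constraints. -/
inductive UC (L : FirstOrder.Language.{u, v}) (U : ℕ → Type w) : Type (max u v w)
  | top : UC L U
  | atom {n : ℕ} (c : U n) (ts : Fin n → L.Term ℕ) : UC L U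
  | and (A A' : UC L U) : UC L U

/-- Goals with disjunction. -/
inductive Goal (L : FirstOrder.Language.{u, v}) (U : ℕ → Type w) : Type (max u v w)
  | top : Goal L U
  | user {n : ℕ} (c : U n) (ts : Fin n → L.Term ℕ) : Goal L U
  | bot : Goal L U
  | eq (s t : L.Term ℕ) : Goal L U
  | rel {n : ℕ} (c : L.Relations n) (ts : Fin n → L.Term ℕ) : Goal L U
  | and (G G' : Goal L U) : Goal L U
  | or (G G' : Goal L U) : Goal L U

section Constraints

variable {L : FirstOrder.Language.{u, v}} {U : ℕ → Type w}

def BC.subst : BC L → (ℕ → L.Term ℕ) → BC L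
  | .top, _ => .top
  | .bot, _ => .bot
  | .eq s t, σ => .eq (s.subst σ) (t.subst σ)
  | .rel c ts, σ => .rel c fun i => (ts i).subst σ
  | .and B B', σ => .and (B.subst σ) (B'.subst σ)

def BC.vars : BC L → Finset ℕ
  | .top => ∅
  | .bot => ∅
  | .eq s t => s.varFinset ∪ t.varFinset
  | .rel _ ts => tupleVars ts
  | .and B B' => B.vars ∪ B'.vars

/-- A built-in constraint as a formula of intuitionistic logic. -/
def BC.form : BC L → IForm L
  | .top => .top
  | .bot => .bot
  | .eq s t => .eq s t
  | .rel c ts => .rel c ts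
  | .and B B' => .and B.form B'.form

/-- A built-in constraint as a goal. -/
def BC.goal (U : ℕ → Type w) : BC L → Goal L U
  | .top => .top
  | .bot => .bot
  | .eq s t => .eq s t
  | .rel c ts => .rel c ts
  | .and B B' => .and (B.goal U) (B'.goal U)

def UC.subst : UC L U → (ℕ → L.Term ℕ) → UC L U
  | .top, _ => .top
  | .atom c ts, σ => .atom c fun i => (ts i).subst σ
  | .and A A', σ => .and (A.subst σ) (A'.subst σ)

def UC.vars : UC L U → Finset ℕ
  | .top => ∅
  | .atom _ ts => tupleVars ts
  | .and A A' => A.vars ∪ A'.vars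

/-- A user-defined constraint as a goal. -/
def UC.goal : UC L U → Goal L U
  | .top => .top
  | .atom c ts => .user c ts
  | .and A A' => .and A.goal A'.goal

/-- The user-defined constraint contains at least one atom. -/
def UC.Nonempty : UC L U → Prop
  | .top => False
  | .atom _ _ => True
  | .and A A' => A.Nonempty ∨ A'.Nonempty

theorem UC.Nonempty.subst {A : UC L U} (h : A.Nonempty) (σ : ℕ → L.Term ℕ) :
    (A.subst σ).Nonempty := by
  induction A with
  | top => exact h
  | atom c ts => trivial
  | and A A' ih ih' => exact h.imp ih ih'

namespace Goal

def subst : Goal L U → (ℕ → L.Term ℕ) → Goal L U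
  | top, _ => top
  | user c ts, σ => user c fun i => (ts i).subst σ
  | bot, _ => bot
  | eq s t, σ => eq (s.subst σ) (t.subst σ)
  | rel c ts, σ => rel c fun i => (ts i).subst σ
  | and G G', σ => and (G.subst σ) (G'.subst σ)
  | or G G', σ => or (G.subst σ) (G'.subst σ)

def vars : Goal L U → Finset ℕ
  | top => ∅
  | user _ ts => tupleVars ts
  | bot => ∅
  | eq s t => s.varFinset ∪ t.varFinset
  | rel _ ts => tupleVars ts
  | and G G' => G.vars ∪ G'.vars
  | or G G' => G.vars ∪ G'.vars

/-- A goal without disjunction. -/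
def Flat : Goal L U → Prop
  | and G G' => G.Flat ∧ G'.Flat
  | or _ _ => False
  | _ => True

/-- The built-in part of a goal: user-defined atoms are dropped. For a flat goal this is the
conjunction of its built-in constraints. -/
def builtinForm : Goal L U → IForm L
  | top => .top
  | user _ _ => .top
  | bot => .bot
  | eq s t => .eq s t
  | rel c ts => .rel c ts
  | and G G' => .and G.builtinForm G'.builtinForm
  | or G G' => .or G.builtinForm G'.builtinForm

/-- The linear-logic reading of a goal. -/
def toLL : Goal L U → LForm L U
  | top => .one
  | user c ts => .user c ts
  | bot => .zero
  | eq s t => .bang (.eq s t)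
  | rel c ts => .bang (.rel c ts)
  | and G G' => .tensor G.toLL G'.toLL
  | or G G' => .plus G.toLL G'.toLL

/-- Goal equivalence: the congruence generated by associativity and commutativity of conjunction,
neutrality of `⊤`, and distributivity of conjunction over disjunction. -/
inductive Equiv : Goal L U → Goal L U → Prop
  | refl (G) : Equiv G G
  | symm {G G'} : Equiv G G' → Equiv G' G
  | trans {G G' G''} : Equiv G G' → Equiv G' G'' → Equiv G G''
  | andCongr {G G' K K'} : Equiv G G' → Equiv K K' → Equiv (and G K) (and G' K')
  | orCongr {G G' K K'} : Equiv G G' → Equiv K K' → Equiv (or G K) (or G' K')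
  | assoc (G G' G'') : Equiv (and (and G G') G'') (and G (and G' G''))
  | comm (G G') : Equiv (and G G') (and G' G)
  | topAnd (G) : Equiv (and top G) G
  | distrib (G G' G'') : Equiv (and G (or G' G'')) (or (and G G') (and G G''))

end Goal

end Constraints

/-! ## Constraint theories -/

/-- The data of a formula `∀ (∃ x̄. B → ∃ x̄'. B')`, with `x̄ = xs` and `x̄' = xs'`. -/
structure CTAxiom (L : FirstOrder.Language.{u, v}) : Type (max u v) where
  xs : Finset ℕ
  B : BC L
  xs' : Finset ℕ
  B' : BC L

/-- The closed formula `∀ (∃ x̄. B → ∃ x̄'. B')`. -/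
def CTAxiom.form {L : FirstOrder.Language.{u, v}} (α : CTAxiom L) : IForm L :=
  .allVars ((α.B.vars \ α.xs) ∪ (α.B'.vars \ α.xs'))
    (.imp (.exVars α.xs α.B.form) (.exVars α.xs' α.B'.form))

/-- A constraint theory, given by its set of axioms. -/
structure ConstraintTheory (L : FirstOrder.Language.{u, v}) : Type (max u v) where
  axioms : Set (CTAxiom L)

namespace ConstraintTheory

variable {L : FirstOrder.Language.{u, v}}

/-- `CT ⊨ A`; the free variables of `A` are read universally. -/
def Entails (CT : ConstraintTheory L) (A : IForm L) : Prop :=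
  IForm.Derives (CTAxiom.form '' CT.axioms) A

/-- Under `CT`, the built-in constraint `≐` is reflexive and equal terms may be substituted for
each other in built-in constraints. -/
def HasEquality (CT : ConstraintTheory L) : Prop :=
  (∀ t : L.Term ℕ, CT.Entails (.eq t t)) ∧
  ∀ (B : BC L) (x : ℕ) (s t : L.Term ℕ),
    CT.Entails (.imp (.and (.eq s t) (B.subst (single x s)).form) (B.subst (single x t)).form)

/-- `CT` decides the satisfiability of every built-in constraint. -/
def IsComplete (CT : ConstraintTheory L) : Prop :=
  ∀ B : BC L, CT.Entails (.exVars B.vars B.form) ∨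
    CT.Entails (.imp (.exVars B.vars B.form) .bot)

/-- The axiom `!∀(c(x₁,…,xⱼ,…,xₙ) ⊗ !(xⱼ ≐ y) ⊸ c(x₁,…,y,…,xₙ) ⊗ !(xⱼ ≐ y))`; the variables
`x₁,…,xₙ,y` are named `0,…,n-1,n`. -/
def userEqAxiom {U : ℕ → Type w} {n : ℕ} (c : U n) (j : Fin n) : LForm L U :=
  let x : Fin n → L.Term ℕ := fun i => .var (i : ℕ)
  let y : L.Term ℕ := .var n
  .bang (.allVars (Finset.range (n + 1))
    (.lolli (.tensor (.user c x) (.bang (.eq (x j) y)))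
      (.tensor (.user c (Function.update x j y)) (.bang (.eq (x j) y)))))

/-- The linear-logic reading of a constraint theory. -/
def toLL (CT : ConstraintTheory L) (U : ℕ → Type w) : Set (LForm L U) :=
  {F | ∃ α ∈ CT.axioms, F = α.form.star U} ∪
    {F | ∃ (n : ℕ) (c : U n) (j : Fin n), F = userEqAxiom c j}

end ConstraintTheory

/-! ## States and configurations -/

section Semantics

variable {L : FirstOrder.Language.{u, v}} {U : ℕ → Type w}

/-- A state `⟨G; V⟩`: a goal with a finite set of global variables. -/
structure State (L : FirstOrder.Language.{u, v}) (U : ℕ → Type w) : Type (max u v w) where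
  goal : Goal L U
  globals : Finset ℕ

/-- The state `⟨A ∧ B; V⟩` with user-defined store `A` and built-in store `B`. -/
def State.normal (A : UC L U) (B : BC L) (V : Finset ℕ) : State L U :=
  ⟨.and A.goal (B.goal U), V⟩

/-- The default failed state `⟨⊤; ⊥; ∅⟩`. -/
def State.failed : State L U := .normal .top .bot ∅

/-- The strictly local variables of the state `⟨A ∧ B; V⟩`. -/
def strictLocals (A : UC L U) (B : BC L) (V : Finset ℕ) : Finset ℕ :=
  ((A.vars ∪ B.vars) \ V) \ A.vars

/-- Equivalence of states. -/
inductive StateEquiv (CT : ConstraintTheory L) : State L U → State L U → Prop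
  | refl (S) : StateEquiv CT S S
  | symm {S T} : StateEquiv CT S T → StateEquiv CT T S
  | trans {S T R} : StateEquiv CT S T → StateEquiv CT T R → StateEquiv CT S R
  | goalTransformation {G G' : Goal L U} (V) : G.Equiv G' → StateEquiv CT ⟨G, V⟩ ⟨G', V⟩
  | eqSubst (A : UC L U) (x : ℕ) (t : L.Term ℕ) (B : BC L) (V) :
      StateEquiv CT (.normal A (.and (.eq (.var x) t) B) V)
        (.normal (A.subst (single x t)) (.and (.eq (.var x) t) B) V)
  | applyCT (A : UC L U) (B B' : BC L) (V) :
      CT.Entails (.imp (.exVars (strictLocals A B V) B.form)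
        (.exVars (strictLocals A B' V) B'.form)) →
      CT.Entails (.imp (.exVars (strictLocals A B' V) B'.form)
        (.exVars (strictLocals A B V) B.form)) →
      StateEquiv CT (.normal A B V) (.normal A B' V)
  | redundantGlobal (G : Goal L U) (x : ℕ) (V) : x ∉ G.vars →
      StateEquiv CT ⟨G, insert x V⟩ ⟨G, V⟩
  | failed (G G' : Goal L U) (V V') :
      StateEquiv CT ⟨.and G .bot, V⟩ ⟨.and G' .bot, V'⟩

/-- State entailment: the smallest preorder on states that contains state equivalence (that is, a
preorder on equivalence classes) and the two conditions below. -/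
inductive StateEntails (CT : ConstraintTheory L) : State L U → State L U → Prop
  | ofEquiv {S T} : StateEquiv CT S T → StateEntails CT S T
  | trans {S T R} : StateEntails CT S T → StateEntails CT T R → StateEntails CT S R
  | weakenBuiltin (A : UC L U) (B B' : BC L) (V) :
      CT.Entails (.imp (.exVars (strictLocals A B V) B.form)
        (.exVars (strictLocals A B' V) B'.form)) →
      StateEntails CT (.normal A B V) (.normal A B' V)
  | omitGlobal (A : UC L U) (B : BC L) (x : ℕ) (V) :
      StateEntails CT (.normal A B (insert x V)) (.normal A B V)

/-- Configurations are finite disjunctions of states. Multisets are used, which builds in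
associativity and commutativity of the disjunction and the role of the empty configuration. -/
abbrev Config (L : FirstOrder.Language.{u, v}) (U : ℕ → Type w) : Type (max u v w) :=
  Multiset (State L U)

/-- Equivalence of configurations. -/
inductive ConfigEquiv (CT : ConstraintTheory L) : Config L U → Config L U → Prop
  | refl (C) : ConfigEquiv CT C C
  | symm {C D} : ConfigEquiv CT C D → ConfigEquiv CT D C
  | trans {C D E} : ConfigEquiv CT C D → ConfigEquiv CT D E → ConfigEquiv CT C E
  | stateEquiv {S S' : State L U} (T : Config L U) : StateEquiv CT S S' →
      ConfigEquiv CT (S ::ₘ T) (S' ::ₘ T)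
  | failed (T : Config L U) : ConfigEquiv CT (State.failed ::ₘ T) T
  | split (G₁ G₂ : Goal L U) (V) (T : Config L U) :
      ConfigEquiv CT (⟨.or G₁ G₂, V⟩ ::ₘ T) (⟨G₁, V⟩ ::ₘ ⟨G₂, V⟩ ::ₘ T)

/-- Configurations with configuration equivalence. -/
def configSetoid (CT : ConstraintTheory L) (U : ℕ → Type w) : Setoid (Config L U) where
  r := ConfigEquiv CT
  iseqv := ⟨.refl, .symm, .trans⟩

/-- Equivalence classes of configurations. -/
abbrev ConfigClass (CT : ConstraintTheory L) (U : ℕ → Type w) : Type (max u v w) :=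
  Quotient (configSetoid CT U)

/-- The equivalence class `[C]` of a configuration. -/
def classOf (CT : ConstraintTheory L) (C : Config L U) : ConfigClass CT U :=
  Quotient.mk (configSetoid CT U) C

/-- A configuration is compact if it is not equivalent to any `S₁ ∨ S₂ ∨ R` with flat states
`S₁, S₂` such that `S₁` is not failed and `S₁` entails `S₂`. -/
def Compact (CT : ConstraintTheory L) (C : Config L U) : Prop :=
  ¬ ∃ (S₁ S₂ : State L U) (R : Config L U), ConfigEquiv CT C (S₁ ::ₘ S₂ ::ₘ R) ∧
    S₁.goal.Flat ∧ S₂.goal.Flat ∧ ¬ StateEquiv CT S₁ State.failed ∧ StateEntails CT S₁ S₂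

/-! ## Rules and programs -/

/-- A rule `H₁ \ H₂ ⇔ G | B`. -/
structure Rule (L : FirstOrder.Language.{u, v}) (U : ℕ → Type w) : Type (max u v w) where
  H₁ : UC L U
  H₂ : UC L U
  G : BC L
  B : Goal L U
  head_nonempty : H₁.Nonempty ∨ H₂.Nonempty

namespace Rule

/-- All variables of a rule. -/
def vars (R : Rule L U) : Finset ℕ := R.H₁.vars ∪ R.H₂.vars ∪ R.G.vars ∪ R.B.vars

/-- The local variables of a rule. -/
def localVars (R : Rule L U) : Finset ℕ := (R.B.vars ∪ R.G.vars) \ (R.H₁.vars ∪ R.H₂.vars)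

/-- Renaming of the variables of a rule. -/
def rename (R : Rule L U) (ρ : ℕ → ℕ) : Rule L U where
  H₁ := R.H₁.subst fun n => .var (ρ n)
  H₂ := R.H₂.subst fun n => .var (ρ n)
  G := R.G.subst fun n => .var (ρ n)
  B := R.B.subst fun n => .var (ρ n)
  head_nonempty := R.head_nonempty.imp (fun h => h.subst _) fun h => h.subst _

/-- `R'` arises from `R` by replacing its variables by pairwise distinct variables. -/
def IsVariant (R R' : Rule L U) : Prop :=
  ∃ ρ : ℕ → ℕ, Set.InjOn ρ (R.vars : Set ℕ) ∧ R' = R.rename ρ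

/-- The linear-logic reading `!∀(H₁ ⊗ H₂ ⊗ G ⊸ H₁ ⊗ ∃ ȳ. (B ⊗ G))` of a rule. -/
def toLL (R : Rule L U) : LForm L U :=
  let H₁ := R.H₁.goal.toLL
  let H₂ := R.H₂.goal.toLL
  let G := (R.G.goal U).toLL
  .bang (.allVars (R.H₁.vars ∪ R.H₂.vars ∪ R.G.vars)
    (.lolli (.tensor (.tensor H₁ H₂) G)
      (.tensor H₁ (.exVars R.localVars (.tensor R.B.toLL G)))))

end Rule

/-- A program is a finite set of rules. -/
abbrev Program (L : FirstOrder.Language.{u, v}) (U : ℕ → Type w) : Type (max u v w) :=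
  Finset (Rule L U)

/-- `⊗ Pᴸ`. -/
noncomputable def Program.tensorLL (P : Program L U) : LForm L U :=
  .bigTensor (P.toList.map Rule.toLL)

/-- A single transition between equivalence classes of configurations. -/
def Step (CT : ConstraintTheory L) (P : Program L U) (q q' : ConfigClass CT U) : Prop :=
  ∃ R ∈ P, ∃ R' : Rule L U, R.IsVariant R' ∧
    ∃ (K : Goal L U) (V : Finset ℕ) (T : Config L U),
      Disjoint R'.localVars (R'.H₁.vars ∪ R'.H₂.vars ∪ K.vars ∪ V) ∧
      CT.Entails (.exVars (R'.G.vars ∪ K.vars) (.and R'.G.form K.builtinForm)) ∧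
      q = classOf CT
        (⟨.and (.and (.and R'.H₁.goal R'.H₂.goal) (R'.G.goal U)) K, V⟩ ::ₘ T) ∧
      q' = classOf CT
        (⟨.and (.and (.and R'.H₁.goal (R'.G.goal U)) R'.B) K, V⟩ ::ₘ T)

/-- The reflexive-transitive closure of the transition relation. -/
def Steps (CT : ConstraintTheory L) (P : Program L U) :
    ConfigClass CT U → ConfigClass CT U → Prop :=
  Relation.ReflTransGen (Step CT P)

/-- Confluence of a program. -/
def Confluent (CT : ConstraintTheory L) (P : Program L U) : Prop :=
  ∀ q q₁ q₂ : ConfigClass CT U, Steps CT P q q₁ → Steps CT P q q₂ →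
    ∃ q₃, Steps CT P q₁ q₃ ∧ Steps CT P q₂ q₃

/-- A program is analytic if only compact configurations are reachable from flat states. -/
def Analytic (CT : ConstraintTheory L) (P : Program L U) : Prop :=
  ∀ (S : State L U) (T : Config L U), S.goal.Flat →
    Steps CT P (classOf CT {S}) (classOf CT T) → Compact CT T

/-- A configuration all of whose states have an empty user-defined store. -/
def DataSufficient (C : Config L U) : Prop :=
  ∀ S ∈ C, ∃ (B : BC L) (V : Finset ℕ), S = .normal .top B V

/-- The set of data-sufficient answers of a state. -/
def dataSufficientAnswers (CT : ConstraintTheory L) (P : Program L U) (S : State L U) :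
    Set (ConfigClass CT U) :=
  {q | ∃ C : Config L U, DataSufficient C ∧ q = classOf CT C ∧ Steps CT P (classOf CT {S}) q}

/-- Operational `S`-equivalence of programs. -/
def OperationallySEquivalent (CT : ConstraintTheory L) (P₁ P₂ : Program L U) : Prop :=
  ∀ S : State L U, dataSufficientAnswers CT P₁ S = dataSufficientAnswers CT P₂ S

/-- Logical equivalence of programs: `CTᴸ ⊢ ⊗ P₁ᴸ ⊸⊸ ⊗ P₂ᴸ`. -/
def LogicallyEquivalent (CT : ConstraintTheory L) (P₁ P₂ : Program L U) : Prop :=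
  LForm.DerivesFrom (CT.toLL U) (.biLolli P₁.tensorLL P₂.tensorLL)

end Semantics

end CHR

namespace CHR

/-! ## Substitution in terms -/

section TermSubst

variable {L : FirstOrder.Language.{u, v}}

/-! Transitions act on the disjuncts of a configuration independently. A configuration is therefore
represented by the multiset of the classes of its satisfiable flat disjuncts (`classNF`, `ofNF`),
and computation by rewriting one member of this multiset at a time (`FlatStep`). Classes of flat
states carry a relation `Le`: `s` is below `t` if `s` is an instance of `t` with a possibly stronger
built-in store and possibly more global variables.

Logical equivalence is exploited through phase semantics. Fix a multiset `T` of classes, and let `Q`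
hold of `s` if the program `P₂` leads from `s` to a disjunction each of whose members is below some
member of `T`. In the commutative monoid of flat goals take as pole the goals all of whose
satisfiable built-in extensions satisfy `Q` (`statePole`). In this model the linear-logic reading of
the constraint theory is valid (`statePole_toLL`), and the rules of `P₂` are valid because `Q` is
closed under backward transitions of `P₂` (`statePole_rule`). By soundness (`LForm.Derives.sound`)
the implication from `P₂` to `P₁` makes the rules of `P₁` valid. Read operationally, this says that
`Q`, in the form `Stable`, is inherited backward along transitions of `P₁` (`FlatStep.stable`).
Everything below a member of `T` satisfies `Q` by the empty run. Hence if `P₁` leads from `s` to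
`T`, then `P₂` leads from `s` to some `W` whose members are below members of `T`
(`FlatSteps.reaches`).

Now let `T` be data-sufficient. A live state below one with empty user-defined store has itself
empty user-defined store, so `W` is data-sufficient too. With the programs exchanged, `P₁` leads
from `s` to some `X` whose members are below members of `W`. Rule heads are nonempty, so neither `T`
nor `X` admits a transition, and confluence of `P₁` gives `X = T`. Thus `T` and `W` lie below each
other. Analyticity makes both antichains, and `Le` is antisymmetric on live states without
user-defined constraints, so `W = T` (`Antichain.eq`) and `P₂` reaches `T` as well
(`FlatSteps.transfer`). -/

theorem term_subst_congr {t : L.Term ℕ} {σ τ : ℕ → L.Term ℕ}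
    (h : ∀ x ∈ t.varFinset, σ x = τ x) : t.subst σ = t.subst τ := by
  induction t with
  | var x => exact h x (by simp [FirstOrder.Language.Term.varFinset])
  | func f ts ih =>
    simp only [FirstOrder.Language.Term.subst]
    congr 1
    funext i
    exact ih i fun x hx => h x (by
      simp only [FirstOrder.Language.Term.varFinset, Finset.mem_biUnion, Finset.mem_univ, true_and]
      exact ⟨i, hx⟩)

theorem term_subst_subst (t : L.Term ℕ) (σ τ : ℕ → L.Term ℕ) :
    (t.subst σ).subst τ = t.subst fun x => (σ x).subst τ := by
  induction t with
  | var x => rfl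
  | func f ts ih =>
    simp only [FirstOrder.Language.Term.subst]
    congr 1
    funext i
    exact ih i

theorem term_subst_var (t : L.Term ℕ) : t.subst .var = t := by
  induction t with
  | var x => rfl
  | func f ts ih =>
    simp only [FirstOrder.Language.Term.subst]
    congr 1
    funext i
    exact ih i

theorem mem_varFinset_subst {t : L.Term ℕ} {σ : ℕ → L.Term ℕ} {x : ℕ} :
    x ∈ (t.subst σ).varFinset ↔ ∃ y ∈ t.varFinset, x ∈ (σ y).varFinset := by
  induction t with
  | var y => simp [FirstOrder.Language.Term.varFinset, FirstOrder.Language.Term.subst]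
  | func f ts ih =>
    simp only [FirstOrder.Language.Term.subst, FirstOrder.Language.Term.varFinset,
      Finset.mem_biUnion, Finset.mem_univ, true_and, ih]
    tauto

@[simp] theorem mem_varFinset_var {x y : ℕ} :
    x ∈ (FirstOrder.Language.Term.var y : L.Term ℕ).varFinset ↔ x = y := by
  simp [FirstOrder.Language.Term.varFinset]

@[simp] theorem subst_var_apply (x : ℕ) (σ : ℕ → L.Term ℕ) :
    (FirstOrder.Language.Term.var x : L.Term ℕ).subst σ = σ x := rfl

theorem term_subst_eq_self {t : L.Term ℕ} {σ : ℕ → L.Term ℕ}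
    (h : ∀ x ∈ t.varFinset, σ x = .var x) : t.subst σ = t :=
  (term_subst_congr h).trans (term_subst_var t)

theorem mem_tupleVars {n : ℕ} {ts : Fin n → L.Term ℕ} {x : ℕ} :
    x ∈ tupleVars ts ↔ ∃ i, x ∈ (ts i).varFinset := by
  simp [tupleVars]

theorem liftSubst_comp (σ τ : ℕ → L.Term ℕ) :
    (fun x => (liftSubst σ x).subst (liftSubst τ)) = liftSubst fun x => (σ x).subst τ := by
  funext x
  cases x with
  | zero => rfl
  | succ n =>
    simp only [liftSubst, term_subst_subst]
    rfl

theorem liftSubst_var : liftSubst (L := L) .var = .var := by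
  funext x
  cases x <;> rfl

/-- The substitution mapping `0` to `t` and `n + 1` to `σ n`. -/
def consSubst (t : L.Term ℕ) (σ : ℕ → L.Term ℕ) : ℕ → L.Term ℕ
  | 0 => t
  | n + 1 => σ n

theorem liftSubst_instSubst (t : L.Term ℕ) (σ : ℕ → L.Term ℕ) :
    (fun x => (liftSubst σ x).subst (instSubst t)) = consSubst t σ := by
  funext x
  cases x with
  | zero => rfl
  | succ n =>
    simp only [liftSubst, term_subst_subst, consSubst]
    exact term_subst_var (σ n)

theorem instSubst_comp (t : L.Term ℕ) (σ : ℕ → L.Term ℕ) :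
    (fun x => (instSubst t x).subst σ) = consSubst (t.subst σ) σ := by
  funext x
  cases x <;> rfl

/-- Binding a named variable and instantiating it again only changes the value of the substitution
at that variable. This allows quantifier arguments to be conducted with named variables although
formulas use indices. -/
theorem bindSubst_consSubst (x : ℕ) (t : L.Term ℕ) (σ : ℕ → L.Term ℕ) :
    (fun y => (bindSubst x y).subst (consSubst t σ)) = Function.update σ x t := by
  funext y
  by_cases h : y = x
  · subst h; simp [bindSubst, consSubst]
  · simp [bindSubst, consSubst, h]

end TermSubst

/-! ### Intuitionistic derivability: substitution, cut, and quantifiers over named variables. -/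

namespace IForm

variable {L : FirstOrder.Language.{u, v}}

theorem subst_subst (A : IForm L) (σ τ : ℕ → L.Term ℕ) :
    (A.subst σ).subst τ = A.subst fun x => (σ x).subst τ := by
  induction A generalizing σ τ with
  | bot | top => rfl
  | eq s t => simp only [subst, term_subst_subst]
  | rel c ts => simp only [subst, term_subst_subst]
  | and A B ihA ihB | or A B ihA ihB | imp A B ihA ihB => simp only [subst, ihA, ihB]
  | all A ih | ex A ih => simp only [subst, ih, liftSubst_comp]

theorem subst_var (A : IForm L) : A.subst .var = A := by
  induction A with
  | bot | top => rfl
  | eq s t => simp only [subst, term_subst_var]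
  | rel c ts => simp only [subst, term_subst_var]
  | and A B ihA ihB | or A B ihA ihB | imp A B ihA ihB => simp only [subst, ihA, ihB]
  | all A ih | ex A ih => simp only [subst, liftSubst_var, ih]

/-- The effect of a substitution on `A` depends only on its values on `S`. -/
def DependsOn (A : IForm L) (S : Set ℕ) : Prop :=
  ∀ σ τ : ℕ → L.Term ℕ, (∀ x ∈ S, σ x = τ x) → A.subst σ = A.subst τ

theorem DependsOn.mono {A : IForm L} {S T : Set ℕ} (h : A.DependsOn S) (hST : S ⊆ T) :
    A.DependsOn T := fun σ τ hst => h σ τ fun x hx => hst x (hST hx)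

theorem DependsOn.imp {A B : IForm L} {S : Set ℕ} (hA : A.DependsOn S) (hB : B.DependsOn S) :
    (IForm.imp A B).DependsOn S := fun σ τ h => by
  simp only [subst, hA σ τ h, hB σ τ h]

theorem DependsOn.binder {A : IForm L} {S : Set ℕ} (h : A.DependsOn S) (x : ℕ)
    {σ τ : ℕ → L.Term ℕ} (hst : ∀ y ∈ S \ {x}, σ y = τ y) :
    (A.subst (bindSubst x)).subst (liftSubst σ) = (A.subst (bindSubst x)).subst (liftSubst τ) := by
  rw [subst_subst, subst_subst]
  refine h _ _ fun y hy => ?_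
  by_cases hyx : y = x
  · simp [bindSubst, hyx, liftSubst]
  · simp [bindSubst, hyx, liftSubst, hst y ⟨hy, hyx⟩]

theorem DependsOn.exVar {A : IForm L} {S : Set ℕ} (h : A.DependsOn S) (x : ℕ) :
    (A.exVar x).DependsOn (S \ {x}) := fun _ _ hst => congrArg ex (h.binder x hst)

theorem DependsOn.allVar {A : IForm L} {S : Set ℕ} (h : A.DependsOn S) (x : ℕ) :
    (A.allVar x).DependsOn (S \ {x}) := fun _ _ hst => congrArg all (h.binder x hst)

theorem DependsOn.foldr_exVar {A : IForm L} {S : Set ℕ} (h : A.DependsOn S) (l : List ℕ) :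
    (l.foldr IForm.exVar A).DependsOn (S \ {x | x ∈ l}) := by
  induction l with
  | nil => simpa using h
  | cons x l ih =>
    refine (ih.exVar x).mono ?_
    rintro y ⟨⟨hy, hyl⟩, hyx⟩
    exact ⟨hy, by simpa using ⟨hyx, hyl⟩⟩

theorem DependsOn.foldr_allVar {A : IForm L} {S : Set ℕ} (h : A.DependsOn S) (l : List ℕ) :
    (l.foldr IForm.allVar A).DependsOn (S \ {x | x ∈ l}) := by
  induction l with
  | nil => simpa using h
  | cons x l ih =>
    refine (ih.allVar x).mono ?_
    rintro y ⟨⟨hy, hyl⟩, hyx⟩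
    exact ⟨hy, by simpa using ⟨hyx, hyl⟩⟩

theorem DependsOn.exVars {A : IForm L} {S : Set ℕ} (h : A.DependsOn S) (s : Finset ℕ) :
    (A.exVars s).DependsOn (S \ s) :=
  (h.foldr_exVar (s.sort (· ≤ ·))).mono fun _ hx =>
    ⟨hx.1, fun hs => hx.2 ((Finset.mem_sort _).2 hs)⟩

theorem DependsOn.allVars {A : IForm L} {S : Set ℕ} (h : A.DependsOn S) (s : Finset ℕ) :
    (A.allVars s).DependsOn (S \ s) :=
  (h.foldr_allVar (s.sort (· ≤ ·))).mono fun _ hx =>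
    ⟨hx.1, fun hs => hx.2 ((Finset.mem_sort _).2 hs)⟩

/-- The variable `y` is irrelevant for substitutions into `A`. -/
def Fresh (y : ℕ) (A : IForm L) : Prop := A.subst (bindSubst y) = A.shift

theorem DependsOn.fresh {A : IForm L} {S : Set ℕ} (h : A.DependsOn S) {y : ℕ} (hy : y ∉ S) :
    Fresh y A := h _ _ fun x hx => by
  have : x ≠ y := fun e => hy (e ▸ hx)
  simp [bindSubst, this, shiftSubst]

theorem DependsOn.subst_eq_self {A : IForm L} (h : A.DependsOn ∅) (σ : ℕ → L.Term ℕ) :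
    A.subst σ = A := (h σ .var fun _ hx => hx.elim).trans A.subst_var

theorem image_shift_subst (Γ : Set (IForm L)) (σ : ℕ → L.Term ℕ) :
    (fun A => A.subst (liftSubst σ)) '' (shift '' Γ) = shift '' ((fun A => A.subst σ) '' Γ) := by
  simp only [Set.image_image, shift, subst_subst]
  rfl

theorem shift_subst_lift (A : IForm L) (σ : ℕ → L.Term ℕ) :
    A.shift.subst (liftSubst σ) = (A.subst σ).shift := by
  simp only [shift, subst_subst]
  rfl

theorem subst_inst_subst (A : IForm L) (t : L.Term ℕ) (σ : ℕ → L.Term ℕ) :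
    (A.subst (instSubst t)).subst σ = (A.subst (liftSubst σ)).subst (instSubst (t.subst σ)) := by
  rw [subst_subst, subst_subst, instSubst_comp, liftSubst_instSubst]

theorem Derives.subst {Γ : Set (IForm L)} {A : IForm L} (h : Derives Γ A) (σ : ℕ → L.Term ℕ) :
    Derives ((fun F => F.subst σ) '' Γ) (A.subst σ) := by
  induction h generalizing σ with
  | ax h => exact .ax ⟨_, h, rfl⟩
  | topI => exact .topI
  | botE _ ih => exact .botE (ih σ)
  | andI _ _ ih₁ ih₂ => exact .andI (ih₁ σ) (ih₂ σ)
  | andE₁ _ ih => exact .andE₁ (ih σ)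
  | andE₂ _ ih => exact .andE₂ (ih σ)
  | orI₁ _ ih => exact .orI₁ (ih σ)
  | orI₂ _ ih => exact .orI₂ (ih σ)
  | orE _ _ _ ih ih₁ ih₂ =>
    refine .orE (ih σ) ?_ ?_
    · simpa only [Set.image_insert_eq] using ih₁ σ
    · simpa only [Set.image_insert_eq] using ih₂ σ
  | impI _ ih => exact .impI (by simpa only [Set.image_insert_eq] using ih σ)
  | impE _ _ ih₁ ih₂ => exact .impE (ih₁ σ) (ih₂ σ)
  | allI _ ih => exact .allI (by simpa only [image_shift_subst] using ih (liftSubst σ))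
  | allE t _ ih =>
    rw [subst_inst_subst]
    exact .allE _ (ih σ)
  | exI t _ ih =>
    refine .exI (t.subst σ) ?_
    rw [← subst_inst_subst]
    exact ih σ
  | exE _ _ ih₁ ih₂ =>
    refine .exE (ih₁ σ) ?_
    have := ih₂ (liftSubst σ)
    rwa [Set.image_insert_eq, image_shift_subst, shift_subst_lift] at this

/-- Simultaneous cut. Weakening is proved beforehand by an induction of its own, because the
derivations of the hypotheses have to be carried under the insertions and shifts made by the
discharging rules. -/
theorem Derives.cutSet {Γ Δ : Set (IForm L)} {A : IForm L} (h : Derives Γ A)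
    (hΔ : ∀ F ∈ Γ, Derives Δ F) : Derives Δ A := by
  have mono : ∀ {Γ : Set (IForm L)} {A : IForm L}, Derives Γ A →
      ∀ Δ : Set (IForm L), Γ ⊆ Δ → Derives Δ A := by
    intro Γ A h
    induction h with
    | ax h => exact fun Δ hs => .ax (hs h)
    | topI => exact fun Δ hs => .topI
    | botE _ ih => exact fun Δ hs => .botE (ih Δ hs)
    | andI _ _ ih₁ ih₂ => exact fun Δ hs => .andI (ih₁ Δ hs) (ih₂ Δ hs)
    | andE₁ _ ih => exact fun Δ hs => .andE₁ (ih Δ hs)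
    | andE₂ _ ih => exact fun Δ hs => .andE₂ (ih Δ hs)
    | orI₁ _ ih => exact fun Δ hs => .orI₁ (ih Δ hs)
    | orI₂ _ ih => exact fun Δ hs => .orI₂ (ih Δ hs)
    | orE _ _ _ ih ih₁ ih₂ =>
      exact fun Δ hs => .orE (ih Δ hs) (ih₁ _ (Set.insert_subset_insert hs))
        (ih₂ _ (Set.insert_subset_insert hs))
    | impI _ ih => exact fun Δ hs => .impI (ih _ (Set.insert_subset_insert hs))
    | impE _ _ ih₁ ih₂ => exact fun Δ hs => .impE (ih₁ Δ hs) (ih₂ Δ hs)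
    | allI _ ih => exact fun Δ hs => .allI (ih _ (Set.image_mono hs))
    | allE t _ ih => exact fun Δ hs => .allE t (ih Δ hs)
    | exI t _ ih => exact fun Δ hs => .exI t (ih Δ hs)
    | exE _ _ ih₁ ih₂ =>
      exact fun Δ hs => .exE (ih₁ Δ hs) (ih₂ _ (Set.insert_subset_insert (Set.image_mono hs)))
  have ins : ∀ {Γ Δ : Set (IForm L)} (B : IForm L), (∀ F ∈ Γ, Derives Δ F) →
      ∀ F ∈ insert B Γ, Derives (insert B Δ) F := by
    rintro Γ Δ B h F (rfl | hF)
    · exact .ax (Set.mem_insert _ _)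
    · exact mono (h F hF) _ (Set.subset_insert _ _)
  have sh : ∀ {Γ Δ : Set (IForm L)}, (∀ F ∈ Γ, Derives Δ F) →
      ∀ F ∈ shift '' Γ, Derives (shift '' Δ) F := by
    rintro Γ Δ h _ ⟨F, hF, rfl⟩
    exact (h F hF).subst shiftSubst
  induction h generalizing Δ with
  | ax h => exact hΔ _ h
  | topI => exact .topI
  | botE _ ih => exact .botE (ih hΔ)
  | andI _ _ ih₁ ih₂ => exact .andI (ih₁ hΔ) (ih₂ hΔ)
  | andE₁ _ ih => exact .andE₁ (ih hΔ)
  | andE₂ _ ih => exact .andE₂ (ih hΔ)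
  | orI₁ _ ih => exact .orI₁ (ih hΔ)
  | orI₂ _ ih => exact .orI₂ (ih hΔ)
  | orE _ _ _ ih ih₁ ih₂ => exact .orE (ih hΔ) (ih₁ (ins _ hΔ)) (ih₂ (ins _ hΔ))
  | impI _ ih => exact .impI (ih (ins _ hΔ))
  | impE _ _ ih₁ ih₂ => exact .impE (ih₁ hΔ) (ih₂ hΔ)
  | allI _ ih => exact .allI (ih (sh hΔ))
  | allE t _ ih => exact .allE t (ih hΔ)
  | exI t _ ih => exact .exI t (ih hΔ)
  | exE _ _ ih₁ ih₂ => exact .exE (ih₁ hΔ) (ih₂ (ins _ (sh hΔ)))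

theorem Derives.mono {Γ Δ : Set (IForm L)} {A : IForm L} (h : Derives Γ A) (hs : Γ ⊆ Δ) :
    Derives Δ A := h.cutSet fun _ hF => .ax (hs hF)

theorem Derives.cut {Γ : Set (IForm L)} {A B : IForm L} (hA : Derives Γ A)
    (hB : Derives (insert A Γ) B) : Derives Γ B := .impE (.impI hB) hA

theorem exVar_subst_inst (A : IForm L) (x : ℕ) (t : L.Term ℕ) (σ : ℕ → L.Term ℕ) :
    ((A.subst (bindSubst x)).subst (liftSubst σ)).subst (instSubst t) =
      A.subst (Function.update σ x t) := by
  rw [subst_subst, subst_subst]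
  congr 1
  rw [← bindSubst_consSubst]
  funext y
  rw [liftSubst_instSubst]

theorem Derives.foldr_exVar_intro {Γ : Set (IForm L)} {A : IForm L} (l : List ℕ)
    {σ τ : ℕ → L.Term ℕ} (hst : ∀ x ∉ l, τ x = σ x) (h : Derives Γ (A.subst τ)) :
    Derives Γ ((l.foldr IForm.exVar A).subst σ) := by
  induction l generalizing σ with
  | nil =>
    have : τ = σ := funext fun x => hst x (by simp)
    exact this ▸ h
  | cons x l ih =>
    refine .exI (τ x) ?_
    rw [exVar_subst_inst]
    refine ih fun y hy => ?_
    by_cases hyx : y = x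
    · simp [hyx]
    · simp [hyx, hst y (by simp [hyx, hy])]

theorem Derives.exVars_intro {Γ : Set (IForm L)} {A : IForm L} {s : Finset ℕ}
    {σ τ : ℕ → L.Term ℕ} (hst : ∀ x ∉ s, τ x = σ x) (h : Derives Γ (A.subst τ)) :
    Derives Γ ((A.exVars s).subst σ) :=
  Derives.foldr_exVar_intro _ (fun x hx => hst x (by simpa using hx)) h

theorem Derives.exVars_intro' {Γ : Set (IForm L)} {A : IForm L} {s : Finset ℕ}
    {τ : ℕ → L.Term ℕ} (hst : ∀ x ∉ s, τ x = .var x) (h : Derives Γ (A.subst τ)) :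
    Derives Γ (A.exVars s) := by
  rw [← (A.exVars s).subst_var]
  exact h.exVars_intro hst

/-- The witness is named by a variable `y` that is fresh for the context, the conclusion and the
relevant values of `σ`. Applying `bindSubst y` to the given derivation turns `y` into the bound
variable `0` and shifts everything else, which yields the premise of `exE`. -/
theorem Derives.exVar_elim {Γ : Set (IForm L)} {A C : IForm L} {S : Set ℕ} (hA : A.DependsOn S)
    {x y : ℕ} {σ : ℕ → L.Term ℕ} (hy : ∀ z ∈ S \ {x}, y ∉ (σ z).varFinset)
    (hΓ : ∀ F ∈ Γ, Fresh y F) (hC : Fresh y C)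
    (h : Derives (insert (A.subst (Function.update σ x (.var y))) Γ) C) :
    Derives (insert ((A.exVar x).subst σ) Γ) C := by
  refine .exE (A := (A.subst (bindSubst x)).subst (liftSubst σ)) (.ax (Set.mem_insert _ _)) ?_
  have key := h.subst (bindSubst y)
  rw [hC, Set.image_insert_eq] at key
  refine key.mono ?_
  rw [Set.insert_subset_iff]
  constructor
  · left
    simp only [subst_subst]
    refine hA _ _ fun z hz => ?_
    by_cases hzx : z = x
    · simp [hzx, bindSubst, liftSubst]
    · simp only [Function.update_of_ne hzx, bindSubst, hzx, if_false, subst_var_apply, liftSubst]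
      refine term_subst_congr fun a ha => ?_
      have : a ≠ y := fun e => hy z ⟨hz, hzx⟩ (e ▸ ha)
      simp only [bindSubst, if_neg this, shiftSubst]
  · rintro _ ⟨F, hF, rfl⟩
    right
    exact ⟨F, Set.mem_insert_of_mem _ hF, (hΓ F hF).symm⟩

/-- Each quantified variable `x` is opened under the name `f x`. Injectivity of `f` on the list
keeps a name already in use from clashing with those opened later. -/
theorem Derives.foldr_exVar_elim {Γ : Set (IForm L)} {A C : IForm L} {S : Set ℕ}
    (hA : A.DependsOn S) (l : List ℕ) (hl : l.Nodup) {f : ℕ → ℕ}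
    (hf : ∀ x ∈ l, ∀ y ∈ l, f x = f y → x = y) {σ τ : ℕ → L.Term ℕ}
    (hτ : ∀ x ∉ l, τ x = σ x) (hτf : ∀ x ∈ l, τ x = .var (f x))
    (hσ : ∀ z ∈ S, z ∉ l → ∀ x ∈ l, f x ∉ (σ z).varFinset)
    (hΓ : ∀ F ∈ Γ, ∀ x ∈ l, Fresh (f x) F) (hC : ∀ x ∈ l, Fresh (f x) C)
    (h : Derives (insert (A.subst τ) Γ) C) :
    Derives (insert ((l.foldr IForm.exVar A).subst σ) Γ) C := by
  induction l generalizing σ with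
  | nil =>
    have : τ = σ := funext fun x => hτ x (by simp)
    exact this ▸ h
  | cons x l ih =>
    have hx : x ∉ l := (List.nodup_cons.1 hl).1
    refine Derives.exVar_elim (hA.foldr_exVar l) (y := f x) ?_ (fun F hF => hΓ F hF x (by simp))
      (hC x (by simp)) ?_
    · rintro z ⟨⟨hz, hzl⟩, hzx⟩
      exact hσ z hz (by simpa using ⟨hzx, hzl⟩) x (by simp)
    · refine ih (List.nodup_cons.1 hl).2 (fun a ha b hb => hf a (by simp [ha]) b (by simp [hb]))
        ?_ (fun a ha => hτf a (by simp [ha])) ?_ (fun F hF a ha => hΓ F hF a (by simp [ha]))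
        (fun a ha => hC a (by simp [ha]))
      · intro y hy
        by_cases hyx : y = x
        · subst hyx; simp [hτf]
        · simp [hyx, hτ y (by simp [hyx, hy])]
      · intro z hz hzl a ha
        by_cases hzx : z = x
        · subst hzx
          rw [Function.update_self, mem_varFinset_var]
          intro e
          exact hx (hf a (by simp [ha]) z (by simp) e ▸ ha)
        · rw [Function.update_of_ne hzx]
          exact hσ z hz (by simp [hzx, hzl]) a (by simp [ha])

theorem Derives.exVars_elim {Γ : Set (IForm L)} {A C : IForm L} {S : Set ℕ}
    (hA : A.DependsOn S) {s : Finset ℕ} {f : ℕ → ℕ} (hf : Set.InjOn f s) {σ τ : ℕ → L.Term ℕ}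
    (hτ : ∀ x ∉ s, τ x = σ x) (hτf : ∀ x ∈ s, τ x = .var (f x))
    (hσ : ∀ z ∈ S, z ∉ s → ∀ x ∈ s, f x ∉ (σ z).varFinset)
    (hΓ : ∀ F ∈ Γ, ∀ x ∈ s, Fresh (f x) F) (hC : ∀ x ∈ s, Fresh (f x) C)
    (h : Derives (insert (A.subst τ) Γ) C) :
    Derives (insert ((A.exVars s).subst σ) Γ) C :=
  Derives.foldr_exVar_elim hA (s.sort (· ≤ ·)) (s.sort_nodup _) (f := f)
    (fun x hx y hy => hf (by simpa using hx) (by simpa using hy))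
    (fun x hx => hτ x (by simpa using hx)) (fun x hx => hτf x (by simpa using hx))
    (fun z hz hzl x hx => hσ z hz (by simpa using hzl) x (by simpa using hx))
    (fun F hF x hx => hΓ F hF x (by simpa using hx)) (fun x hx => hC x (by simpa using hx)) h

theorem Derives.exVars_elim' {Γ : Set (IForm L)} {A C : IForm L} {s : Finset ℕ}
    (hΓ : ∀ F ∈ Γ, ∀ x ∈ s, Fresh x F) (hC : ∀ x ∈ s, Fresh x C)
    (h : Derives (insert A Γ) C) : Derives (insert (A.exVars s) Γ) C := by
  rw [← (A.exVars s).subst_var]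
  -- Dependence on all variables holds trivially; the variables are opened under their own names.
  refine Derives.exVars_elim (S := Set.univ) (f := id) (τ := .var)
    (fun σ τ h => by rw [funext fun x => h x trivial]) (fun _ _ _ _ h => h) (fun _ _ => rfl)
    (fun _ _ => rfl) ?_ hΓ hC (by rwa [subst_var])
  intro z _ hz x hx hxz
  rw [mem_varFinset_var] at hxz
  exact hz (by simpa [← hxz] using hx)

/-- Each quantifier is instantiated by the value `τ x` that is wanted in the end, so the
substitution is not altered. The range of `τ` in the hypothesis is harmless for closed formulas,
which ignore substitutions. -/
theorem Derives.foldr_allVar_elim {Γ : Set (IForm L)} {A : IForm L} (l : List ℕ)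
    (σ : ℕ → L.Term ℕ) (h : ∀ τ, (∀ x ∉ l, τ x = σ x) → Derives Γ ((l.foldr IForm.allVar A).subst τ)) :
    Derives Γ (A.subst σ) := by
  induction l with
  | nil => exact h σ fun _ _ => rfl
  | cons x l ih =>
    refine ih fun τ hτ => ?_
    have := (h τ fun y hy => hτ y fun hl => hy (by simp [hl])).allE (τ x)
    rwa [exVar_subst_inst, Function.update_eq_self] at this

end IForm

/-! ## Constraints, substitution and multisets of constraints -/

section Freshness

theorem exists_fresh_injection (F : Finset ℕ) :
    ∃ f : ℕ → ℕ, Function.Injective f ∧ ∀ x, f x ∉ F := by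
  refine ⟨fun x => x + (F.sup id + 1), fun x y h => by simpa using h, fun x hx => ?_⟩
  have := Finset.le_sup (f := id) hx
  simp only [id] at this
  omega

variable {L : FirstOrder.Language.{u, v}}

/-- A property of substitutions that is stable under replacing one value by a related one is
stable under replacing all values by related ones. -/
theorem subst_induction {S : Finset ℕ} {P : (ℕ → L.Term ℕ) → Prop}
    {R : L.Term ℕ → L.Term ℕ → Prop}
    (congr : ∀ σ τ : ℕ → L.Term ℕ, (∀ x ∈ S, σ x = τ x) → P σ → P τ)
    (step : ∀ (σ : ℕ → L.Term ℕ) (x : ℕ) (t : L.Term ℕ), R (σ x) t → P σ →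
      P (Function.update σ x t))
    {σ τ : ℕ → L.Term ℕ} (h : ∀ x ∈ S, R (σ x) (τ x)) (hσ : P σ) : P τ := by
  -- The values of `τ` are adopted along a growing subset `T` of `S`; elsewhere `σ` is kept.
  have key : ∀ T : Finset ℕ, T ⊆ S → P fun y => if y ∈ T then τ y else σ y := by
    intro T
    induction T using Finset.induction_on with
    | empty => intro _; simpa using hσ
    | insert x T hx ih =>
      intro hT
      have := step _ x (τ x) (by simpa [hx] using h x (hT (by simp)))
        (ih fun y hy => hT (by simp [hy]))
      refine congr _ _ (fun y _ => ?_) this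
      by_cases hyx : y = x
      · simp [hyx]
      · simp [hyx]
  exact congr _ _ (fun x hx => by simp [hx]) (key S subset_rfl)

/-- The variable `z` is a placeholder: a single substitution for `z` realises any change of `σ` at
`x`. General replacement is thereby reduced to the one-variable form in which equality is given. -/
theorem update_subst_single {S : Finset ℕ} {σ : ℕ → L.Term ℕ} {x z : ℕ} (t : L.Term ℕ)
    (hz : ∀ y ∈ S, z ∉ (σ y).varFinset) :
    ∀ y ∈ S, (Function.update σ x (.var z) y).subst (single z t) = Function.update σ x t y := by
  intro y hy
  by_cases hyx : y = x
  · subst hyx; simp [single]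
  · simp only [Function.update_of_ne hyx]
    refine term_subst_eq_self fun a ha => ?_
    have : a ≠ z := fun e => hz y hy (e ▸ ha)
    simp only [single, if_neg this]

end Freshness

section Constraints

variable {L : FirstOrder.Language.{u, v}} {U : ℕ → Type w}

theorem BC.subst_congr {b : BC L} {σ τ : ℕ → L.Term ℕ} (h : ∀ x ∈ b.vars, σ x = τ x) :
    b.subst σ = b.subst τ := by
  induction b with
  | top | bot => rfl
  | eq s t =>
    simp only [BC.vars, Finset.mem_union] at h
    simp only [BC.subst, term_subst_congr fun x hx => h x (.inl hx),
      term_subst_congr fun x hx => h x (.inr hx)]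
  | rel c ts =>
    simp only [BC.subst]
    congr 1
    funext i
    exact term_subst_congr fun x hx => h x (mem_tupleVars.2 ⟨i, hx⟩)
  | and b b' ih ih' =>
    simp only [BC.vars, Finset.mem_union] at h
    simp only [BC.subst, ih fun x hx => h x (.inl hx), ih' fun x hx => h x (.inr hx)]

theorem BC.subst_subst (b : BC L) (σ τ : ℕ → L.Term ℕ) :
    (b.subst σ).subst τ = b.subst fun x => (σ x).subst τ := by
  induction b with
  | top | bot => rfl
  | eq s t => simp only [BC.subst, term_subst_subst]
  | rel c ts => simp only [BC.subst, term_subst_subst]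
  | and b b' ih ih' => simp only [BC.subst, ih, ih']

theorem BC.subst_var (b : BC L) : b.subst .var = b := by
  induction b with
  | top | bot => rfl
  | eq s t => simp only [BC.subst, term_subst_var]
  | rel c ts => simp only [BC.subst, term_subst_var]
  | and b b' ih ih' => simp only [BC.subst, ih, ih']

theorem BC.mem_vars_subst {b : BC L} {σ : ℕ → L.Term ℕ} {x : ℕ} :
    x ∈ (b.subst σ).vars ↔ ∃ y ∈ b.vars, x ∈ (σ y).varFinset := by
  induction b with
  | top | bot => simp [BC.subst, BC.vars]
  | eq s t =>
    simp only [BC.subst, BC.vars, Finset.mem_union, mem_varFinset_subst]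
    grind
  | rel c ts =>
    simp only [BC.subst, BC.vars, mem_tupleVars, mem_varFinset_subst]
    grind
  | and b b' ih ih' =>
    simp only [BC.subst, BC.vars, Finset.mem_union, ih, ih']
    grind

theorem BC.form_subst (b : BC L) (σ : ℕ → L.Term ℕ) : (b.subst σ).form = b.form.subst σ := by
  induction b with
  | top | bot => rfl
  | eq s t => rfl
  | rel c ts => rfl
  | and b b' ih ih' => simp only [BC.subst, BC.form, IForm.subst, ih, ih']

theorem BC.form_dependsOn (b : BC L) : b.form.DependsOn b.vars := fun σ τ h => by
  rw [← b.form_subst, ← b.form_subst, BC.subst_congr h]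

theorem UC.subst_congr {a : UC L U} {σ τ : ℕ → L.Term ℕ} (h : ∀ x ∈ a.vars, σ x = τ x) :
    a.subst σ = a.subst τ := by
  induction a with
  | top => rfl
  | atom c ts =>
    simp only [UC.subst]
    congr 1
    funext i
    exact term_subst_congr fun x hx => h x (mem_tupleVars.2 ⟨i, hx⟩)
  | and a a' ih ih' =>
    simp only [UC.vars, Finset.mem_union] at h
    simp only [UC.subst, ih fun x hx => h x (.inl hx), ih' fun x hx => h x (.inr hx)]

theorem UC.subst_subst (a : UC L U) (σ τ : ℕ → L.Term ℕ) :
    (a.subst σ).subst τ = a.subst fun x => (σ x).subst τ := by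
  induction a with
  | top => rfl
  | atom c ts => simp only [UC.subst, term_subst_subst]
  | and a a' ih ih' => simp only [UC.subst, ih, ih']

theorem UC.subst_var (a : UC L U) : a.subst .var = a := by
  induction a with
  | top => rfl
  | atom c ts => simp only [UC.subst, term_subst_var]
  | and a a' ih ih' => simp only [UC.subst, ih, ih']

theorem UC.mem_vars_subst {a : UC L U} {σ : ℕ → L.Term ℕ} {x : ℕ} :
    x ∈ (a.subst σ).vars ↔ ∃ y ∈ a.vars, x ∈ (σ y).varFinset := by
  induction a with
  | top => simp [UC.subst, UC.vars]
  | atom c ts =>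
    simp only [UC.subst, UC.vars, mem_tupleVars, mem_varFinset_subst]
    grind
  | and b b' ih ih' =>
    simp only [UC.subst, UC.vars, Finset.mem_union, ih, ih']
    grind

/-- The variables of a multiset of built-in constraints. -/
def bvars (B : Multiset (BC L)) : Finset ℕ := (B.map BC.vars).sup

/-- The variables of a multiset of user-defined constraints. -/
def uvars (A : Multiset (UC L U)) : Finset ℕ := (A.map UC.vars).sup

theorem mem_multiset_sup {s : Multiset (Finset ℕ)} {x : ℕ} : x ∈ s.sup ↔ ∃ t ∈ s, x ∈ t := by
  induction s using Multiset.induction_on with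
  | empty => simp
  | cons t s ih => simp [ih]

theorem mem_bvars {B : Multiset (BC L)} {x : ℕ} : x ∈ bvars B ↔ ∃ b ∈ B, x ∈ b.vars := by
  simp [bvars, mem_multiset_sup]

theorem mem_uvars {A : Multiset (UC L U)} {x : ℕ} : x ∈ uvars A ↔ ∃ a ∈ A, x ∈ a.vars := by
  simp [uvars, mem_multiset_sup]

/-- Substitution in a multiset of built-in constraints. -/
def bsubst (B : Multiset (BC L)) (σ : ℕ → L.Term ℕ) : Multiset (BC L) := B.map fun b => b.subst σ

/-- Substitution in a multiset of user-defined constraints. -/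
def usubst (A : Multiset (UC L U)) (σ : ℕ → L.Term ℕ) : Multiset (UC L U) :=
  A.map fun a => a.subst σ

theorem bvars_add (B B' : Multiset (BC L)) : bvars (B + B') = bvars B ∪ bvars B' := by
  simp [bvars]

theorem uvars_add (A A' : Multiset (UC L U)) : uvars (A + A') = uvars A ∪ uvars A' := by
  simp [uvars]

@[simp] theorem bsubst_add (B B' : Multiset (BC L)) (σ : ℕ → L.Term ℕ) :
    bsubst (B + B') σ = bsubst B σ + bsubst B' σ := Multiset.map_add _ _ _

@[simp] theorem usubst_add (A A' : Multiset (UC L U)) (σ : ℕ → L.Term ℕ) :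
    usubst (A + A') σ = usubst A σ + usubst A' σ := Multiset.map_add _ _ _

@[simp] theorem usubst_zero (σ : ℕ → L.Term ℕ) : usubst (0 : Multiset (UC L U)) σ = 0 := rfl

theorem bsubst_congr {B : Multiset (BC L)} {σ τ : ℕ → L.Term ℕ}
    (h : ∀ x ∈ bvars B, σ x = τ x) : bsubst B σ = bsubst B τ :=
  Multiset.map_congr rfl fun _ hb => BC.subst_congr fun x hx => h x (mem_bvars.2 ⟨_, hb, hx⟩)

theorem usubst_congr {A : Multiset (UC L U)} {σ τ : ℕ → L.Term ℕ}
    (h : ∀ x ∈ uvars A, σ x = τ x) : usubst A σ = usubst A τ :=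
  Multiset.map_congr rfl fun _ ha => UC.subst_congr fun x hx => h x (mem_uvars.2 ⟨_, ha, hx⟩)

theorem bsubst_var (B : Multiset (BC L)) : bsubst B .var = B := by
  simp only [bsubst, BC.subst_var, Multiset.map_id']

theorem usubst_var (A : Multiset (UC L U)) : usubst A .var = A := by
  simp only [usubst, UC.subst_var, Multiset.map_id']

theorem bsubst_bsubst (B : Multiset (BC L)) (σ τ : ℕ → L.Term ℕ) :
    bsubst (bsubst B σ) τ = bsubst B fun x => (σ x).subst τ := by
  simp only [bsubst, Multiset.map_map, Function.comp_def, BC.subst_subst]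

theorem usubst_usubst (A : Multiset (UC L U)) (σ τ : ℕ → L.Term ℕ) :
    usubst (usubst A σ) τ = usubst A fun x => (σ x).subst τ := by
  simp only [usubst, Multiset.map_map, Function.comp_def, UC.subst_subst]

theorem bsubst_eq_self {B : Multiset (BC L)} {σ : ℕ → L.Term ℕ}
    (h : ∀ x ∈ bvars B, σ x = .var x) : bsubst B σ = B := (bsubst_congr h).trans (bsubst_var B)

theorem usubst_eq_self {A : Multiset (UC L U)} {σ : ℕ → L.Term ℕ}
    (h : ∀ x ∈ uvars A, σ x = .var x) : usubst A σ = A := (usubst_congr h).trans (usubst_var A)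

theorem mem_bsubst {B : Multiset (BC L)} {σ : ℕ → L.Term ℕ} {c : BC L} :
    c ∈ bsubst B σ ↔ ∃ b ∈ B, b.subst σ = c := Multiset.mem_map

theorem mem_bvars_bsubst {B : Multiset (BC L)} {σ : ℕ → L.Term ℕ} {x : ℕ} :
    x ∈ bvars (bsubst B σ) ↔ ∃ y ∈ bvars B, x ∈ (σ y).varFinset := by
  simp only [mem_bvars, mem_bsubst]
  constructor
  · rintro ⟨_, ⟨b, hb, rfl⟩, hx⟩
    obtain ⟨y, hy, hxy⟩ := BC.mem_vars_subst.1 hx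
    exact ⟨y, ⟨b, hb, hy⟩, hxy⟩
  · rintro ⟨y, ⟨b, hb, hy⟩, hxy⟩
    exact ⟨_, ⟨b, hb, rfl⟩, BC.mem_vars_subst.2 ⟨y, hy, hxy⟩⟩

theorem mem_uvars_usubst {A : Multiset (UC L U)} {σ : ℕ → L.Term ℕ} {x : ℕ} :
    x ∈ uvars (usubst A σ) ↔ ∃ y ∈ uvars A, x ∈ (σ y).varFinset := by
  simp only [mem_uvars, usubst, Multiset.mem_map]
  constructor
  · rintro ⟨_, ⟨b, hb, rfl⟩, hx⟩
    obtain ⟨y, hy, hxy⟩ := UC.mem_vars_subst.1 hx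
    exact ⟨y, ⟨b, hb, hy⟩, hxy⟩
  · rintro ⟨y, ⟨b, hb, hy⟩, hxy⟩
    exact ⟨_, ⟨b, hb, rfl⟩, UC.mem_vars_subst.2 ⟨y, hy, hxy⟩⟩

/-- The conjunction of a multiset of built-in constraints. -/
noncomputable def conjB (B : Multiset (BC L)) : BC L := B.toList.foldr .and .top

/-- The conjunction of a multiset of user-defined constraints. -/
noncomputable def conjU (A : Multiset (UC L U)) : UC L U := A.toList.foldr .and .top

theorem vars_conjB (B : Multiset (BC L)) : (conjB B).vars = bvars B := by
  have : ∀ l : List (BC L), (l.foldr BC.and .top).vars = bvars (l : Multiset (BC L)) := by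
    intro l
    induction l with
    | nil => rfl
    | cons b l ih => simp only [List.foldr, BC.vars, ih, bvars, ← Multiset.cons_coe,
        Multiset.map_cons, Multiset.sup_cons, Finset.sup_eq_union]
  rw [conjB, this, Multiset.coe_toList]

theorem vars_conjU (A : Multiset (UC L U)) : (conjU A).vars = uvars A := by
  have : ∀ l : List (UC L U), (l.foldr UC.and .top).vars = uvars (l : Multiset (UC L U)) := by
    intro l
    induction l with
    | nil => rfl
    | cons b l ih => simp only [List.foldr, UC.vars, ih, uvars, ← Multiset.cons_coe,
        Multiset.map_cons, Multiset.sup_cons, Finset.sup_eq_union]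
  rw [conjU, this, Multiset.coe_toList]

/-- The atoms of a built-in constraint. -/
def BC.atoms : BC L → Multiset (BC L)
  | .top => 0
  | .bot => {.bot}
  | .eq s t => {.eq s t}
  | .rel c ts => {.rel c ts}
  | .and b b' => b.atoms + b'.atoms

/-- The atoms of a user-defined constraint. -/
def UC.atoms : UC L U → Multiset (UC L U)
  | .top => 0
  | .atom c ts => {.atom c ts}
  | .and a a' => a.atoms + a'.atoms

theorem BC.bvars_atoms (b : BC L) : bvars b.atoms = b.vars := by
  induction b with
  | top => rfl
  | bot | eq | rel => simp [BC.atoms, bvars]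
  | and b b' ih ih' => simp only [BC.atoms, BC.vars, bvars_add, ih, ih']

theorem UC.uvars_atoms (a : UC L U) : uvars a.atoms = a.vars := by
  induction a with
  | top => rfl
  | atom => simp [UC.atoms, uvars]
  | and b b' ih ih' => simp only [UC.atoms, UC.vars, uvars_add, ih, ih']

theorem BC.atoms_subst (b : BC L) (σ : ℕ → L.Term ℕ) : (b.subst σ).atoms = bsubst b.atoms σ := by
  induction b with
  | top | bot | eq | rel => rfl
  | and b b' ih ih' => simp only [BC.atoms, BC.subst, bsubst_add, ih, ih']

theorem UC.atoms_subst (a : UC L U) (σ : ℕ → L.Term ℕ) : (a.subst σ).atoms = usubst a.atoms σ := by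
  induction a with
  | top | atom => rfl
  | and b b' ih ih' => simp only [UC.atoms, UC.subst, usubst_add, ih, ih']

theorem UC.atoms_ne_zero {a : UC L U} (h : a.Nonempty) : a.atoms ≠ 0 := by
  induction a with
  | top => exact h.elim
  | atom => simp [UC.atoms]
  | and a a' ih ih' =>
    rcases h with h | h
    · simp [UC.atoms, ih h]
    · simp [UC.atoms, ih' h]

end Constraints

/-! ## Entailment from built-in constraints -/

namespace ConstraintTheory

variable {L : FirstOrder.Language.{u, v}} (CT : ConstraintTheory L)

/-- `A` follows from `CT` and the constraints in `B`. -/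
def Ent (B : Multiset (BC L)) (A : IForm L) : Prop :=
  IForm.Derives (CTAxiom.form '' CT.axioms ∪ {F | ∃ b ∈ B, F = b.form}) A

variable {CT}

/-- Closed axioms are fixed by every substitution. Hence entailments can be instantiated without
touching the theory, and every variable may serve as an eigenvariable. -/
theorem axiom_closed {F : IForm L} (h : F ∈ CTAxiom.form '' CT.axioms) : F.DependsOn ∅ := by
  obtain ⟨α, -, rfl⟩ := h
  refine IForm.DependsOn.mono (IForm.DependsOn.allVars (IForm.DependsOn.imp
    (((α.B.form_dependsOn).exVars α.xs).mono (T := ((α.B.vars \ α.xs) ∪ (α.B'.vars \ α.xs') :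
      Finset ℕ)) ?_) (((α.B'.form_dependsOn).exVars α.xs').mono ?_)) _) ?_
  · intro x hx; simp at hx ⊢; tauto
  · intro x hx; simp at hx ⊢; tauto
  · intro x hx; exact (hx.2 hx.1).elim

theorem fresh_axiom {F : IForm L} (h : F ∈ CTAxiom.form '' CT.axioms) (x : ℕ) :
    IForm.Fresh x F := (axiom_closed h).fresh (Set.notMem_empty x)

theorem entails_iff {A : IForm L} : CT.Entails A ↔ CT.Ent 0 A := by
  simp [Entails, Ent]

theorem Entails.ent {A : IForm L} (h : CT.Entails A) (B : Multiset (BC L)) : CT.Ent B A :=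
  IForm.Derives.mono h Set.subset_union_left

theorem Ent.of_mem {B : Multiset (BC L)} {b : BC L} (h : b ∈ B) : CT.Ent B b.form :=
  .ax (.inr ⟨b, h, rfl⟩)

theorem Ent.trans {B B' : Multiset (BC L)} {A : IForm L} (h : ∀ b ∈ B', CT.Ent B b.form)
    (h' : CT.Ent B' A) : CT.Ent B A := by
  refine IForm.Derives.cutSet h' ?_
  rintro F (hF | ⟨b, hb, rfl⟩)
  · exact .ax (.inl hF)
  · exact h b hb

theorem Ent.mono {B B' : Multiset (BC L)} {A : IForm L} (h : CT.Ent B A) (hB : B ⊆ B') :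
    CT.Ent B' A := Ent.trans (fun _ hb => .of_mem (hB hb)) h

theorem Ent.subst {B : Multiset (BC L)} {A : IForm L} (h : CT.Ent B A) (σ : ℕ → L.Term ℕ) :
    CT.Ent (bsubst B σ) (A.subst σ) := by
  refine IForm.Derives.mono (IForm.Derives.subst h σ) ?_
  rintro _ ⟨F, hF | ⟨b, hb, rfl⟩, rfl⟩
  · left
    simpa only [(axiom_closed hF).subst_eq_self] using hF
  · exact .inr ⟨b.subst σ, mem_bsubst.2 ⟨b, hb, rfl⟩, (b.form_subst σ).symm⟩

theorem Ent.bsubst {B B' : Multiset (BC L)} (h : ∀ b ∈ B', CT.Ent B b.form) (σ : ℕ → L.Term ℕ) :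
    ∀ b ∈ bsubst B' σ, CT.Ent (bsubst B σ) b.form := by
  intro c hc
  obtain ⟨b, hb, rfl⟩ := mem_bsubst.1 hc
  rw [b.form_subst]
  exact (h b hb).subst σ

theorem derives_conjB_subst {Γ : Set (IForm L)} {B : Multiset (BC L)} {σ : ℕ → L.Term ℕ} :
    IForm.Derives Γ ((conjB B).form.subst σ) ↔
      ∀ b ∈ CHR.bsubst B σ, IForm.Derives Γ b.form := by
  have : ∀ l : List (BC L), IForm.Derives Γ ((l.foldr BC.and .top).form.subst σ) ↔
      ∀ b ∈ l, IForm.Derives Γ (b.subst σ).form := by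
    intro l
    induction l with
    | nil => exact ⟨fun _ b hb => by simp at hb, fun _ => .topI⟩
    | cons b l ih =>
      rw [List.forall_mem_cons, ← ih, b.form_subst]
      exact ⟨fun h => ⟨.andE₁ h, .andE₂ h⟩, fun h => .andI h.1 h.2⟩
  rw [conjB, this]
  simp [mem_bsubst]

theorem derives_conjB {Γ : Set (IForm L)} {B : Multiset (BC L)} :
    IForm.Derives Γ (conjB B).form ↔ ∀ b ∈ B, IForm.Derives Γ b.form := by
  rw [← (conjB B).form.subst_var, derives_conjB_subst, bsubst_var]

theorem ent_conjB {B B' : Multiset (BC L)} :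
    CT.Ent B (conjB B').form ↔ ∀ b ∈ B', CT.Ent B b.form := derives_conjB

theorem derives_atoms {Γ : Set (IForm L)} {b : BC L} :
    IForm.Derives Γ b.form ↔ ∀ a ∈ b.atoms, IForm.Derives Γ a.form := by
  induction b with
  | top => exact ⟨fun _ b hb => by simp [BC.atoms] at hb, fun _ => .topI⟩
  | bot | eq | rel => simp [BC.atoms]
  | and b b' ih ih' =>
    have : IForm.Derives Γ (b.and b').form ↔ IForm.Derives Γ b.form ∧ IForm.Derives Γ b'.form :=
      ⟨fun h => ⟨.andE₁ h, .andE₂ h⟩, fun h => .andI h.1 h.2⟩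
    simp only [this, ih, ih', BC.atoms, Multiset.mem_add]
    grind

theorem ent_atoms {B : Multiset (BC L)} {b : BC L} :
    CT.Ent B b.form ↔ ∀ a ∈ b.atoms, CT.Ent B a.form := derives_atoms

theorem ent_of_insert_conjB {B : Multiset (BC L)} {A : IForm L} :
    IForm.Derives (insert (conjB B).form (CTAxiom.form '' CT.axioms)) A ↔ CT.Ent B A := by
  constructor
  · intro h
    refine IForm.Derives.cut (ent_conjB.2 fun b hb => Ent.of_mem hb) (h.mono ?_)
    exact Set.insert_subset_insert Set.subset_union_left
  · intro h
    refine h.cutSet ?_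
    rintro F (hF | ⟨b, hb, rfl⟩)
    · exact .ax (.inr hF)
    · exact derives_conjB.1 (.ax (Set.mem_insert _ _)) b hb

/-- A closed axiom is unchanged by substitution, so its outer quantifiers can be instantiated by `σ`
itself. -/
theorem Ent.apply_theory {α : CTAxiom L} (hα : α ∈ CT.axioms) {B : Multiset (BC L)} {σ : ℕ → L.Term ℕ}
    (h : CT.Ent B ((IForm.exVars α.xs α.B.form).subst σ)) :
    CT.Ent B ((IForm.exVars α.xs' α.B'.form).subst σ) := by
  refine IForm.Derives.impE ?_ h
  refine IForm.Derives.foldr_allVar_elim (A := .imp _ _)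
    ((((α.B.vars \ α.xs) ∪ (α.B'.vars \ α.xs')).sort (· ≤ ·))) σ fun τ _ => ?_
  have hm : α.form ∈ CTAxiom.form '' CT.axioms := ⟨α, hα, rfl⟩
  have := (axiom_closed hm).subst_eq_self τ
  rw [CTAxiom.form, IForm.allVars] at this
  rw [this]
  exact .ax (.inl hm)

/-- Existential constraints as consequences: the quantified variables may be renamed. -/
theorem Ent.exVars_trans {B B' : Multiset (BC L)} {A : IForm L} {s : Finset ℕ}
    (hA : ∀ x ∈ s, IForm.Fresh x A) (h : CT.Ent B (.exVars s (conjB B').form))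
    (h' : CT.Ent B' A) : CT.Ent B A := by
  refine .impE (.impI ?_) h
  refine (IForm.Derives.exVars_elim' (Γ := CTAxiom.form '' CT.axioms)
    (fun F hF x _ => fresh_axiom hF x) hA (ent_of_insert_conjB.2 h')).mono ?_
  exact Set.insert_subset_insert Set.subset_union_left

theorem Ent.exVars_intro {B B' : Multiset (BC L)} {s : Finset ℕ} {σ τ : ℕ → L.Term ℕ}
    (hst : ∀ x ∉ s, x ∈ bvars B' → τ x = σ x) (h : ∀ b ∈ CHR.bsubst B' τ, CT.Ent B b.form) :
    CT.Ent B ((IForm.exVars s (conjB B').form).subst σ) := by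
  refine IForm.Derives.exVars_intro (τ := fun x => if x ∈ s then τ x else σ x)
    (fun x hx => by simp [hx]) (derives_conjB_subst.2 ?_)
  change ∀ b ∈ CHR.bsubst B' _, CT.Ent B b.form
  rwa [bsubst_congr (τ := τ)]
  intro x hx
  by_cases hxs : x ∈ s
  · simp [hxs]
  · simp [hxs, hst x hxs hx]

theorem Ent.exVars_intro' {B B' : Multiset (BC L)} {s : Finset ℕ} {τ : ℕ → L.Term ℕ}
    (hst : ∀ x ∉ s, x ∈ bvars B' → τ x = .var x) (h : ∀ b ∈ CHR.bsubst B' τ, CT.Ent B b.form) :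
    CT.Ent B (IForm.exVars s (conjB B').form) := by
  rw [← (IForm.exVars s (conjB B').form).subst_var]
  exact Ent.exVars_intro hst h

/-- Instances of existential constraints as existential constraints over fresh variables. -/
theorem Ent.exVars_subst {B : Multiset (BC L)} {b : BC L} {s : Finset ℕ} {σ τ : ℕ → L.Term ℕ}
    {f : ℕ → ℕ} (h : CT.Ent B ((IForm.exVars s b.form).subst σ)) (hf : Function.Injective f)
    (hτ : ∀ x ∉ s, τ x = σ x) (hτf : ∀ x ∈ s, τ x = .var (f x))
    (hσ : ∀ z ∈ b.vars, z ∉ s → ∀ x, f x ∉ (σ z).varFinset) :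
    CT.Ent B (IForm.exVars (s.image f) (b.subst τ).form) := by
  refine .impE (.impI ?_) h
  have hdep : (IForm.exVars (s.image f) (b.subst τ).form).DependsOn
      ((b.subst τ).vars \ (s.image f : Finset ℕ)) := (BC.form_dependsOn _).exVars _
  refine (IForm.Derives.exVars_elim (Γ := CTAxiom.form '' CT.axioms) (BC.form_dependsOn b)
    hf.injOn hτ hτf ?_ (fun F hF x _ => fresh_axiom hF _) (fun x hx => hdep.fresh ?_) ?_).mono
    (Set.insert_subset_insert Set.subset_union_left)
  · exact fun z hz hzs x _ => hσ z (by simpa using hz) hzs x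
  · rintro ⟨-, hx'⟩
    exact hx' (by simpa using ⟨x, hx, rfl⟩)
  · refine IForm.Derives.exVars_intro' (τ := .var) (fun _ _ => rfl) ?_
    rw [IForm.subst_var, b.form_subst]
    exact .ax (Set.mem_insert _ _)

/-- The constraints in `B` are unsatisfiable. -/
def Unsat (CT : ConstraintTheory L) (B : Multiset (BC L)) : Prop := CT.Ent B .bot

theorem Unsat.of_ent {B B' : Multiset (BC L)} (h : CT.Unsat B') (hB : ∀ b ∈ B', CT.Ent B b.form) :
    CT.Unsat B := Ent.trans hB h

theorem Unsat.mono {B B' : Multiset (BC L)} (h : CT.Unsat B') (hB : B' ⊆ B) : CT.Unsat B :=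
  h.of_ent fun _ hb => .of_mem (hB hb)

theorem Unsat.of_subst {B B' : Multiset (BC L)} (h : CT.Unsat B') {σ : ℕ → L.Term ℕ}
    (hB : ∀ b ∈ CHR.bsubst B' σ, CT.Ent B b.form) : CT.Unsat B :=
  Ent.trans hB (Ent.subst h σ)

/-! ### Equality -/

theorem HasEquality.refl (hEq : CT.HasEquality) (B : Multiset (BC L)) (t : L.Term ℕ) :
    CT.Ent B (BC.eq t t).form := (hEq.1 t).ent B

theorem HasEquality.replace (hEq : CT.HasEquality) {B : Multiset (BC L)} {s t : L.Term ℕ}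
    (h : CT.Ent B (BC.eq s t).form) (b : BC L) (x : ℕ)
    (hb : CT.Ent B (b.subst (single x s)).form) : CT.Ent B (b.subst (single x t)).form :=
  .impE ((hEq.2 b x s t).ent B) (.andI h hb)

/-- In the constraint `x ≐ s`, with `x` not occurring in `s`, replacing the value `s` of `x` by `t`
turns `s ≐ s` into `t ≐ s`. -/
theorem HasEquality.symm (hEq : CT.HasEquality) {B : Multiset (BC L)} {s t : L.Term ℕ}
    (h : CT.Ent B (BC.eq s t).form) : CT.Ent B (BC.eq t s).form := by
  obtain ⟨x, hx⟩ := Infinite.exists_notMem_finset s.varFinset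
  have hs : ∀ r : L.Term ℕ, s.subst (single x r) = s := fun r =>
    term_subst_eq_self fun y hy => by
      have : y ≠ x := fun e => hx (e ▸ hy)
      simp only [single, if_neg this]
  have := hEq.replace h (.eq (.var x) s) x (by
    simpa [BC.subst, hs, single] using hEq.refl B s)
  simpa [BC.subst, hs, single] using this

theorem HasEquality.congr (hEq : CT.HasEquality) {B : Multiset (BC L)} {b : BC L}
    {σ τ : ℕ → L.Term ℕ} (h : ∀ x ∈ b.vars, CT.Ent B (BC.eq (σ x) (τ x)).form)
    (hb : CT.Ent B (b.subst σ).form) : CT.Ent B (b.subst τ).form := by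
  refine subst_induction (S := b.vars) (P := fun σ => CT.Ent B (b.subst σ).form)
    (R := fun s t => CT.Ent B (BC.eq s t).form)
    (fun σ τ h hσ => by rwa [← BC.subst_congr h]) (fun σ x t hR hσ => ?_) h hb
  -- The fresh `z` marks the occurrences that come from `x`, so that single-variable replacement
  -- applies to exactly these.
  obtain ⟨z, hz⟩ := Infinite.exists_notMem_finset (b.vars.biUnion fun y => (σ y).varFinset)
  have key : ∀ r : L.Term ℕ, (b.subst (Function.update σ x (.var z))).subst (single z r) =
      b.subst (Function.update σ x r) := fun r => by
    rw [BC.subst_subst]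
    refine BC.subst_congr (update_subst_single r fun y hy hzy => hz ?_)
    exact Finset.mem_biUnion.2 ⟨y, hy, hzy⟩
  rw [← key]
  refine hEq.replace hR _ z ?_
  rwa [key, Function.update_eq_self]

end ConstraintTheory

/-! ## Disjunctive normal forms of goals -/

section NormalForm

variable {L : FirstOrder.Language.{u, v}} {U : ℕ → Type w}

namespace Goal

theorem Equiv.andTop (G : Goal L U) : (Goal.and G top).Equiv G := (Equiv.comm _ _).trans (.topAnd _)

theorem Equiv.leftComm (G G' G'' : Goal L U) :
    (Goal.and G (.and G' G'')).Equiv (.and G' (.and G G'')) :=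
  (Equiv.assoc _ _ _).symm.trans (((Equiv.comm _ _).andCongr (.refl _)).trans (.assoc _ _ _))

theorem Equiv.andAndComm (G₁ G₂ G₃ G₄ : Goal L U) :
    (Goal.and (.and G₁ G₂) (.and G₃ G₄)).Equiv (.and (.and G₁ G₃) (.and G₂ G₄)) :=
  (Equiv.assoc _ _ _).trans (((Equiv.refl _).andCongr (.leftComm _ _ _)).trans
    (Equiv.assoc _ _ _).symm)

/-- The conjunction of a list of goals. -/
def conj (l : List (Goal L U)) : Goal L U := l.foldr .and .top

theorem conj_perm {l l' : List (Goal L U)} (h : l.Perm l') : (conj l).Equiv (conj l') := by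
  induction h with
  | nil => exact .refl _
  | cons G _ ih => exact (Equiv.refl G).andCongr ih
  | swap G G' l => exact .leftComm _ _ _
  | trans _ _ ih ih' => exact ih.trans ih'

theorem conj_append (l l' : List (Goal L U)) :
    (conj (l ++ l')).Equiv (.and (conj l) (conj l')) := by
  induction l with
  | nil => exact (Equiv.topAnd _).symm
  | cons G l ih => exact ((Equiv.refl G).andCongr ih).trans (Equiv.assoc _ _ _).symm

end Goal

theorem conjU_goal (A : Multiset (UC L U)) :
    (conjU A).goal = Goal.conj (A.toList.map UC.goal) := by
  rw [conjU]
  induction A.toList with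
  | nil => rfl
  | cons a l ih => simp only [List.foldr, UC.goal, ih, List.map, Goal.conj]

theorem conjB_goal (B : Multiset (BC L)) :
    (conjB B).goal U = Goal.conj (B.toList.map (BC.goal U)) := by
  rw [conjB]
  induction B.toList with
  | nil => rfl
  | cons a l ih => simp only [List.foldr, BC.goal, ih, List.map, Goal.conj]

theorem conjU_goal_coe (l : List (UC L U)) :
    (conjU (l : Multiset (UC L U))).goal.Equiv (Goal.conj (l.map UC.goal)) := by
  rw [conjU_goal]
  exact Goal.conj_perm ((Multiset.coe_eq_coe.1 (Multiset.coe_toList _)).map _)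

theorem conjB_goal_coe (l : List (BC L)) :
    ((conjB (l : Multiset (BC L))).goal U).Equiv (Goal.conj (l.map (BC.goal U))) := by
  rw [conjB_goal]
  exact Goal.conj_perm ((Multiset.coe_eq_coe.1 (Multiset.coe_toList _)).map _)

theorem conjU_add (A A' : Multiset (UC L U)) :
    (conjU (A + A')).goal.Equiv (.and (conjU A).goal (conjU A').goal) := by
  induction A using Quotient.inductionOn
  induction A' using Quotient.inductionOn
  simp only [Multiset.quot_mk_to_coe, Multiset.coe_add]
  refine (conjU_goal_coe _).trans ?_
  rw [List.map_append]
  exact (Goal.conj_append _ _).trans ((conjU_goal_coe _).symm.andCongr (conjU_goal_coe _).symm)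

theorem conjB_add (B B' : Multiset (BC L)) :
    ((conjB (B + B')).goal U).Equiv (.and ((conjB B).goal U) ((conjB B').goal U)) := by
  induction B using Quotient.inductionOn
  induction B' using Quotient.inductionOn
  simp only [Multiset.quot_mk_to_coe, Multiset.coe_add]
  refine (conjB_goal_coe _).trans ?_
  rw [List.map_append]
  exact (Goal.conj_append _ _).trans ((conjB_goal_coe _).symm.andCongr (conjB_goal_coe _).symm)

theorem conjU_singleton (a : UC L U) : (conjU {a}).goal.Equiv a.goal :=
  (conjU_goal_coe [a]).trans (Goal.Equiv.andTop _)

theorem conjB_singleton (b : BC L) : ((conjB {b}).goal U).Equiv (b.goal U) :=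
  (conjB_goal_coe [b]).trans (Goal.Equiv.andTop _)

theorem conjU_zero : (conjU (0 : Multiset (UC L U))).goal = .top := by simp [conjU, UC.goal]

theorem conjB_zero : (conjB (0 : Multiset (BC L))).goal U = .top := by simp [conjB, BC.goal]

theorem UC.conjU_atoms (a : UC L U) : (conjU a.atoms).goal.Equiv a.goal := by
  induction a with
  | top => rw [UC.atoms, conjU_zero]; exact .refl _
  | atom => exact conjU_singleton _
  | and a a' ih ih' => exact (conjU_add _ _).trans (ih.andCongr ih')

theorem BC.conjB_atoms (b : BC L) : ((conjB b.atoms).goal U).Equiv (b.goal U) := by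
  induction b with
  | top => rw [BC.atoms, conjB_zero]; exact .refl _
  | bot | eq | rel => exact conjB_singleton _
  | and a a' ih ih' => exact (conjB_add _ _).trans (ih.andCongr ih')

theorem conjU_subst (A : Multiset (UC L U)) (σ : ℕ → L.Term ℕ) :
    ((conjU A).subst σ).goal.Equiv (conjU (usubst A σ)).goal := by
  have h1 : ((conjU A).subst σ).goal = Goal.conj ((A.toList.map fun a => a.subst σ).map UC.goal) := by
    rw [conjU]
    induction A.toList with
    | nil => rfl
    | cons a l ih => simp only [List.foldr, UC.goal, UC.subst, ih, List.map, Goal.conj]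
  rw [h1]
  refine (conjU_goal_coe _).symm.trans ?_
  rw [← Multiset.map_coe, Multiset.coe_toList]
  exact .refl _

/-- Flat goals up to associativity, commutativity and neutrality: the user-defined atoms and the
built-in atoms. -/
abbrev FlatGoal (L : FirstOrder.Language.{u, v}) (U : ℕ → Type w) : Type (max u v w) :=
  Multiset (UC L U) × Multiset (BC L)

/-- The sums of elements of `X` and `Y`. -/
def msum (X Y : Multiset (FlatGoal L U)) : Multiset (FlatGoal L U) :=
  X.bind fun m => Y.map fun m' => m + m'

theorem mem_msum {X Y : Multiset (FlatGoal L U)} {m : FlatGoal L U} :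
    m ∈ msum X Y ↔ ∃ x ∈ X, ∃ y ∈ Y, x + y = m := by
  simp only [msum, Multiset.mem_bind, Multiset.mem_map]

theorem msum_comm (X Y : Multiset (FlatGoal L U)) : msum X Y = msum Y X := by
  simp only [msum, ← Multiset.bind_singleton (s := X), ← Multiset.bind_singleton (s := Y)]
  rw [Multiset.bind_bind]
  simp only [add_comm]

theorem msum_assoc (X Y Z : Multiset (FlatGoal L U)) :
    msum (msum X Y) Z = msum X (msum Y Z) := by
  simp only [msum, Multiset.bind_assoc, Multiset.bind_map, Multiset.map_bind, Multiset.map_map,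
    Function.comp_def, add_assoc]

theorem singleton_msum (m : FlatGoal L U) (Y : Multiset (FlatGoal L U)) :
    msum {m} Y = Y.map fun m' => m + m' := by simp [msum]

theorem msum_add (X Y Z : Multiset (FlatGoal L U)) :
    msum X (Y + Z) = msum X Y + msum X Z := by
  simp [msum, Multiset.map_add, Multiset.bind_add]

/-- The disjunctive normal form of a goal. -/
def Goal.dnf : Goal L U → Multiset (FlatGoal L U)
  | .top => {0}
  | .user c ts => {({.atom c ts}, 0)}
  | .bot => {(0, {.bot})}
  | .eq s t => {(0, {.eq s t})}
  | .rel c ts => {(0, {.rel c ts})}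
  | .and G G' => msum G.dnf G'.dnf
  | .or G G' => G.dnf + G'.dnf

/-- The generators hold as equalities of multisets, with multiplicities: conjunction becomes the
bilinear operation `msum` with unit `{0}`, and disjunction becomes the sum. -/
theorem Goal.Equiv.dnf_eq {G G' : Goal L U} (h : G.Equiv G') : G.dnf = G'.dnf := by
  induction h with
  | refl => rfl
  | symm _ ih => exact ih.symm
  | trans _ _ ih ih' => exact ih.trans ih'
  | andCongr _ _ ih ih' => simp only [Goal.dnf, ih, ih']
  | orCongr _ _ ih ih' => simp only [Goal.dnf, ih, ih']
  | assoc => exact msum_assoc _ _ _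
  | comm => exact msum_comm _ _
  | topAnd => simp [Goal.dnf, singleton_msum]
  | distrib => exact msum_add _ _ _

theorem UC.dnf_goal (a : UC L U) : a.goal.dnf = {(a.atoms, 0)} := by
  induction a with
  | top | atom => rfl
  | and a a' ih ih' => simp [UC.goal, Goal.dnf, ih, ih', UC.atoms, singleton_msum]

theorem BC.dnf_goal (b : BC L) : (b.goal U).dnf = {(0, b.atoms)} := by
  induction b with
  | top | bot | eq | rel => rfl
  | and a a' ih ih' => simp [BC.goal, Goal.dnf, ih, ih', BC.atoms, singleton_msum]

theorem Goal.vars_of_mem_dnf {G : Goal L U} {m : FlatGoal L U} (h : m ∈ G.dnf) :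
    uvars m.1 ∪ bvars m.2 ⊆ G.vars := by
  induction G generalizing m with
  | top | bot | eq | rel | user =>
    rw [Goal.dnf, Multiset.mem_singleton] at h
    subst h
    simp [uvars, bvars, Goal.vars, UC.vars, BC.vars]
  | and G G' ih ih' =>
    obtain ⟨x, hx, y, hy, rfl⟩ := mem_msum.1 h
    have := ih hx
    have := ih' hy
    simp only [Prod.fst_add, Prod.snd_add, uvars_add, bvars_add, Goal.vars]
    grind
  | or G G' ih ih' =>
    rcases Multiset.mem_add.1 h with h | h
    · exact (ih h).trans Finset.subset_union_left
    · exact (ih' h).trans Finset.subset_union_right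

/-- Substitution in a flat goal. -/
def FlatGoal.subst (m : FlatGoal L U) (σ : ℕ → L.Term ℕ) : FlatGoal L U :=
  (usubst m.1 σ, bsubst m.2 σ)

theorem Goal.dnf_subst (G : Goal L U) (σ : ℕ → L.Term ℕ) :
    (G.subst σ).dnf = G.dnf.map fun m => m.subst σ := by
  induction G with
  | top | bot | eq | rel | user => rfl
  | and G G' ih ih' =>
    simp only [Goal.subst, Goal.dnf, ih, ih', msum, Multiset.map_bind, Multiset.bind_map,
      Multiset.map_map, Function.comp_def]
    simp only [FlatGoal.subst, Prod.fst_add, Prod.snd_add, usubst_add, bsubst_add, Prod.mk_add_mk]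
  | or G G' ih ih' => simp only [Goal.subst, Goal.dnf, ih, ih', Multiset.map_add]

theorem Goal.atoms_of_mem_dnf {G : Goal L U} {m : FlatGoal L U} (h : m ∈ G.dnf) :
    (∀ a ∈ m.1, a.atoms = {a}) ∧ ∀ b ∈ m.2, b.atoms = {b} := by
  induction G generalizing m with
  | top | bot | eq | rel | user =>
    rw [Goal.dnf, Multiset.mem_singleton] at h
    subst h
    simp [UC.atoms, BC.atoms]
  | and G G' ih ih' =>
    obtain ⟨x, hx, y, hy, rfl⟩ := mem_msum.1 h
    have := ih hx
    have := ih' hy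
    simp only [Prod.fst_add, Prod.snd_add, Multiset.mem_add]
    grind
  | or G G' ih ih' =>
    rcases Multiset.mem_add.1 h with h | h
    · exact ih h
    · exact ih' h

theorem atoms_conjU {A : Multiset (UC L U)} (h : ∀ a ∈ A, a.atoms = {a}) :
    (conjU A).atoms = A := by
  have : ∀ l : List (UC L U), (∀ a ∈ l, a.atoms = {a}) → (l.foldr UC.and .top).atoms = ↑l := by
    intro l
    induction l with
    | nil => intro _; rfl
    | cons a l ih =>
      intro h
      rw [List.foldr, UC.atoms, h a (by simp), ih fun b hb => h b (by simp [hb])]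
      rfl
  rw [conjU, this _ (by simpa using h), Multiset.coe_toList]

theorem atoms_conjB {B : Multiset (BC L)} (h : ∀ b ∈ B, b.atoms = {b}) :
    (conjB B).atoms = B := by
  have : ∀ l : List (BC L), (∀ a ∈ l, a.atoms = {a}) → (l.foldr BC.and .top).atoms = ↑l := by
    intro l
    induction l with
    | nil => intro _; rfl
    | cons a l ih =>
      intro h
      rw [List.foldr, BC.atoms, h a (by simp), ih fun b hb => h b (by simp [hb])]
      rfl
  rw [conjB, this _ (by simpa using h), Multiset.coe_toList]

end NormalForm

/-! ## Equivalence classes of flat states -/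

section Classes

variable {L : FirstOrder.Language.{u, v}} {U : ℕ → Type w}

/-- States with state equivalence. -/
def stateSetoid (CT : ConstraintTheory L) (U : ℕ → Type w) : Setoid (State L U) where
  r := StateEquiv CT
  iseqv := ⟨.refl, .symm, .trans⟩

/-- Equivalence classes of states. -/
abbrev StateClass (CT : ConstraintTheory L) (U : ℕ → Type w) : Type (max u v w) :=
  Quotient (stateSetoid CT U)

/-- The class of the flat state with the given user-defined and built-in constraints. -/
noncomputable def cls (CT : ConstraintTheory L) (A : Multiset (UC L U)) (B : Multiset (BC L))
    (V : Finset ℕ) : StateClass CT U :=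
  Quotient.mk (stateSetoid CT U) (.normal (conjU A) (conjB B) V)

variable {CT : ConstraintTheory L}

theorem mk_normal_eq_cls {A : UC L U} {B : BC L} {A' : Multiset (UC L U)} {B' : Multiset (BC L)}
    {V : Finset ℕ} (hA : A.goal.Equiv (conjU A').goal)
    (hB : (B.goal U).Equiv ((conjB B').goal U)) :
    Quotient.mk (stateSetoid CT U) (.normal A B V) = cls CT A' B' V :=
  Quotient.sound (StateEquiv.goalTransformation V (hA.andCongr hB))

theorem mk_normal (A : UC L U) (B : BC L) (V : Finset ℕ) :
    Quotient.mk (stateSetoid CT U) (.normal A B V) = cls CT A.atoms B.atoms V :=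
  mk_normal_eq_cls A.conjU_atoms.symm B.conjB_atoms.symm

/-- A `FlatStep` describes the rest of a state by one user-defined and one built-in constraint. This
passes from multisets of arbitrary constraints to the atoms of their conjunctions. -/
theorem cls_flatten (X A : Multiset (UC L U)) (Y B : Multiset (BC L)) (V : Finset ℕ) :
    cls CT (X + A) (Y + B) V = cls CT (X + (conjU A).atoms) (Y + (conjB B).atoms) V :=
  mk_normal_eq_cls
    ((conjU_add _ _).trans (((Goal.Equiv.refl _).andCongr (conjU A).conjU_atoms.symm).trans
      (conjU_add _ _).symm))
    ((conjB_add _ _).trans (((Goal.Equiv.refl _).andCongr (conjB B).conjB_atoms.symm).trans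
      (conjB_add _ _).symm))

/-- An unsatisfiable store and falsity imply each other even after projection, so the store may be
replaced by `⊥`; all states containing `⊥` are identified. -/
theorem cls_of_unsat {A : Multiset (UC L U)} {B : Multiset (BC L)} {V : Finset ℕ}
    (h : CT.Unsat B) : cls CT A B V = Quotient.mk (stateSetoid CT U) State.failed := by
  have h1 : StateEquiv CT (.normal (conjU A) (conjB B) V) (.normal (conjU A) .bot V) := by
    refine .applyCT _ _ _ _ ?_ ?_
    · refine .impI ?_
      refine IForm.Derives.exVars_elim' (fun F hF x _ => ConstraintTheory.fresh_axiom hF x)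
        (fun x _ => ?_) (.botE (ConstraintTheory.ent_of_insert_conjB.2 h))
      refine ((BC.form_dependsOn (L := L) .bot).exVars _).fresh ?_
      simp [BC.vars]
    · refine .impI (IForm.Derives.exVars_elim'
        (fun F hF x _ => ConstraintTheory.fresh_axiom hF x) (fun x hx => ?_)
        (.botE (.ax (Set.mem_insert _ _))))
      refine ((BC.form_dependsOn (conjB B)).exVars _).fresh fun hx' => ?_
      simp only [strictLocals, BC.vars, Set.mem_sdiff, Finset.mem_coe, Finset.mem_sdiff,
        Finset.mem_union] at hx hx'
      grind
  exact Quotient.sound (h1.trans (.failed _ _ _ _))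

/-- An existential consequence over arbitrary variables that are not global entails the
corresponding implication between the projected built-in stores. -/
theorem entails_strictLocals {A : UC L U} {B B' : Multiset (BC L)} {V s : Finset ℕ}
    (hs : ∀ x ∈ s, x ∉ V ∧ x ∉ A.vars) (h : CT.Ent B (.exVars s (conjB B').form)) :
    CT.Entails (.imp (.exVars (strictLocals A (conjB B) V) (conjB B).form)
      (.exVars (strictLocals A (conjB B') V) (conjB B').form)) := by
  have fresh : ∀ x, x ∉ V → x ∉ A.vars → IForm.Fresh x
      (.exVars (strictLocals A (conjB B') V) (conjB B').form) := fun x hV hA => by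
    refine ((BC.form_dependsOn _).exVars _).fresh fun hx => ?_
    simp only [strictLocals, Set.mem_sdiff, Finset.mem_coe, Finset.mem_sdiff,
      Finset.mem_union] at hx
    grind
  refine .impI (IForm.Derives.exVars_elim'
    (fun F hF x _ => ConstraintTheory.fresh_axiom hF x) (fun x hx => ?_)
    (ConstraintTheory.ent_of_insert_conjB.2 ?_))
  · simp only [strictLocals, Finset.mem_sdiff, Finset.mem_union] at hx
    exact fresh x hx.1.2 hx.2
  -- The variables in `s` need not be the strictly local ones, but they are fresh for the
  -- conclusion, so the existential hypothesis can be opened.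
  · refine ConstraintTheory.Ent.exVars_trans (fun x hx => fresh x (hs x hx).1 (hs x hx).2) h ?_
    refine ConstraintTheory.Ent.exVars_intro' (τ := .var) (fun _ _ _ => rfl) ?_
    rw [bsubst_var]
    exact fun b hb => .of_mem hb

theorem cls_congr_builtin {A : Multiset (UC L U)} {B B' : Multiset (BC L)} {V s s' : Finset ℕ}
    (hs : ∀ x ∈ s, x ∉ V ∧ x ∉ uvars A) (h : CT.Ent B (.exVars s (conjB B').form))
    (hs' : ∀ x ∈ s', x ∉ V ∧ x ∉ uvars A) (h' : CT.Ent B' (.exVars s' (conjB B).form)) :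
    cls CT A B V = cls CT A B' V :=
  Quotient.sound (.applyCT _ _ _ _ (entails_strictLocals (by rwa [vars_conjU]) h)
    (entails_strictLocals (by rwa [vars_conjU]) h'))

theorem ConstraintTheory.Ent.exVars_of_subst {B B' : Multiset (BC L)} {F : Finset ℕ}
    {σ : ℕ → L.Term ℕ} (hσ : ∀ x ∈ F, x ∈ bvars B' → σ x = .var x)
    (h : ∀ b ∈ CHR.bsubst B' σ, CT.Ent B b.form) :
    CT.Ent B (.exVars (bvars B' \ F) (conjB B').form) :=
  ConstraintTheory.Ent.exVars_intro' (fun x hx hxB => hσ x (by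
    by_contra hF; exact hx (by simp [hxB, hF])) hxB) h

/-- Built-in stores that are instances of each other, up to substitution of local variables. -/
theorem cls_congr_of_subst {A : Multiset (UC L U)} {B B' : Multiset (BC L)} {V : Finset ℕ}
    {σ τ : ℕ → L.Term ℕ} (hσ : ∀ x, x ∈ V ∨ x ∈ uvars A → x ∈ bvars B' → σ x = .var x)
    (h : ∀ b ∈ bsubst B' σ, CT.Ent B b.form)
    (hτ : ∀ x, x ∈ V ∨ x ∈ uvars A → x ∈ bvars B → τ x = .var x)
    (h' : ∀ b ∈ bsubst B τ, CT.Ent B' b.form) : cls CT A B V = cls CT A B' V := by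
  refine cls_congr_builtin (s := bvars B' \ (V ∪ uvars A)) (s' := bvars B \ (V ∪ uvars A)) ?_
    (ConstraintTheory.Ent.exVars_of_subst (fun x hx hxB => hσ x (by simpa using hx) hxB) h) ?_
    (ConstraintTheory.Ent.exVars_of_subst (fun x hx hxB => hτ x (by simpa using hx) hxB) h')
  all_goals intro x hx; simp at hx; tauto

/-- Constraints that are entailed up to a choice of fresh local variables may be added. -/
theorem cls_add_of_subst {A : Multiset (UC L U)} {B B' : Multiset (BC L)} {V : Finset ℕ}
    {σ : ℕ → L.Term ℕ} (hσ : ∀ x, x ∈ V ∨ x ∈ uvars A ∨ x ∈ bvars B → x ∈ bvars B' → σ x = .var x)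
    (h : ∀ b ∈ bsubst B' σ, CT.Ent B b.form) : cls CT A B V = cls CT A (B + B') V := by
  -- Nothing is known about `σ` outside the variables of `B'`, hence it is made the identity there.
  refine cls_congr_of_subst (σ := fun x => if x ∈ bvars B' then σ x else .var x) (τ := .var)
    (fun x hx hxB => ?_) ?_ (fun _ _ _ => rfl) ?_
  · by_cases hx' : x ∈ bvars B'
    · simpa [hx'] using hσ x (hx.imp_right .inl) hx'
    · simp [hx']
  · rw [bsubst_add]
    intro b hb
    rcases Multiset.mem_add.1 hb with hb | hb
    · rw [bsubst_eq_self] at hb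
      · exact .of_mem hb
      · intro x hx
        by_cases hx' : x ∈ bvars B'
        · simpa [hx'] using hσ x (.inr (.inr hx)) hx'
        · simp [hx']
    · rw [bsubst_congr (τ := σ)] at hb
      · exact h b hb
      · intro x hx; simp [hx]
  · rw [bsubst_var]
    exact fun b hb => .of_mem (by simp [hb])

theorem cls_add_of_ent {A : Multiset (UC L U)} {B B' : Multiset (BC L)} {V : Finset ℕ}
    (h : ∀ b ∈ B', CT.Ent B b.form) : cls CT A B V = cls CT A (B + B') V :=
  cls_add_of_subst (σ := .var) (fun _ _ _ => rfl) (by rwa [bsubst_var])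

/-- An existential consequence is made explicit in the store: its quantified variables, being absent
from the state, become local variables, and the projection stays the same. -/
theorem cls_add_of_exVars {A : Multiset (UC L U)} {B : Multiset (BC L)} {b : BC L}
    {V s : Finset ℕ} (hs : ∀ x ∈ s, x ∉ V ∧ x ∉ uvars A ∧ x ∉ bvars B)
    (h : CT.Ent B (.exVars s b.form)) : cls CT A B V = cls CT A (B + b.atoms) V := by
  refine cls_congr_builtin (s := s) (s' := ∅) (fun x hx => ⟨(hs x hx).1, (hs x hx).2.1⟩) ?_
    (by simp) ?_
  · have h1 : IForm.Derives (CTAxiom.form '' CT.axioms ∪ {F | ∃ b ∈ B, F = b.form})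
        (.imp (.exVars s b.form) (.exVars s (conjB (B + b.atoms)).form)) := by
      refine .impI (IForm.Derives.exVars_elim' ?_ (fun x hx => ?_) ?_)
      · rintro F (hF | ⟨b, hb, rfl⟩) x hx
        · exact ConstraintTheory.fresh_axiom hF x
        · exact (b.form_dependsOn).fresh fun hxb =>
            (hs x hx).2.2 (mem_bvars.2 ⟨b, hb, hxb⟩)
      · refine ((BC.form_dependsOn _).exVars s).fresh fun hx' => hx'.2 (by simpa using hx)
      · refine IForm.Derives.exVars_intro' (τ := .var) (fun _ _ => rfl) ?_
        rw [IForm.subst_var, ConstraintTheory.derives_conjB]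
        intro b hb
        rcases Multiset.mem_add.1 hb with hb | hb
        · exact .ax (.inr (.inr ⟨b, hb, rfl⟩))
        · exact ConstraintTheory.derives_atoms.1 (.ax (Set.mem_insert _ _)) b hb
    exact .impE h1 h
  · refine ConstraintTheory.Ent.exVars_intro' (τ := .var) (fun _ _ _ => rfl) ?_
    rw [bsubst_var]
    exact fun b hb => .of_mem (by simp [hb])

theorem cls_eqSubst (A : Multiset (UC L U)) (x : ℕ) (t : L.Term ℕ) (B : Multiset (BC L))
    (V : Finset ℕ) : cls CT A ({.eq (.var x) t} + B) V =
      cls CT (usubst A (single x t)) ({.eq (.var x) t} + B) V := by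
  have hB : ((BC.and (.eq (.var x) t) (conjB B)).goal U).Equiv
      ((conjB ({.eq (.var x) t} + B)).goal U) :=
    (((conjB_singleton _).symm.andCongr (.refl _)).trans (conjB_add _ _).symm)
  rw [← mk_normal_eq_cls (Goal.Equiv.refl _) hB, ← mk_normal_eq_cls (conjU_subst _ _) hB]
  exact Quotient.sound (.eqSubst _ _ _ _ _)

theorem cls_insert_global {A : Multiset (UC L U)} {B : Multiset (BC L)} {V : Finset ℕ} {x : ℕ}
    (hA : x ∉ uvars A) (hB : x ∉ bvars B) : cls CT A B (insert x V) = cls CT A B V := by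
  refine Quotient.sound (.redundantGlobal _ x V ?_)
  have hU : ∀ a : UC L U, a.goal.vars = a.vars := fun a => by
    induction a with
    | top | atom => rfl
    | and a a' ih ih' => simp only [UC.goal, Goal.vars, ih, ih', UC.vars]
  have hB' : ∀ b : BC L, (b.goal U).vars = b.vars := fun b => by
    induction b with
    | top | bot | eq | rel => rfl
    | and a a' ih ih' => simp only [BC.goal, Goal.vars, ih, ih', BC.vars]
  simp [Goal.vars, hU, hB', vars_conjU, vars_conjB, hA, hB]

theorem cls_union_globals {A : Multiset (UC L U)} {B : Multiset (BC L)} {V W : Finset ℕ}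
    (h : ∀ x ∈ W, x ∉ V → x ∉ uvars A ∧ x ∉ bvars B) : cls CT A B (W ∪ V) = cls CT A B V := by
  induction W using Finset.induction_on with
  | empty => simp
  | insert x W hx ih =>
    rw [Finset.insert_union]
    by_cases hxV : x ∈ V
    · rw [Finset.insert_eq_of_mem (by simp [hxV])]
      exact ih fun y hy => h y (by simp [hy])
    · have := h x (by simp) hxV
      rw [cls_insert_global this.1 this.2]
      exact ih fun y hy => h y (by simp [hy])

/-- Equal terms may be exchanged in the user-defined store. -/
theorem cls_congr_user (hEq : CT.HasEquality) {A A' : Multiset (UC L U)} {B : Multiset (BC L)}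
    {V : Finset ℕ} {σ τ : ℕ → L.Term ℕ}
    (h : ∀ x ∈ uvars A, CT.Ent B (BC.eq (σ x) (τ x)).form) :
    cls CT (usubst A σ + A') B V = cls CT (usubst A τ + A') B V := by
  refine subst_induction (S := uvars A) (R := fun s t => CT.Ent B (BC.eq s t).form)
    (P := fun τ => cls CT (usubst A σ + A') B V = cls CT (usubst A τ + A') B V)
    (fun τ τ' h hτ => by rwa [← usubst_congr h]) (fun τ x t hR hτ => hτ.trans ?_) h rfl
  -- State equivalence only replaces a variable by a term. So a fresh local variable `z` with an
  -- equation `z ≐ τ x` takes over the occurrences of `τ x`; the equation is then exchanged for `z ≐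
  -- t`, and `z` is eliminated again.
  obtain ⟨z, hz⟩ := Infinite.exists_notMem_finset ((uvars A).biUnion (fun y => (τ y).varFinset) ∪
    (τ x).varFinset ∪ t.varFinset ∪ uvars (usubst A τ + A') ∪
    uvars (usubst A (Function.update τ x t) + A') ∪ uvars A' ∪ bvars B ∪ V)
  simp only [Finset.mem_union, not_or] at hz
  obtain ⟨⟨⟨⟨⟨⟨⟨hzA, hzx⟩, hzt⟩, hz1⟩, hz2⟩, hzA'⟩, hzB⟩, hzV⟩ := hz
  have key : ∀ r : L.Term ℕ, usubst (usubst A (Function.update τ x (.var z)) + A') (single z r) =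
      usubst A (Function.update τ x r) + A' := fun r => by
    rw [usubst_add, usubst_usubst, usubst_eq_self (A := A')]
    · congr 1
      refine usubst_congr (update_subst_single r fun y hy hzy => hzA ?_)
      exact Finset.mem_biUnion.2 ⟨y, hy, hzy⟩
    · intro y hy
      have : y ≠ z := fun e => hzA' (e ▸ hy)
      simp only [single, if_neg this]
  have intro : ∀ r : L.Term ℕ, z ∉ r.varFinset →
      z ∉ uvars (usubst A (Function.update τ x r) + A') →
      cls CT (usubst A (Function.update τ x r) + A') B V =
        cls CT (usubst A (Function.update τ x (.var z)) + A') ({.eq (.var z) r} + B) V := by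
    intro r hr hz3
    rw [cls_eqSubst, key, add_comm {BC.eq (.var z) r} B]
    refine cls_add_of_subst (σ := single z r) (fun y hy _ => ?_) ?_
    · have : y ≠ z := by rintro rfl; tauto
      simp only [single, if_neg this]
    · intro b hb
      have : r.subst (single z r) = r := term_subst_eq_self fun y hy => by
        have : y ≠ z := fun e => hr (e ▸ hy)
        simp only [single, if_neg this]
      simp only [bsubst, Multiset.map_singleton, Multiset.mem_singleton, BC.subst, this,
        subst_var_apply] at hb
      subst hb
      simpa [single] using hEq.refl B r
  have e1 := intro (τ x) hzx (by rwa [Function.update_eq_self])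
  rw [Function.update_eq_self] at e1
  rw [e1, intro t hzt hz2]
  have swap : ∀ r r' : L.Term ℕ, CT.Ent B (BC.eq r r').form → z ∉ r.varFinset → z ∉ r'.varFinset →
      ∀ b ∈ ({.eq (.var z) r'} + B : Multiset (BC L)),
        CT.Ent ({.eq (.var z) r} + B) b.form := by
    intro r r' hr hzr hzr' b hb
    rcases Multiset.mem_add.1 hb with hb | hb
    · rw [Multiset.mem_singleton] at hb
      subst hb
      -- The variable `y` is the hole in the constraint `z ≐ y`, in which `r` is replaced by `r'`.
      obtain ⟨y, hy⟩ := Infinite.exists_notMem_finset ({z} : Finset ℕ)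
      have hzy : z ≠ y := fun e => hy (by simp [e])
      have := hEq.replace (B := {.eq (.var z) r} + B) (hr.mono fun c hc => by simp [hc])
        (.eq (.var z) (.var y)) y (by
          simpa [BC.subst, single, hzy] using ConstraintTheory.Ent.of_mem (CT := CT)
            (B := {.eq (.var z) r} + B) (b := .eq (.var z) r) (by simp))
      simpa [BC.subst, single, hzy] using this
    · exact .of_mem (by simp [hb])
  refine cls_congr_of_subst (σ := .var) (τ := .var) (fun _ _ _ => rfl) ?_ (fun _ _ _ => rfl) ?_
  · rw [bsubst_var]; exact swap _ _ hR hzx hzt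
  · rw [bsubst_var]; exact swap _ _ (hEq.symm hR) hzt hzx

/-- Renaming of a local variable. -/
theorem cls_rename_local (hEq : CT.HasEquality) {A : Multiset (UC L U)} {B : Multiset (BC L)}
    {V : Finset ℕ} {x z : ℕ} (hx : x ∉ V) (hzV : z ∉ V) (hzA : z ∉ uvars A) (hzB : z ∉ bvars B) :
    cls CT A B V = cls CT (usubst A (single x (.var z))) (bsubst B (single x (.var z))) V := by
  by_cases hxz : x = z
  · subst hxz
    have : single (L := L) x (.var x) = .var := funext fun y => by
      by_cases h : y = x <;> simp [single, h]
    rw [this, usubst_var, bsubst_var]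
  have hzx : z ≠ x := fun e => hxz e.symm
  set E : BC L := .eq (.var x) (.var z) with hE
  -- The equation merely defines the fresh local variable `z`, so it may be added.
  have h1 : cls CT A B V = cls CT A (B + {E}) V := by
    refine cls_add_of_subst (σ := single z (.var x)) (fun y hy _ => ?_) ?_
    · have : y ≠ z := by rintro rfl; tauto
      simp only [single, if_neg this]
    · intro b hb
      simp only [bsubst, Multiset.map_singleton, Multiset.mem_singleton, hE, BC.subst,
        subst_var_apply] at hb
      subst hb
      simpa [single, hxz] using hEq.refl B (.var x)
  have h2 : cls CT A (B + {E}) V = cls CT (usubst A (single x (.var z))) (B + {E}) V := by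
    have := cls_congr_user hEq (A := A) (A' := 0) (B := B + {E}) (V := V) (σ := .var)
      (τ := single x (.var z)) fun y _ => by
        by_cases hy : y = x
        · subst hy
          simpa [single, hE] using ConstraintTheory.Ent.of_mem (CT := CT) (B := B + {E}) (b := E)
            (by simp)
        · simpa [single, hy] using hEq.refl _ _
    simpa [usubst_var] using this
  rw [h1, h2]
  -- Now `x` is neither global nor present in the user-defined store, so it can be instantiated by
  -- `z` in the built-in store, which turns the added equation into `z ≐ z`.
  refine cls_congr_of_subst (σ := .var) (τ := single x (.var z)) (fun _ _ _ => rfl) ?_ ?_ ?_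
  · rw [bsubst_var]
    intro c hc
    obtain ⟨b, hb, rfl⟩ := mem_bsubst.1 hc
    refine hEq.congr (σ := .var) (fun y _ => ?_) (by
      rw [BC.subst_var]; exact .of_mem (by simp [hb]))
    by_cases hy : y = x
    · subst hy
      simpa [single, hE] using ConstraintTheory.Ent.of_mem (CT := CT) (B := B + {E}) (b := E)
        (by simp)
    · simpa [single, hy] using hEq.refl _ _
  · intro y hy _
    have : y ≠ x := by
      rintro rfl
      rcases hy with hy | hy
      · exact hx hy
      · obtain ⟨a, ha, hya⟩ := mem_uvars_usubst.1 hy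
        by_cases hax : a = y
        · subst hax; simp [single] at hya; exact hxz hya
        · simp [single, hax] at hya; exact hax hya.symm
    simp only [single, if_neg this]
  · intro b hb
    rw [bsubst_add] at hb
    rcases Multiset.mem_add.1 hb with hb | hb
    · exact .of_mem hb
    · simp only [bsubst, Multiset.map_singleton, Multiset.mem_singleton, hE, BC.subst,
        subst_var_apply] at hb
      subst hb
      simpa [single, hzx] using hEq.refl _ _

end Classes

/-! ## Normal forms of configurations -/

section ConfigNF

variable {L : FirstOrder.Language.{u, v}} {U : ℕ → Type w}

open Classical in
/-- The classes of the satisfiable disjuncts of a state. -/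
noncomputable def stateNF (CT : ConstraintTheory L) (S : State L U) :
    Multiset (StateClass CT U) :=
  (S.goal.dnf.filter fun m => ¬ CT.Unsat m.2).map fun m => cls CT m.1 m.2 S.globals

/-- The classes of the satisfiable disjuncts of a configuration. -/
noncomputable def configNF (CT : ConstraintTheory L) (C : Config L U) :
    Multiset (StateClass CT U) := C.bind (stateNF CT)

variable {CT : ConstraintTheory L}

open Classical in
theorem mem_stateNF {S : State L U} {s : StateClass CT U} :
    s ∈ stateNF CT S ↔ ∃ m ∈ S.goal.dnf, ¬ CT.Unsat m.2 ∧ cls CT m.1 m.2 S.globals = s := by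
  simp only [stateNF, Multiset.mem_map, Multiset.mem_filter, and_assoc]

theorem dnf_normal_goal (A : UC L U) (B : BC L) :
    (Goal.and A.goal (B.goal U)).dnf = {(A.atoms, B.atoms)} := by
  simp [Goal.dnf, UC.dnf_goal, BC.dnf_goal, singleton_msum]

open Classical in
theorem stateNF_of_dnf {S : State L U} {m : FlatGoal L U} (h : S.goal.dnf = {m})
    (hm : ¬ CT.Unsat m.2) : stateNF CT S = {cls CT m.1 m.2 S.globals} := by
  simp [stateNF, h, Multiset.filter_singleton, hm]

open Classical in
theorem stateNF_eq_zero {S : State L U} (h : ∀ m ∈ S.goal.dnf, CT.Unsat m.2) :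
    stateNF CT S = 0 := by
  rw [stateNF, Multiset.filter_eq_nil.2 (by simpa using h), Multiset.map_zero]

open ConstraintTheory in
-- Falsity has no variables, so existential quantification of a store does not affect its
-- unsatisfiability.
theorem unsat_of_entails_strictLocals {A : UC L U} {B B' : BC L} {V : Finset ℕ}
    (h : CT.Entails (.imp (.exVars (strictLocals A B V) B.form)
      (.exVars (strictLocals A B' V) B'.form))) (hB : CT.Unsat B'.atoms) : CT.Unsat B.atoms := by
  have hB' : CT.Ent B.atoms B.form := ent_atoms.2 fun a ha => .of_mem ha
  have h1 : CT.Ent B.atoms (.exVars (strictLocals A B' V) B'.form) :=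
    .impE (h.ent _) (IForm.Derives.exVars_intro' (τ := .var) (fun _ _ => rfl)
      (by rwa [IForm.subst_var]))
  refine .impE (.impI ?_) h1
  refine (IForm.Derives.exVars_elim' (Γ := CTAxiom.form '' CT.axioms) (C := .bot)
    (fun F hF x _ => fresh_axiom hF x) (fun _ _ => rfl) ?_).mono
      (Set.insert_subset_insert Set.subset_union_left)
  refine IForm.Derives.cutSet hB ?_
  rintro F (hF | ⟨b, hb, rfl⟩)
  · exact .ax (.inr hF)
  · exact derives_atoms.1 (.ax (Set.mem_insert _ _)) b hb

open Classical in
-- The substitution rule and the rule for built-in stores concern flat states, which have a single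
-- disjunct, and they preserve satisfiability. Discarding unsatisfiable disjuncts gives all states
-- containing `⊥` the same, empty, normal form.
theorem stateNF_eq {S S' : State L U} (h : StateEquiv CT S S') : stateNF CT S = stateNF CT S' := by
  induction h with
  | refl => rfl
  | symm _ ih => exact ih.symm
  | trans _ _ ih ih' => exact ih.trans ih'
  | goalTransformation V h => simp only [stateNF, h.dnf_eq]
  | eqSubst A x t B V =>
    have hd := dnf_normal_goal A (.and (.eq (.var x) t) B)
    have hd' := dnf_normal_goal (A.subst (single x t)) (.and (.eq (.var x) t) B)
    by_cases hu : CT.Unsat (BC.and (.eq (.var x) t) B).atoms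
    · rw [stateNF_eq_zero, stateNF_eq_zero]
      · intro m hm; rw [State.normal, hd', Multiset.mem_singleton] at hm; subst hm; exact hu
      · intro m hm; rw [State.normal, hd, Multiset.mem_singleton] at hm; subst hm; exact hu
    · rw [stateNF_of_dnf hd hu, stateNF_of_dnf hd' hu]
      congr 1
      rw [State.normal, State.normal, ← mk_normal, ← mk_normal]
      exact Quotient.sound (.eqSubst _ _ _ _ _)
  | applyCT A B B' V h h' =>
    have hd := dnf_normal_goal A B
    have hd' := dnf_normal_goal A B'
    have hu' : CT.Unsat B.atoms ↔ CT.Unsat B'.atoms :=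
      ⟨unsat_of_entails_strictLocals h', unsat_of_entails_strictLocals h⟩
    by_cases hu : CT.Unsat B.atoms
    · rw [stateNF_eq_zero, stateNF_eq_zero]
      · intro m hm; rw [State.normal, hd', Multiset.mem_singleton] at hm; subst hm; exact hu'.1 hu
      · intro m hm; rw [State.normal, hd, Multiset.mem_singleton] at hm; subst hm; exact hu
    · rw [stateNF_of_dnf hd hu, stateNF_of_dnf hd' (mt hu'.2 hu)]
      congr 1
      rw [State.normal, State.normal, ← mk_normal, ← mk_normal]
      exact Quotient.sound (.applyCT _ _ _ _ h h')
  | redundantGlobal G x V hx =>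
    refine Multiset.map_congr rfl fun m hm => ?_
    have := Goal.vars_of_mem_dnf (Multiset.mem_of_mem_filter hm)
    exact cls_insert_global (fun h => hx (this (by simp [h]))) fun h => hx (this (by simp [h]))
  | failed G G' V V' =>
    have : ∀ (G : Goal L U) (V : Finset ℕ), stateNF CT ⟨.and G .bot, V⟩ = 0 := fun G V => by
      refine stateNF_eq_zero fun m hm => ?_
      obtain ⟨x, hx, y, hy, rfl⟩ := mem_msum.1 hm
      rw [Goal.dnf, Multiset.mem_singleton] at hy
      subst hy
      exact ConstraintTheory.Ent.of_mem (b := .bot) (by simp)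
    rw [this, this]

theorem stateNF_failed : stateNF CT (State.failed : State L U) = 0 := by
  refine stateNF_eq_zero fun m hm => ?_
  rw [State.failed, State.normal, dnf_normal_goal, Multiset.mem_singleton] at hm
  subst hm
  exact ConstraintTheory.Ent.of_mem (b := .bot) (by simp [BC.atoms])

@[simp] theorem configNF_cons (S : State L U) (C : Config L U) :
    configNF CT (S ::ₘ C) = stateNF CT S + configNF CT C := Multiset.cons_bind _ _ _

open Classical in
theorem configNF_eq {C D : Config L U} (h : ConfigEquiv CT C D) :
    configNF CT C = configNF CT D := by
  induction h with
  | refl => rfl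
  | symm _ ih => exact ih.symm
  | trans _ _ ih ih' => exact ih.trans ih'
  | stateEquiv T h => rw [configNF_cons, configNF_cons, stateNF_eq h]
  | failed T => rw [configNF_cons, stateNF_failed, zero_add]
  | split G₁ G₂ V T =>
    rw [configNF_cons, configNF_cons, configNF_cons, ← add_assoc]
    simp [stateNF, Goal.dnf, Multiset.filter_add]

/-- The normal form of a class of configurations. -/
noncomputable def classNF : ConfigClass CT U → Multiset (StateClass CT U) :=
  Quotient.lift (configNF CT) fun _ _ h => configNF_eq h

theorem classNF_classOf (C : Config L U) : classNF (classOf CT C) = configNF CT C := rfl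

/-- The class of configurations with the given normal form. -/
noncomputable def ofNF (m : Multiset (StateClass CT U)) : ConfigClass CT U :=
  classOf CT (m.map Quotient.out)

theorem ConfigEquiv.add_right {C D : Config L U} (h : ConfigEquiv CT C D) (E : Config L U) :
    ConfigEquiv CT (C + E) (D + E) := by
  induction h with
  | refl => exact .refl _
  | symm _ ih => exact .symm ih
  | trans _ _ ih ih' => exact .trans ih ih'
  | stateEquiv T h => simp only [Multiset.cons_add]; exact .stateEquiv _ h
  | failed T => simp only [Multiset.cons_add]; exact .failed _
  | split G₁ G₂ V T => simp only [Multiset.cons_add]; exact .split _ _ _ _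

theorem ConfigEquiv.add {C D C' D' : Config L U} (h : ConfigEquiv CT C D)
    (h' : ConfigEquiv CT C' D') : ConfigEquiv CT (C + C') (D + D') := by
  refine (h.add_right C').trans ?_
  rw [add_comm D, add_comm D]
  exact h'.add_right D

theorem StateEquiv.config {S S' : State L U} (h : StateEquiv CT S S') :
    ConfigEquiv CT {S} {S'} := .stateEquiv 0 h

theorem ConfigEquiv.map {ι : Type*} {X : Multiset ι} {f g : ι → State L U}
    (h : ∀ i ∈ X, StateEquiv CT (f i) (g i)) : ConfigEquiv CT (X.map f) (X.map g) := by
  induction X using Multiset.induction_on with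
  | empty => exact .refl _
  | cons i X ih =>
    rw [Multiset.map_cons, Multiset.map_cons, ← Multiset.singleton_add, ← Multiset.singleton_add]
    exact (h i (by simp)).config.add (ih fun j hj => h j (by simp [hj]))

theorem ConfigEquiv.bind {ι : Type*} {X : Multiset ι} {f g : ι → Config L U}
    (h : ∀ i ∈ X, ConfigEquiv CT (f i) (g i)) : ConfigEquiv CT (X.bind f) (X.bind g) := by
  induction X using Multiset.induction_on with
  | empty => exact .refl _
  | cons i X ih =>
    rw [Multiset.cons_bind, Multiset.cons_bind]
    exact (h i (by simp)).add (ih fun j hj => h j (by simp [hj]))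

/-- A flat goal as a goal. -/
noncomputable def FlatGoal.goal (m : FlatGoal L U) : Goal L U :=
  .and (conjU m.1).goal ((conjB m.2).goal U)

theorem FlatGoal.goal_add (m m' : FlatGoal L U) :
    (m + m').goal.Equiv (.and m.goal m'.goal) :=
  ((conjU_add _ _).andCongr (conjB_add _ _)).trans (Goal.Equiv.andAndComm _ _ _ _)

/-- The remaining conjunct `K` is carried along so that the induction passes through conjunctions:
`G` is expanded with `G' ∧ K` as the rest, and then `G'` with the disjunct of `G` and `K` as the
rest. -/
theorem configEquiv_dnf_and (G K : Goal L U) (V : Finset ℕ) :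
    ConfigEquiv CT {⟨.and G K, V⟩} (G.dnf.map fun m => ⟨.and m.goal K, V⟩) := by
  have base : ∀ (G K : Goal L U) (m : FlatGoal L U), G.Equiv m.goal →
      ConfigEquiv CT {⟨.and G K, V⟩}
        (({m} : Multiset (FlatGoal L U)).map fun m => ⟨.and m.goal K, V⟩) := by
    intro G K m h
    exact (StateEquiv.goalTransformation V (h.andCongr (.refl K))).config
  have builtin : ∀ b : BC L, (b.goal U).Equiv (FlatGoal.goal (0, {b})) := fun b => by
    rw [FlatGoal.goal, conjU_zero]
    exact (conjB_singleton _).symm.trans (.symm (.topAnd _))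
  induction G generalizing K with
  | top =>
    refine base _ _ _ ?_
    simp only [FlatGoal.goal, Prod.fst_zero, Prod.snd_zero, conjU_zero, conjB_zero]
    exact .symm (.topAnd _)
  | user c ts =>
    refine base _ _ _ ?_
    rw [FlatGoal.goal, conjB_zero]
    exact (conjU_singleton (.atom c ts)).symm.trans (.symm (.andTop _))
  | bot => exact base _ _ _ (builtin .bot)
  | eq s t => exact base _ _ _ (builtin (.eq s t))
  | rel c ts => exact base _ _ _ (builtin (.rel c ts))
  | and G G' ih ih' =>
    refine .trans (StateEquiv.goalTransformation V (.assoc G G' K)).config ?_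
    refine (ih _).trans ?_
    have h1 : ConfigEquiv CT (G.dnf.map fun m => ⟨.and m.goal (.and G' K), V⟩)
        (G.dnf.bind fun m => {⟨.and G' (.and m.goal K), V⟩}) := by
      rw [Multiset.bind_singleton]
      exact ConfigEquiv.map fun m _ => .goalTransformation V (.leftComm _ _ _)
    refine h1.trans ((ConfigEquiv.bind fun m _ => ih' _).trans ?_)
    simp only [Goal.dnf, msum, Multiset.map_bind, Multiset.map_map, Function.comp_def]
    refine ConfigEquiv.bind fun m _ => ConfigEquiv.map fun m' _ => .goalTransformation V ?_
    exact (Goal.Equiv.leftComm _ _ _).trans ((Goal.Equiv.assoc _ _ _).symm.trans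
      ((FlatGoal.goal_add _ _).symm.andCongr (.refl _)))
  | or G G' ih ih' =>
    have h1 : (Goal.and (.or G G') K).Equiv (.or (.and G K) (.and G' K)) :=
      (Goal.Equiv.comm _ _).trans ((Goal.Equiv.distrib _ _ _).trans
        (.orCongr (.comm _ _) (.comm _ _)))
    refine .trans (StateEquiv.goalTransformation V h1).config ?_
    refine .trans (.split _ _ _ 0) ?_
    simp only [Goal.dnf, Multiset.map_add]
    exact ConfigEquiv.add (ih K) (ih' K)

open Classical in
theorem configEquiv_stateNF (S : State L U) :
    ConfigEquiv CT {S} ((stateNF CT S).map Quotient.out) := by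
  obtain ⟨G, V⟩ := S
  refine .trans (StateEquiv.goalTransformation V (Goal.Equiv.andTop G).symm).config ?_
  refine (configEquiv_dnf_and G .top V).trans ?_
  simp only [stateNF]
  induction G.dnf using Multiset.induction_on with
  | empty => exact .refl _
  | cons m X ih =>
    have hm : StateEquiv CT ⟨.and m.goal .top, V⟩ (.normal (conjU m.1) (conjB m.2) V) :=
      .goalTransformation V (.andTop _)
    rw [Multiset.map_cons, ← Multiset.singleton_add]
    by_cases hu : CT.Unsat m.2
    · rw [Multiset.filter_cons_of_neg _ (by simpa using hu)]
      refine .trans (ConfigEquiv.add (D := {State.failed}) (.trans hm.config ?_) ih) ?_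
      · exact (Quotient.exact (cls_of_unsat (A := m.1) (V := V) hu) : StateEquiv CT _ _).config
      · exact .failed _
    · rw [Multiset.filter_cons_of_pos (p := fun m : FlatGoal L U => ¬ CT.Unsat m.2) _ hu,
        Multiset.map_cons, Multiset.map_cons,
        ← Multiset.singleton_add]
      refine ConfigEquiv.add (hm.trans ?_).config ih
      exact (Quotient.mk_out (s := stateSetoid CT U) _ : StateEquiv CT _ _).symm

/-- Together with `configNF_eq` this makes the multiset of live classes a complete invariant of
configuration equivalence. -/
theorem classOf_eq_ofNF (C : Config L U) : classOf CT C = ofNF (configNF CT C) := by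
  refine Quotient.sound ?_
  induction C using Multiset.induction_on with
  | empty => exact .refl _
  | cons S C ih =>
    rw [configNF_cons, Multiset.map_add, ← Multiset.singleton_add]
    exact (configEquiv_stateNF S).add ih

theorem ofNF_classNF (q : ConfigClass CT U) : ofNF (classNF q) = q := by
  induction q using Quotient.inductionOn with
  | h C => exact (classOf_eq_ofNF C).symm

/-- The class of a satisfiable flat state. -/
def Live (s : StateClass CT U) : Prop :=
  ∃ A B V, s = cls CT A B V ∧ ¬ CT.Unsat B

theorem stateNF_normal_conj {A : Multiset (UC L U)} {B : Multiset (BC L)} {V : Finset ℕ}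
    (h : ¬ CT.Unsat B) : stateNF CT (.normal (conjU A) (conjB B) V) = {cls CT A B V} := by
  have hu : ¬ CT.Unsat (conjB B).atoms := fun h' => h (h'.of_ent fun b hb =>
    (ConstraintTheory.ent_atoms.1 (ConstraintTheory.ent_conjB.2 fun c hc => .of_mem hc)) b hb)
  rw [stateNF_of_dnf (dnf_normal_goal _ _) hu]
  congr 1
  exact (mk_normal _ _ _).symm

theorem stateNF_out {s : StateClass CT U} (h : Live s) : stateNF CT s.out = {s} := by
  obtain ⟨A, B, V, rfl, hB⟩ := h
  rw [← stateNF_normal_conj hB]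
  exact stateNF_eq (Quotient.mk_out (s := stateSetoid CT U) _)

theorem configNF_map_out {m : Multiset (StateClass CT U)} (h : ∀ s ∈ m, Live s) :
    configNF CT (m.map Quotient.out) = m := by
  induction m using Multiset.induction_on with
  | empty => rfl
  | cons s m ih =>
    rw [Multiset.map_cons, configNF_cons, stateNF_out (h s (by simp)),
      ih fun t ht => h t (by simp [ht]), Multiset.singleton_add]

theorem classNF_ofNF {m : Multiset (StateClass CT U)} (h : ∀ s ∈ m, Live s) :
    classNF (ofNF m) = m := configNF_map_out h

theorem live_of_mem_stateNF {S : State L U} {s : StateClass CT U} (h : s ∈ stateNF CT S) :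
    Live s := by
  obtain ⟨m, -, hu, rfl⟩ := mem_stateNF.1 h
  exact ⟨_, _, _, rfl, hu⟩

theorem live_of_mem_configNF {C : Config L U} {s : StateClass CT U} (h : s ∈ configNF CT C) :
    Live s := by
  obtain ⟨S, -, hs⟩ := Multiset.mem_bind.1 h
  exact live_of_mem_stateNF hs

theorem live_of_mem_classNF {q : ConfigClass CT U} {s : StateClass CT U} (h : s ∈ classNF q) :
    Live s := by
  induction q using Quotient.inductionOn with
  | h C => exact live_of_mem_configNF h

/-- Satisfiability does not depend on the representative: an unsatisfiable class has empty normal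
form, a live one has a singleton. -/
theorem live_cls_iff {A : Multiset (UC L U)} {B : Multiset (BC L)} {V : Finset ℕ} :
    Live (cls CT A B V) ↔ ¬ CT.Unsat B := by
  refine ⟨fun h hB => ?_, fun h => ⟨A, B, V, rfl, h⟩⟩
  have h1 := stateNF_out h
  rw [cls_of_unsat hB, stateNF_eq (Quotient.mk_out (s := stateSetoid CT U) _),
    stateNF_failed] at h1
  exact absurd h1.symm (Multiset.singleton_ne_zero _)

theorem not_stateEquiv_failed {S : State L U} (h : Live (Quotient.mk (stateSetoid CT U) S)) :
    ¬ StateEquiv CT S State.failed := fun h' => by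
  obtain ⟨A, B, V, hs, hB⟩ := h
  have h1 := stateNF_eq (Quotient.exact hs : StateEquiv CT _ _)
  rw [stateNF_normal_conj hB, stateNF_eq h', stateNF_failed] at h1
  exact absurd h1.symm (Multiset.singleton_ne_zero _)

end ConfigNF

/-! ## Transitions between normal forms -/

section FlatSteps

variable {L : FirstOrder.Language.{u, v}} {U : ℕ → Type w}

/-- A transition of a single satisfiable flat state, between normal forms of configurations. -/
def FlatStep (CT : ConstraintTheory L) (P : Program L U) (m m' : Multiset (StateClass CT U)) :
    Prop :=
  ∃ R ∈ P, ∃ R' : Rule L U, R.IsVariant R' ∧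
    ∃ (A : UC L U) (B : BC L) (V : Finset ℕ) (c : Multiset (StateClass CT U)),
      Disjoint R'.localVars (R'.H₁.vars ∪ R'.H₂.vars ∪ (A.vars ∪ B.vars) ∪ V) ∧
      ¬ CT.Unsat (R'.G.atoms + B.atoms) ∧
      m = cls CT (R'.H₁.atoms + R'.H₂.atoms + A.atoms) (R'.G.atoms + B.atoms) V ::ₘ c ∧
      m' = stateNF CT ⟨.and (.and (.and R'.H₁.goal (R'.G.goal U)) R'.B)
        (.and A.goal (B.goal U)), V⟩ + c

/-- The reflexive-transitive closure of `FlatStep`. -/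
abbrev FlatSteps (CT : ConstraintTheory L) (P : Program L U) :
    Multiset (StateClass CT U) → Multiset (StateClass CT U) → Prop :=
  Relation.ReflTransGen (FlatStep CT P)

variable {CT : ConstraintTheory L} {P : Program L U}

theorem FlatStep.add_right {m m' : Multiset (StateClass CT U)} (h : FlatStep CT P m m')
    (c : Multiset (StateClass CT U)) : FlatStep CT P (m + c) (m' + c) := by
  obtain ⟨R, hR, R', hv, A, B, V, d, hd, hs, rfl, rfl⟩ := h
  exact ⟨R, hR, R', hv, A, B, V, d + c, hd, hs, by rw [Multiset.cons_add], by rw [add_assoc]⟩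

theorem FlatSteps.add_right {m m' : Multiset (StateClass CT U)} (h : FlatSteps CT P m m')
    (c : Multiset (StateClass CT U)) : FlatSteps CT P (m + c) (m' + c) :=
  h.lift (· + c) fun _ _ hs => hs.add_right c

theorem FlatSteps.add {m m' n n' : Multiset (StateClass CT U)} (h : FlatSteps CT P m m')
    (h' : FlatSteps CT P n n') : FlatSteps CT P (m + n) (m' + n') := by
  refine (h.add_right n).trans ?_
  rw [add_comm m', add_comm m']
  exact FlatSteps.add_right h' m'

theorem FlatSteps.bind {ι : Type*} {X : Multiset ι} {f g : ι → Multiset (StateClass CT U)}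
    (h : ∀ i ∈ X, FlatSteps CT P (f i) (g i)) : FlatSteps CT P (X.bind f) (X.bind g) := by
  induction X using Multiset.induction_on with
  | empty => exact .refl
  | cons i X ih =>
    rw [Multiset.cons_bind, Multiset.cons_bind]
    exact FlatSteps.add (h i (by simp)) (ih fun j hj => h j (by simp [hj]))

theorem FlatStep.live {m m' : Multiset (StateClass CT U)} (h : FlatStep CT P m m')
    (hm : ∀ s ∈ m, Live s) : ∀ s ∈ m', Live s := by
  obtain ⟨R, hR, R', hv, A, B, V, d, hd, hs, rfl, rfl⟩ := h
  intro s hs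
  rcases Multiset.mem_add.1 hs with hs | hs
  · exact live_of_mem_stateNF hs
  · exact hm s (by simp [hs])

theorem FlatSteps.live {m m' : Multiset (StateClass CT U)} (h : FlatSteps CT P m m')
    (hm : ∀ s ∈ m, Live s) : ∀ s ∈ m', Live s := by
  induction h with
  | refl => exact hm
  | tail _ h ih => exact h.live ih

/-- Splits a state along the disjuncts of its context `K`, so that a transition in a disjunctive
context can be studied in each flat disjunct. -/
theorem stateNF_and (G K : Goal L U) (V : Finset ℕ) :
    stateNF CT ⟨.and G K, V⟩ = K.dnf.bind fun k => stateNF CT ⟨.and G k.goal, V⟩ := by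
  classical
  have h : ∀ k ∈ K.dnf, (Goal.and G k.goal).dnf = msum {k} G.dnf := fun k hk => by
    have := Goal.atoms_of_mem_dnf hk
    rw [Goal.dnf, FlatGoal.goal, dnf_normal_goal, atoms_conjU this.1, atoms_conjB this.2,
      msum_comm]
  rw [stateNF]
  simp only [Goal.dnf]
  rw [msum_comm, msum, Multiset.filter_bind, Multiset.map_bind]
  refine Multiset.bind_congr fun k hk => ?_
  rw [stateNF]
  simp only [h k hk, singleton_msum]

/-- A transition with a disjunctive context becomes one transition for each satisfiable disjunct of
the context. An unsatisfiable disjunct contributes nothing on either side, since a transition never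
removes built-in constraints. -/
theorem Step.flatSteps {q q' : ConfigClass CT U} (h : Step CT P q q') :
    FlatSteps CT P (classNF q) (classNF q') := by
  obtain ⟨R, hR, R', hv, K, V, T, hd, -, rfl, rfl⟩ := h
  rw [classNF_classOf, classNF_classOf, configNF_cons, configNF_cons]
  refine FlatSteps.add_right ?_ _
  rw [stateNF_and _ K, stateNF_and _ K]
  refine FlatSteps.bind fun k hk => ?_
  have hat := Goal.atoms_of_mem_dnf hk
  have hvars := Goal.vars_of_mem_dnf hk
  have hdnf : (Goal.and (.and (.and R'.H₁.goal R'.H₂.goal) (R'.G.goal U)) k.goal).dnf =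
      {(R'.H₁.atoms + R'.H₂.atoms + k.1, R'.G.atoms + k.2)} := by
    simp [Goal.dnf, FlatGoal.goal, UC.dnf_goal, BC.dnf_goal, singleton_msum,
      atoms_conjU hat.1, atoms_conjB hat.2]
    rfl
  by_cases hu : CT.Unsat (R'.G.atoms + k.2)
  · rw [stateNF_eq_zero, stateNF_eq_zero]
    · intro m hm
      simp only [Goal.dnf, FlatGoal.goal, UC.dnf_goal, BC.dnf_goal, singleton_msum, mem_msum,
        Multiset.map_singleton, atoms_conjU hat.1, atoms_conjB hat.2, Multiset.mem_map,
        Multiset.mem_singleton] at hm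
      obtain ⟨x, ⟨d, -, rfl⟩, y, rfl, rfl⟩ := hm
      refine hu.mono ?_
      intro b hb
      simp only [Prod.snd_add, Multiset.mem_add, zero_add] at hb ⊢
      tauto
    · intro m hm
      rw [hdnf, Multiset.mem_singleton] at hm
      subst hm
      exact hu
  · rw [stateNF_of_dnf hdnf hu]
    refine .single ⟨R, hR, R', hv, conjU k.1, conjB k.2, V, 0, ?_, ?_, ?_, ?_⟩
    · refine hd.mono_right ?_
      rw [vars_conjU, vars_conjB]
      grind
    · rwa [atoms_conjB hat.2]
    · rw [atoms_conjU hat.1, atoms_conjB hat.2]; rfl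
    · rw [add_zero]; rfl

theorem Steps.flatSteps {q q' : ConfigClass CT U} (h : Steps CT P q q') :
    FlatSteps CT P (classNF q) (classNF q') := by
  induction h with
  | refl => exact .refl
  | tail _ h ih => exact ih.trans h.flatSteps

theorem UC.derives_builtinForm (Γ : Set (IForm L)) (a : UC L U) :
    IForm.Derives Γ a.goal.builtinForm := by
  induction a with
  | top | atom => exact .topI
  | and a a' ih ih' => exact .andI ih ih'

theorem BC.builtinForm_goal (b : BC L) : (b.goal U).builtinForm = b.form := by
  induction b with
  | top | bot | eq | rel => rfl
  | and a a' ih ih' => simp only [BC.goal, Goal.builtinForm, BC.form, ih, ih']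

open ConstraintTheory in
-- Completeness of the constraint theory enters here: a store from which `⊥` is not derivable has a
-- derivable existential closure, which is the side condition of a transition.
theorem FlatStep.step (hC : CT.IsComplete) {m m' : Multiset (StateClass CT U)}
    (h : FlatStep CT P m m') (hm : ∀ s ∈ m, Live s) : Step CT P (ofNF m) (ofNF m') := by
  obtain ⟨R, hR, R', hv, A, B, V, c, hd, hs, rfl, rfl⟩ := h
  have hc : configNF CT (c.map Quotient.out) = c := configNF_map_out fun s hs => hm s (by simp [hs])
  refine ⟨R, hR, R', hv, .and A.goal (B.goal U), V, c.map Quotient.out, ?_, ?_, ?_, ?_⟩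
  · refine hd.mono_right ?_
    have hU : ∀ a : UC L U, a.goal.vars = a.vars := fun a => by
      induction a with
      | top | atom => rfl
      | and a a' ih ih' => simp only [UC.goal, Goal.vars, ih, ih', UC.vars]
    have hB' : ∀ b : BC L, (b.goal U).vars = b.vars := fun b => by
      induction b with
      | top | bot | eq | rel => rfl
      | and a a' ih ih' => simp only [BC.goal, Goal.vars, ih, ih', BC.vars]
    simp only [Goal.vars, hU, hB', subset_refl]
  · have hK : ∀ Γ : Set (IForm L), IForm.Derives Γ (BC.and R'.G B).form →
        IForm.Derives Γ (.and R'.G.form (Goal.and A.goal (B.goal U)).builtinForm) := fun Γ h =>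
      .andI (.andE₁ h) (.andI (A.derives_builtinForm Γ) (by
        rw [B.builtinForm_goal]; exact .andE₂ h))
    rcases hC (.and R'.G B) with h | h
    · refine IForm.Derives.cut h ?_
      refine IForm.Derives.exVars_elim' (fun F hF x _ => fresh_axiom hF x) (fun x hx => ?_)
        (IForm.Derives.exVars_intro' (τ := .var) (fun _ _ => rfl) ?_)
      · have hdep : ∀ F : IForm L, F.DependsOn Set.univ := fun F σ τ h => by
          rw [funext fun x => h x trivial]
        refine ((hdep _).exVars _).fresh fun hx' => hx'.2 ?_
        have hB' : ∀ b : BC L, (b.goal U).vars = b.vars := fun b => by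
          induction b with
          | top | bot | eq | rel => rfl
          | and a a' ih ih' => simp only [BC.goal, Goal.vars, ih, ih', BC.vars]
        simp only [BC.vars, Goal.vars, hB', Finset.coe_union, Set.mem_union, Finset.mem_coe,
          Finset.mem_union] at hx ⊢
        tauto
      · rw [IForm.subst_var]
        exact hK _ (.ax (Set.mem_insert _ _))
    · refine (hs (.impE (h.ent _) (IForm.Derives.exVars_intro' (τ := .var) (fun _ _ => rfl) ?_))).elim
      rw [IForm.subst_var]
      exact ent_atoms.2 fun a ha => .of_mem ha
  · rw [classOf_eq_ofNF, configNF_cons, hc, stateNF_of_dnf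
      (m := (R'.H₁.atoms + R'.H₂.atoms + A.atoms, R'.G.atoms + B.atoms)) _ hs]
    · rfl
    · simp [Goal.dnf, UC.dnf_goal, BC.dnf_goal, singleton_msum]
  · rw [classOf_eq_ofNF, configNF_cons, hc]

theorem FlatSteps.steps (hC : CT.IsComplete) {m m' : Multiset (StateClass CT U)}
    (h : FlatSteps CT P m m') (hm : ∀ s ∈ m, Live s) : Steps CT P (ofNF m) (ofNF m') := by
  induction h with
  | refl => exact .refl
  | tail h' h ih => exact ih.tail (h.step hC (FlatSteps.live h' hm))

/-- Transition sequences from a disjunction run independently in the disjuncts. -/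
theorem FlatSteps.of_add {m n r : Multiset (StateClass CT U)} (h : FlatSteps CT P (m + n) r) :
    ∃ m' n', r = m' + n' ∧ FlatSteps CT P m m' ∧ FlatSteps CT P n n' := by
  induction h with
  | refl => exact ⟨m, n, rfl, .refl, .refl⟩
  | tail _ h ih =>
    obtain ⟨m₁, n₁, rfl, hm, hn⟩ := ih
    obtain ⟨R, hR, R', hv, A, B, V, c, hd, hs, he, rfl⟩ := h
    have hmem : cls CT (R'.H₁.atoms + R'.H₂.atoms + A.atoms) (R'.G.atoms + B.atoms) V ∈ m₁ + n₁ :=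
      he ▸ Multiset.mem_cons_self _ _
    rcases Multiset.mem_add.1 hmem with h1 | h1
    · obtain ⟨c₁, rfl⟩ := Multiset.exists_cons_of_mem h1
      rw [Multiset.cons_add, Multiset.cons_inj_right] at he
      refine ⟨_, n₁, ?_, hm.tail ⟨R, hR, R', hv, A, B, V, c₁, hd, hs, rfl, rfl⟩, hn⟩
      rw [← he, add_assoc]
    · obtain ⟨c₁, rfl⟩ := Multiset.exists_cons_of_mem h1
      rw [Multiset.add_cons, Multiset.cons_inj_right] at he
      refine ⟨m₁, _, ?_, hm, hn.tail ⟨R, hR, R', hv, A, B, V, c₁, hd, hs, rfl, rfl⟩⟩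
      rw [← he, add_left_comm]

end FlatSteps

/-! ## Refinement of flat states -/

section Refinement

variable {L : FirstOrder.Language.{u, v}} {U : ℕ → Type w} {CT : ConstraintTheory L}

/-- The state `s` is an instance of the flat state `⟨A ∧ B; V⟩`, with additional built-in
constraints and global variables. -/
def Refines (s : StateClass CT U) (A : Multiset (UC L U)) (B : Multiset (BC L)) (V : Finset ℕ) :
    Prop :=
  ∃ (σ : ℕ → L.Term ℕ) (B₁ : Multiset (BC L)) (V₁ : Finset ℕ), (∀ x ∈ V, σ x = .var x) ∧
    V ⊆ V₁ ∧ s = cls CT (usubst A σ) B₁ V₁ ∧ ∀ b ∈ bsubst B σ, CT.Ent B₁ b.form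

theorem Refines.refl (A : Multiset (UC L U)) (B : Multiset (BC L)) (V : Finset ℕ) :
    Refines (cls CT A B V) A B V :=
  ⟨.var, B, V, fun _ _ => rfl, subset_rfl, by rw [usubst_var], by
    rw [bsubst_var]; exact fun b hb => .of_mem hb⟩

theorem Refines.not_unsat {s : StateClass CT U} {A : Multiset (UC L U)} {B : Multiset (BC L)}
    {V : Finset ℕ} (h : Refines s A B V) (hs : Live s) : ¬ CT.Unsat B := by
  obtain ⟨σ, B₁, V₁, -, -, rfl, hB⟩ := h
  exact fun hu => live_cls_iff.1 hs (hu.of_subst hB)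

open ConstraintTheory in
-- The store `B₁` implies the instance under `σ` of the projection of `B'`. Its witnesses are named
-- by fresh variables `f x`, and the resulting instance of `B'` is added to `B₁`, which leaves the
-- class of the refining state unchanged.
theorem Refines.applyCT {s : StateClass CT U} {A : UC L U} {B B' : BC L} {V : Finset ℕ}
    (h : CT.Entails (.imp (.exVars (strictLocals A B V) B.form)
      (.exVars (strictLocals A B' V) B'.form)))
    (hs : Refines s A.atoms B.atoms V) : Refines s A.atoms B'.atoms V := by
  obtain ⟨σ, B₁, V₁, hV, hV₁, rfl, hB⟩ := hs
  rw [← BC.atoms_subst] at hB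
  have h1 : CT.Ent B₁ ((IForm.exVars (strictLocals A B' V) B'.form).subst σ) := by
    have := (Ent.subst (entails_iff.1 h) σ).mono (Multiset.zero_subset B₁)
    refine .impE this (IForm.Derives.exVars_intro (τ := σ) (fun _ _ => rfl) ?_)
    rw [← B.form_subst]
    exact ent_atoms.2 hB
  obtain ⟨f, hf, hfF⟩ := exists_fresh_injection (V₁ ∪ uvars (usubst A.atoms σ) ∪ bvars B₁ ∪
    B'.vars.biUnion fun z => (σ z).varFinset)
  simp only [Finset.mem_union, not_or, Finset.mem_biUnion, not_exists, not_and] at hfF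
  set τ : ℕ → L.Term ℕ := fun x => if x ∈ strictLocals A B' V then .var (f x) else σ x with hτ
  have h2 := h1.exVars_subst (τ := τ) hf (fun x hx => by simp [hτ, hx])
    (fun x hx => by simp [hτ, hx]) fun z hz _ x => (hfF x).2 z hz
  have hτσ : ∀ x, x ∉ strictLocals A B' V → τ x = σ x := fun x hx => by simp [hτ, hx]
  refine ⟨τ, B₁ + (B'.subst τ).atoms, V₁, fun x hx => ?_, hV₁, ?_, ?_⟩
  · rw [hτσ x (by simp [strictLocals, hx]), hV x hx]
  · rw [usubst_congr (σ := τ) (τ := σ)]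
    · refine cls_add_of_exVars (fun y hy => ?_) h2
      obtain ⟨x, -, rfl⟩ := Finset.mem_image.1 hy
      exact ⟨(hfF x).1.1.1, (hfF x).1.1.2, (hfF x).1.2⟩
    · intro x hx
      rw [UC.uvars_atoms] at hx
      exact hτσ x (by simp [strictLocals, hx])
  · rw [← BC.atoms_subst]
    exact fun b hb => .of_mem (by simp [hb])

/-- If `x` is already global in the refining state, `σ` is reset at `x`, where its value is
irrelevant. Otherwise `x` is local there; it is renamed to a fresh `z`, after which `x` can be
declared global. -/
theorem Refines.insert_global (hEq : CT.HasEquality) {s : StateClass CT U}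
    {A : Multiset (UC L U)} {B : Multiset (BC L)} {V : Finset ℕ} {x : ℕ} (hA : x ∉ uvars A)
    (hB : x ∉ bvars B) (hs : Refines s A B V) : Refines s A B (insert x V) := by
  obtain ⟨σ, B₁, V₁, hV, hV₁, rfl, hB₁⟩ := hs
  by_cases hx : x ∈ V₁
  · refine ⟨Function.update σ x (.var x), B₁, V₁, fun y hy => ?_, ?_, ?_, ?_⟩
    · by_cases hyx : y = x
      · simp [hyx]
      · rw [Function.update_of_ne hyx]
        exact hV y (by simpa [hyx] using hy)
    · exact Finset.insert_subset hx hV₁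
    · rw [usubst_congr fun y hy => ?_]
      have : y ≠ x := fun e => hA (e ▸ hy)
      exact (Function.update_of_ne this _ _).symm
    · rwa [bsubst_congr (τ := σ) fun y hy => ?_]
      have : y ≠ x := fun e => hB (e ▸ hy)
      exact Function.update_of_ne this _ _
  · obtain ⟨z, hz⟩ := Infinite.exists_notMem_finset (V₁ ∪ uvars (usubst A σ) ∪ bvars B₁ ∪ {x})
    simp only [Finset.mem_union, not_or, Finset.mem_singleton] at hz
    set ρ : ℕ → L.Term ℕ := single x (.var z) with hρ
    have hxρ : ∀ a, x ∉ (ρ a).varFinset := fun a ha => by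
      by_cases hax : a = x
      · simp [hρ, single, hax] at ha; exact hz.2 ha.symm
      · simp [hρ, single, hax] at ha; exact hax ha.symm
    set τ : ℕ → L.Term ℕ := fun y => if y = x then .var x else (σ y).subst ρ with hτ
    have hτσ : ∀ y, y ≠ x → (σ y).subst ρ = τ y := fun y hy => by simp [hτ, hy]
    have hAτ : usubst (usubst A σ) ρ = usubst A τ := by
      rw [usubst_usubst]
      exact usubst_congr fun y hy => hτσ y fun e => hA (e ▸ hy)
    refine ⟨τ, bsubst B₁ ρ, insert x V₁, fun y hy => ?_, Finset.insert_subset_insert _ hV₁, ?_, ?_⟩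
    · by_cases hyx : y = x
      · simp [hτ, hyx]
      · rw [← hτσ y hyx, hV y (by simpa [hyx] using hy)]
        simp [hρ, single, hyx]
    · rw [cls_rename_local hEq hx hz.1.1.1 hz.1.1.2 hz.1.2, ← hρ, hAτ, cls_insert_global]
      · rw [← hAτ]
        intro h
        obtain ⟨a, -, ha⟩ := mem_uvars_usubst.1 h
        exact hxρ a ha
      · intro h
        obtain ⟨a, -, ha⟩ := mem_bvars_bsubst.1 h
        exact hxρ a ha
    · rw [← bsubst_congr (σ := fun y => (σ y).subst ρ) fun y hy => hτσ y fun e => hB (e ▸ hy),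
        ← bsubst_bsubst]
      exact ConstraintTheory.Ent.bsubst hB₁ ρ

/-- Some disjunct of the state `S` is refined by `s`. -/
def RefinesState (s : StateClass CT U) (S : State L U) : Prop :=
  ∃ m ∈ S.goal.dnf, Refines s m.1 m.2 S.globals

theorem refinesState_normal {s : StateClass CT U} {A : UC L U} {B : BC L} {V : Finset ℕ} :
    RefinesState s (.normal A B V) ↔ Refines s A.atoms B.atoms V := by
  simp [RefinesState, State.normal, dnf_normal_goal]

/-- Being refined by `s` is a property of the class of `S`. Liveness of `s` serves the failure rule:
no satisfiable state refines a state containing `⊥`. -/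
theorem refinesState_iff (hEq : CT.HasEquality) {s : StateClass CT U} (hs : Live s)
    {S S' : State L U} (h : StateEquiv CT S S') : RefinesState s S ↔ RefinesState s S' := by
  induction h with
  | refl => rfl
  | symm _ ih => exact ih.symm
  | trans _ _ ih ih' => exact ih.trans ih'
  | goalTransformation V h => simp only [RefinesState, h.dnf_eq]
  | eqSubst A x t B V =>
    rw [refinesState_normal, refinesState_normal]
    refine exists_congr fun σ => exists_congr fun B₁ => exists_congr fun V₁ =>
      and_congr_right fun _ => and_congr_right fun _ => and_congr_left fun hB => ?_
    rw [UC.atoms_subst, usubst_usubst]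
    -- The store `B₁` entails the instance of `x ≐ t`, so substituting `t` for `x` before applying
    -- `σ` gives provably equal terms.
    have := cls_congr_user hEq (A := A.atoms) (A' := 0) (B := B₁) (V := V₁) (σ := σ)
      (τ := fun y => (single x t y).subst σ) fun y _ => by
        by_cases hy : y = x
        · subst hy
          have := hB ((BC.eq (.var y) t).subst σ)
            (mem_bsubst.2 ⟨_, by simp [BC.atoms], rfl⟩)
          simpa [single, BC.subst] using this
        · simpa [single, hy] using hEq.refl B₁ (σ y)
    rw [add_zero, add_zero] at this
    rw [this]
  | applyCT A B B' V h h' =>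
    rw [refinesState_normal, refinesState_normal]
    exact ⟨.applyCT h, .applyCT h'⟩
  | redundantGlobal G x V hx =>
    refine exists_congr fun m => and_congr_right fun hm => ?_
    have := Goal.vars_of_mem_dnf hm
    constructor
    · rintro ⟨σ, B₁, V₁, hV, hV₁, hs, hB⟩
      exact ⟨σ, B₁, V₁, fun y hy => hV y (by simp [hy]),
        (Finset.subset_insert _ _).trans hV₁, hs, hB⟩
    · exact .insert_global hEq (fun h => hx (this (by simp [h]))) fun h => hx (this (by simp [h]))
  | failed G G' V V' =>
    have : ∀ (G : Goal L U) (V : Finset ℕ), ¬ RefinesState s ⟨.and G .bot, V⟩ := by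
      rintro G V ⟨m, hm, h⟩
      obtain ⟨x, hx, y, hy, rfl⟩ := mem_msum.1 hm
      rw [Goal.dnf, Multiset.mem_singleton] at hy
      subst hy
      exact h.not_unsat hs (ConstraintTheory.Ent.of_mem (b := .bot) (by simp))
    simp only [this]

open ConstraintTheory in
theorem refines_atoms_conj {s : StateClass CT U} {A : Multiset (UC L U)} {B : Multiset (BC L)}
    {V : Finset ℕ} : Refines s (conjU A).atoms (conjB B).atoms V ↔ Refines s A B V := by
  refine exists_congr fun σ => exists_congr fun B₁ => exists_congr fun V₁ =>
    and_congr_right fun _ => and_congr_right fun _ => and_congr ?_ ?_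
  · rw [← UC.atoms_subst]
    have : cls CT ((conjU A).subst σ).atoms B₁ V₁ = cls CT (usubst A σ) B₁ V₁ :=
      Quotient.sound (.goalTransformation _
        (((UC.conjU_atoms _).trans (conjU_subst A σ)).andCongr (.refl _)))
    rw [this]
  · rw [← BC.atoms_subst]
    refine derives_atoms.symm.trans ?_
    rw [BC.form_subst]
    exact derives_conjB_subst

/-- Refinement between classes of states. -/
def Le (s t : StateClass CT U) : Prop := ∃ A B V, t = cls CT A B V ∧ Refines s A B V

/-- By `refinesState_iff` the representative chosen in the definition of `Le` is immaterial. -/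
theorem Le.refines (hEq : CT.HasEquality) {s : StateClass CT U} (hs : Live s)
    {A : Multiset (UC L U)} {B : Multiset (BC L)} {V : Finset ℕ} (h : Le s (cls CT A B V)) :
    Refines s A B V := by
  obtain ⟨A', B', V', he, h⟩ := h
  have := refinesState_iff hEq hs (Quotient.exact he)
  rw [refinesState_normal, refinesState_normal, refines_atoms_conj, refines_atoms_conj] at this
  exact this.2 h

theorem Le.refl {s : StateClass CT U} (h : Live s) : Le s s := by
  obtain ⟨A, B, V, rfl, -⟩ := h
  exact ⟨A, B, V, rfl, .refl _ _ _⟩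

theorem Le.trans (hEq : CT.HasEquality) {r s t : StateClass CT U} (hr : Live r) (h : Le r s)
    (h' : Le s t) : Le r t := by
  obtain ⟨A, B, V, rfl, σ, B₁, V₁, hV, hV₁, rfl, hB⟩ := h'
  obtain ⟨τ, B₂, V₂, hV', hV₂, rfl, hB'⟩ := h.refines hEq hr
  refine ⟨A, B, V, rfl, fun x => (σ x).subst τ, B₂, V₂, fun x hx => ?_, hV₁.trans hV₂, ?_, ?_⟩
  · simp only [hV x hx]; exact hV' x (hV₁ hx)
  · rw [usubst_usubst]
  · rw [← bsubst_bsubst]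
    exact fun b hb => ConstraintTheory.Ent.trans hB' (ConstraintTheory.Ent.bsubst hB τ b hb)

end Refinement

/-! ## States without user-defined constraints -/

section Pure

variable {L : FirstOrder.Language.{u, v}} {U : ℕ → Type w} {CT : ConstraintTheory L}

/-- The class has a representative without user-defined constraints. -/
def Pure (s : StateClass CT U) : Prop := ∃ B V, s = cls CT 0 B V

/-- The projection of a built-in constraint to the variables in `V`. -/
def proj (b : BC L) (V : Finset ℕ) : IForm L := .exVars (b.vars \ V) b.form

theorem fresh_proj {b : BC L} {V : Finset ℕ} {x : ℕ} (hx : x ∉ V) : IForm.Fresh x (proj b V) := by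
  refine ((BC.form_dependsOn b).exVars _).fresh fun h => h.2 ?_
  simpa [hx] using h.1

open ConstraintTheory in
theorem entails_proj {b b' : BC L} {V V' : Finset ℕ} (hV : V' ⊆ V)
    (h : CT.Ent b.atoms (proj b' V')) : CT.Entails (.imp (proj b V) (proj b' V')) := by
  refine .impI (IForm.Derives.exVars_elim' (fun F hF x _ => fresh_axiom hF x) (fun x hx => ?_) ?_)
  · exact fresh_proj fun h => (Finset.mem_sdiff.1 hx).2 (hV h)
  · refine IForm.Derives.cutSet h ?_
    rintro F (hF | ⟨c, hc, rfl⟩)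
    · exact .ax (.inr hF)
    · exact derives_atoms.1 (.ax (Set.mem_insert _ _)) c hc

open ConstraintTheory in
theorem entails_proj_of_atoms {b b' : BC L} (V : Finset ℕ)
    (h : ∀ c ∈ b'.atoms, CT.Ent b.atoms c.form) : CT.Entails (.imp (proj b V) (proj b' V)) := by
  refine entails_proj subset_rfl (IForm.Derives.exVars_intro' (τ := .var) (fun _ _ => rfl) ?_)
  rw [IForm.subst_var]
  exact ent_atoms.2 h

theorem ConstraintTheory.Entails.imp_trans {A B C : IForm L} (h : CT.Entails (.imp A B))
    (h' : CT.Entails (.imp B C)) : CT.Entails (.imp A C) :=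
  .impI (.impE (h'.mono (Set.subset_insert _ _))
    (.impE (h.mono (Set.subset_insert _ _)) (.ax (Set.mem_insert _ _))))

/-- All satisfiable disjuncts of `S` are free of user-defined constraints, and their projections
imply `C`. -/
def ProjImplies (CT : ConstraintTheory L) (S : State L U) (C : IForm L) : Prop :=
  ∀ m ∈ S.goal.dnf, ¬ CT.Unsat m.2 →
    m.1 = 0 ∧ CT.Entails (.imp (proj (conjB m.2) S.globals) C)

open ConstraintTheory in
theorem projImplies_normal {A : UC L U} {B : BC L} {V : Finset ℕ} {C : IForm L} :
    ProjImplies CT (.normal A B V) C ↔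
      (¬ CT.Unsat B.atoms → A.atoms = 0 ∧ CT.Entails (.imp (proj B V) C)) := by
  have hB : CT.Ent B.atoms B.form := ent_atoms.2 fun a ha => .of_mem ha
  have h1 : CT.Entails (.imp (proj B V) (proj (conjB B.atoms) V)) := by
    refine entails_proj_of_atoms V (ent_atoms.1 (ent_conjB.2 fun b hb => .of_mem hb))
  have h2 : CT.Entails (.imp (proj (conjB B.atoms) V) (proj B V)) := by
    refine entails_proj_of_atoms V fun c hc => ?_
    exact ent_conjB.1 (ent_atoms.2 fun a ha => .of_mem ha) c hc
  simp only [ProjImplies, State.normal, dnf_normal_goal, Multiset.mem_singleton, forall_eq]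
  exact imp_congr_right fun _ => and_congr_right fun _ => ⟨h1.imp_trans, h2.imp_trans⟩

/-- With `C` arbitrary, this makes emptiness of the user-defined store and the strength of the
projection to the globals invariants of a satisfiable flat state without user-defined constraints.
For an empty user-defined store the strictly local variables are all the variables that are not
global, so the rule for built-in stores compares exactly the projections. -/
theorem projImplies_iff {S S' : State L U} (h : StateEquiv CT S S') (C : IForm L) :
    ProjImplies CT S C ↔ ProjImplies CT S' C := by
  induction h with
  | refl => rfl
  | symm _ ih => exact ih.symm
  | trans _ _ ih ih' => exact ih.trans ih'
  | goalTransformation V h => simp only [ProjImplies, h.dnf_eq]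
  | eqSubst A x t B V =>
    rw [projImplies_normal, projImplies_normal, UC.atoms_subst, usubst, Multiset.map_eq_zero]
  | applyCT A B B' V h h' =>
    rw [projImplies_normal, projImplies_normal]
    have hu : CT.Unsat B.atoms ↔ CT.Unsat B'.atoms :=
      ⟨unsat_of_entails_strictLocals h', unsat_of_entails_strictLocals h⟩
    rw [hu]
    refine imp_congr_right fun _ => and_congr_right fun hA => ?_
    have hvars : A.vars = ∅ := by rw [← UC.uvars_atoms, hA]; rfl
    have hl : ∀ b : BC L, strictLocals A b V = b.vars \ V := fun b => by
      simp [strictLocals, hvars]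
    rw [hl, hl] at h h'
    exact ⟨h'.imp_trans, h.imp_trans⟩
  | redundantGlobal G x V hx =>
    refine forall_congr' fun m => imp_congr_right fun hm => ?_
    have := Goal.vars_of_mem_dnf hm
    have hxm : x ∉ (conjB m.2).vars := fun h => hx (this (by simp [vars_conjB] at h; simp [h]))
    have hs : (conjB m.2).vars \ insert x V = (conjB m.2).vars \ V := by
      rw [Finset.sdiff_insert_of_notMem hxm]
    simp only [proj, hs]
  | failed G G' V V' =>
    have : ∀ (G : Goal L U) (V : Finset ℕ), ProjImplies CT ⟨.and G .bot, V⟩ C := by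
      intro G V m hm hu
      obtain ⟨x, hx, y, hy, rfl⟩ := mem_msum.1 hm
      rw [Goal.dnf, Multiset.mem_singleton] at hy
      subst hy
      exact (hu (ConstraintTheory.Ent.of_mem (b := .bot) (by simp))).elim
    simp only [this]

open ConstraintTheory in
theorem projImplies_conj {A : Multiset (UC L U)} {B : Multiset (BC L)} {V : Finset ℕ}
    {C : IForm L} (hB : ¬ CT.Unsat B) : ProjImplies CT (.normal (conjU A) (conjB B) V) C ↔
      (conjU A).atoms = 0 ∧ CT.Entails (.imp (proj (conjB B) V) C) := by
  rw [projImplies_normal]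
  have : ¬ CT.Unsat (conjB B).atoms := fun h' => hB (h'.of_ent fun b hb =>
    (ent_atoms.1 (ent_conjB.2 fun c hc => .of_mem hc)) b hb)
  simp [this]

theorem conjU_zero_atoms : (conjU (0 : Multiset (UC L U))).atoms = 0 := by simp [conjU, UC.atoms]

theorem entails_imp_self (C : IForm L) : CT.Entails (.imp C C) :=
  .impI (.ax (Set.mem_insert _ _))

theorem entails_proj_of_cls_eq {B B' : Multiset (BC L)} {V V' : Finset ℕ}
    (h : cls (U := U) CT 0 B V = cls CT 0 B' V') (hB : ¬ CT.Unsat B) :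
    CT.Entails (.imp (proj (conjB B) V) (proj (conjB B') V')) := by
  have hB' : ¬ CT.Unsat B' := by rw [← live_cls_iff (U := U) (A := 0) (V := V'), ← h]; exact live_cls_iff.2 hB
  have := projImplies_iff (Quotient.exact h) (proj (conjB B') V')
  rw [projImplies_conj hB, projImplies_conj hB'] at this
  exact (this.2 ⟨conjU_zero_atoms, entails_imp_self _⟩).2

theorem Pure.atoms_eq_zero {A : UC L U} {B : BC L} {V : Finset ℕ}
    (h : Pure (Quotient.mk (stateSetoid CT U) (.normal A B V))) (hB : ¬ CT.Unsat B.atoms) :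
    A.atoms = 0 := by
  obtain ⟨B', V', he⟩ := h
  have hB' : ¬ CT.Unsat B' := by
    rw [← live_cls_iff (U := U) (A := 0) (V := V'), ← he, mk_normal]
    exact live_cls_iff.2 hB
  have := projImplies_iff (Quotient.exact he) .top
  rw [projImplies_conj hB', projImplies_normal] at this
  exact (this.2 ⟨conjU_zero_atoms, .impI .topI⟩ hB).1

theorem Le.pure {s t : StateClass CT U} (hEq : CT.HasEquality) (hs : Live s) (h : Le s t)
    (ht : Pure t) : Pure s := by
  obtain ⟨B, V, rfl⟩ := ht
  obtain ⟨σ, B₁, V₁, -, -, rfl, -⟩ := h.refines hEq hs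
  exact ⟨B₁, V₁, rfl⟩

/-- The matching substitution fixes the globals `V'`, so its other values are witnesses for the
variables quantified in the projection. -/
theorem Le.entails_proj {B B' : Multiset (BC L)} {V V' : Finset ℕ} (hEq : CT.HasEquality)
    (hB : ¬ CT.Unsat B) (h : Le (cls (U := U) CT 0 B V) (cls CT 0 B' V')) :
    CT.Entails (.imp (proj (conjB B) V) (proj (conjB B') V')) := by
  obtain ⟨σ, B₁, V₁, hV, hV₁, he, hB₁⟩ := h.refines hEq (live_cls_iff.2 hB)
  refine (entails_proj_of_cls_eq (he.trans (by rw [usubst_zero])) hB).imp_trans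
    (CHR.entails_proj hV₁ ?_)
  rw [proj, vars_conjB]
  refine ConstraintTheory.Ent.exVars_of_subst (fun x hx _ => hV x hx) fun b hb => ?_
  exact ConstraintTheory.Ent.trans (ConstraintTheory.ent_conjB.1
    (ConstraintTheory.ent_atoms.2 fun a ha => .of_mem ha)) (hB₁ b hb)

/-- Without user-defined constraints every variable that is not global is local, so all of them can
be renamed at once; the inverse of `f` renames back. -/
theorem cls_zero_rename {B : Multiset (BC L)} {V : Finset ℕ} {f : ℕ → ℕ}
    (hf : Function.Injective f) (hV : ∀ x, f x ∉ V) :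
    cls (U := U) CT 0 B V =
      cls CT 0 (bsubst B fun x => if x ∈ V then .var x else .var (f x)) V := by
  refine cls_congr_of_subst
    (σ := fun y => if y ∈ V then .var y else .var (Function.invFun f y))
    (τ := fun x => if x ∈ V then .var x else .var (f x)) ?_ ?_ ?_ ?_
  · rintro x (hx | hx) _
    · simp [hx]
    · simp [uvars] at hx
  · rw [bsubst_bsubst, bsubst_eq_self]
    · exact fun b hb => .of_mem hb
    · intro x _
      by_cases hx : x ∈ V
      · simp [hx]
      · simp [hx, hV, Function.leftInverse_invFun hf x]
  · rintro x (hx | hx) _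
    · simp [hx]
    · simp [uvars] at hx
  · exact fun b hb => .of_mem hb

/-- Two pure states have representatives with the same global variables. -/
theorem exists_common_globals {s t : StateClass CT U} (hs : Pure s) (ht : Pure t) :
    ∃ B B' V, s = cls CT 0 B V ∧ t = cls CT 0 B' V := by
  obtain ⟨B, V, rfl⟩ := hs
  obtain ⟨B', V', rfl⟩ := ht
  -- The local variables of both states are moved away from both sets of globals; afterwards the
  -- missing globals are redundant and may be added.
  obtain ⟨f, hf, hfV⟩ := exists_fresh_injection (V ∪ V')
  simp only [Finset.mem_union, not_or] at hfV
  have key : ∀ (B : Multiset (BC L)) (V W : Finset ℕ), (∀ x, f x ∉ V) → (∀ x, f x ∉ W) →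
      cls (U := U) CT 0 B V =
        cls CT 0 (bsubst B fun x => if x ∈ V then .var x else .var (f x)) (W ∪ V) := by
    intro B V W hV hW
    rw [cls_zero_rename hf hV, cls_union_globals]
    refine fun x hx hxV => ⟨by simp [uvars], fun h => ?_⟩
    obtain ⟨y, -, hy⟩ := mem_bvars_bsubst.1 h
    by_cases hyV : y ∈ V
    · simp only [hyV, if_true, mem_varFinset_var] at hy
      exact hxV (hy ▸ hyV)
    · simp only [hyV, if_false, mem_varFinset_var] at hy
      exact hW y (hy ▸ hx)
  have h' := key B' V' V (fun x => (hfV x).2) (fun x => (hfV x).1)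
  rw [Finset.union_comm] at h'
  exact ⟨_, _, _, key B V V' (fun x => (hfV x).1) (fun x => (hfV x).2), h'⟩

theorem strictLocals_conjU_zero (b : BC L) (V : Finset ℕ) :
    strictLocals (conjU (0 : Multiset (UC L U))) b V = b.vars \ V := by
  simp [strictLocals, conjU, UC.vars]

theorem Le.antisymm (hEq : CT.HasEquality) {s t : StateClass CT U} (hs : Live s) (ht : Live t)
    (hps : Pure s) (hpt : Pure t) (h : Le s t) (h' : Le t s) : s = t := by
  obtain ⟨B, B', V, rfl, rfl⟩ := exists_common_globals hps hpt
  refine Quotient.sound (.applyCT _ _ _ _ ?_ ?_)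
  · rw [strictLocals_conjU_zero, strictLocals_conjU_zero]
    exact h.entails_proj hEq (live_cls_iff.1 hs)
  · rw [strictLocals_conjU_zero, strictLocals_conjU_zero]
    exact h'.entails_proj hEq (live_cls_iff.1 ht)

/-- Refinement between pure states implies state entailment of flat representatives. -/
theorem Le.stateEntails (hEq : CT.HasEquality) {s t : StateClass CT U} (hs : Live s)
    (hps : Pure s) (hpt : Pure t) (h : Le s t) : ∃ B B' V,
      s = cls CT 0 B V ∧ t = cls CT 0 B' V ∧
        StateEntails CT (.normal (conjU (0 : Multiset (UC L U))) (conjB B) V)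
          (.normal (conjU 0) (conjB B') V) := by
  obtain ⟨B, B', V, rfl, rfl⟩ := exists_common_globals hps hpt
  refine ⟨B, B', V, rfl, rfl, .weakenBuiltin _ _ _ _ ?_⟩
  rw [strictLocals_conjU_zero, strictLocals_conjU_zero]
  exact h.entails_proj hEq (live_cls_iff.1 hs)

end Pure

/-! ## Phase semantics of linear logic -/

open scoped Pointwise

section Closure

variable {M : Type*} [AddCommMonoid M]

/-- The double orthogonal of a set with respect to a pole. -/
def cl (pole X : Set M) : Set M := {m | ∀ k, (∀ x ∈ X, x + k ∈ pole) → m + k ∈ pole}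

/-- The elements that admit weakening and contraction. -/
def duplicable (pole : Set M) : Set M :=
  {m | (∀ k ∈ pole, m + k ∈ pole) ∧ ∀ k, m + (m + k) ∈ pole → m + k ∈ pole}

variable {pole X Y Z : Set M}

theorem subset_cl : X ⊆ cl pole X := fun m hm _ h => h m hm

theorem cl_subset_cl (h : X ⊆ cl pole Y) : cl pole X ⊆ cl pole Y :=
  fun _ hm k hk => hm k fun _ hx => h hx k hk

theorem cl_mono (h : X ⊆ Y) : cl pole X ⊆ cl pole Y := cl_subset_cl (h.trans subset_cl)

theorem cl_cl : cl pole (cl pole X) = cl pole X :=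
  (cl_subset_cl subset_rfl).antisymm subset_cl

/-- The summand from `Y` is absorbed into the element against which membership in the closure is
tested. -/
theorem cl_add_subset (h : X + Y ⊆ cl pole Z) : cl pole X + Y ⊆ cl pole Z := by
  rintro _ ⟨m, hm, y, hy, rfl⟩ k hk
  change m + y + k ∈ pole
  rw [add_assoc]
  refine hm _ fun x hx => ?_
  rw [← add_assoc]
  exact h (Set.add_mem_add hx hy) k hk

theorem cl_add_cl : cl pole X + cl pole Y ⊆ cl pole (X + Y) := by
  refine cl_add_subset ?_
  rw [add_comm]
  refine cl_add_subset ?_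
  rw [add_comm]
  exact subset_cl

theorem zero_mem_duplicable : (0 : M) ∈ duplicable pole := by simp [duplicable]

theorem add_mem_duplicable {m n : M} (hm : m ∈ duplicable pole) (hn : n ∈ duplicable pole) :
    m + n ∈ duplicable pole := by
  refine ⟨fun k hk => ?_, fun k hk => ?_⟩
  · rw [add_assoc]; exact hm.1 _ (hn.1 _ hk)
  · rw [add_assoc]
    refine hm.2 _ ?_
    have h1 : n + (n + (m + (m + k))) ∈ pole := by
      convert hk using 1; abel
    convert hn.2 _ h1 using 1; abel

end Closure

/-! ### Interpretation of linear-logic formulas and soundness. -/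

section Phase

variable {L : FirstOrder.Language.{u, v}} {U : ℕ → Type w}

/-- The interpretation of the formulas of linear logic. -/
def sem (pole : Set (FlatGoal L U)) : LForm L U → (ℕ → L.Term ℕ) → Set (FlatGoal L U)
  | .user c ts, σ => cl pole {({.atom c fun i => (ts i).subst σ}, 0)}
  | .eq s t, σ => cl pole {(0, {.eq (s.subst σ) (t.subst σ)})}
  | .rel c ts, σ => cl pole {(0, {.rel c fun i => (ts i).subst σ})}
  | .one, _ => cl pole {0}
  | .zero, _ => cl pole ∅
  | .top, _ => Set.univ
  | .tensor A B, σ => cl pole (sem pole A σ + sem pole B σ)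
  | .lolli A B, σ => {m | ∀ a ∈ sem pole A σ, m + a ∈ sem pole B σ}
  | .with_ A B, σ => sem pole A σ ∩ sem pole B σ
  | .plus A B, σ => cl pole (sem pole A σ ∪ sem pole B σ)
  | .bang A, σ => cl pole (sem pole A σ ∩ duplicable pole)
  | .all A, σ => {m | ∀ t, m ∈ sem pole A (consSubst t σ)}
  | .ex A, σ => cl pole {m | ∃ t, m ∈ sem pole A (consSubst t σ)}

variable {pole : Set (FlatGoal L U)}

/-- All interpretations are closed sets, so a closure is included in one of them as soon as its
generators are. -/
theorem cl_sem (A : LForm L U) (σ : ℕ → L.Term ℕ) : cl pole (sem pole A σ) = sem pole A σ := by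
  refine Set.Subset.antisymm ?_ subset_cl
  induction A generalizing σ with
  | user | eq | rel | one | zero | tensor | plus | bang | ex => simp only [sem, cl_cl]; rfl
  | top => exact fun _ _ => trivial
  | lolli A B _ ih =>
    intro m hm a ha
    refine ih σ fun k hk => ?_
    rw [add_assoc]
    refine hm _ fun x hx => ?_
    rw [← add_assoc]
    exact hk _ (hx a ha)
  | with_ A B ih ih' =>
    exact fun m hm => ⟨ih σ (cl_mono Set.inter_subset_left hm),
      ih' σ (cl_mono Set.inter_subset_right hm)⟩
  | all A ih => exact fun m hm t => ih _ (cl_mono (X := sem pole (.all A) σ) (fun x hx => hx t) hm)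

theorem sem_cl_add_subset {X Y : Set (FlatGoal L U)} {A : LForm L U} {σ : ℕ → L.Term ℕ}
    (h : X + Y ⊆ sem pole A σ) : cl pole X + Y ⊆ sem pole A σ := by
  rw [← cl_sem] at h ⊢
  exact cl_add_subset h

theorem liftSubst_consSubst (t : L.Term ℕ) (τ σ : ℕ → L.Term ℕ) :
    (fun x => (liftSubst τ x).subst (consSubst t σ)) = consSubst t fun x => (τ x).subst σ := by
  funext x
  cases x with
  | zero => rfl
  | succ n => simp only [liftSubst, term_subst_subst, consSubst]; rfl

theorem sem_subst (A : LForm L U) (τ σ : ℕ → L.Term ℕ) :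
    sem pole (A.subst τ) σ = sem pole A fun x => (τ x).subst σ := by
  induction A generalizing τ σ with
  | user | eq | rel => simp only [LForm.subst, sem, term_subst_subst]
  | one | zero | top => rfl
  | tensor A B ih ih' | lolli A B ih ih' | with_ A B ih ih' | plus A B ih ih' =>
    simp only [LForm.subst, sem, ih, ih']
  | bang A ih => simp only [LForm.subst, sem, ih]
  | all A ih | ex A ih => simp only [LForm.subst, sem, ih, liftSubst_consSubst]

theorem sem_shift (A : LForm L U) (t : L.Term ℕ) (σ : ℕ → L.Term ℕ) :
    sem pole A.shift (consSubst t σ) = sem pole A σ := sem_subst _ _ _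

theorem sem_inst (A : LForm L U) (t : L.Term ℕ) (σ : ℕ → L.Term ℕ) :
    sem pole (A.subst (instSubst t)) σ = sem pole A (consSubst (t.subst σ) σ) := by
  rw [sem_subst, instSubst_comp]

/-- The interpretation of a multiset of formulas. -/
def semCtx (pole : Set (FlatGoal L U)) (Γ : Multiset (LForm L U)) (σ : ℕ → L.Term ℕ) :
    Set (FlatGoal L U) := (Γ.map fun A => sem pole A σ).sum

@[simp] theorem semCtx_cons (A : LForm L U) (Γ : Multiset (LForm L U)) (σ : ℕ → L.Term ℕ) :
    semCtx pole (A ::ₘ Γ) σ = sem pole A σ + semCtx pole Γ σ := by simp [semCtx]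

@[simp] theorem semCtx_add (Γ Δ : Multiset (LForm L U)) (σ : ℕ → L.Term ℕ) :
    semCtx pole (Γ + Δ) σ = semCtx pole Γ σ + semCtx pole Δ σ := by simp [semCtx]

theorem semCtx_map_shift (Γ : Multiset (LForm L U)) (t : L.Term ℕ) (σ : ℕ → L.Term ℕ) :
    semCtx pole (Γ.map LForm.shift) (consSubst t σ) = semCtx pole Γ σ := by
  simp only [semCtx, Multiset.map_map, Function.comp_def, sem_shift]

/-- This is the content of promotion: up to closure, each summand is duplicable, and duplicable
elements are closed under addition. -/
theorem semCtx_map_bang (Γ : Multiset (LForm L U)) (σ : ℕ → L.Term ℕ) :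
    semCtx pole (Γ.map LForm.bang) σ ⊆
      cl pole (semCtx pole (Γ.map LForm.bang) σ ∩ duplicable pole) := by
  induction Γ using Multiset.induction_on with
  | empty =>
    rintro m hm
    refine subset_cl ⟨hm, ?_⟩
    simp only [semCtx, Multiset.map_zero, Multiset.sum_zero, Set.mem_zero] at hm
    exact hm ▸ zero_mem_duplicable
  | cons A Γ ih =>
    rw [Multiset.map_cons, semCtx_cons]
    refine (Set.add_subset_add subset_rfl ih).trans (cl_add_cl.trans (cl_mono ?_))
    rintro _ ⟨a, ha, g, hg, rfl⟩
    exact ⟨Set.add_mem_add (subset_cl ha) hg.1, add_mem_duplicable ha.2 hg.2⟩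

/-- Derivable sequents are valid in every phase model. -/
theorem LForm.Derives.sound {Γ : Multiset (LForm L U)} {A : LForm L U} (h : LForm.Derives Γ A)
    (σ : ℕ → L.Term ℕ) : semCtx pole Γ σ ⊆ sem pole A σ := by
  induction h generalizing σ with
  | identity => simp [semCtx]
  | cut _ _ ih ih' =>
    rw [semCtx_add]
    exact (Set.add_subset_add (ih σ) subset_rfl).trans (by simpa using ih' σ)
  | tensorL _ ih =>
    rw [semCtx_cons]
    refine sem_cl_add_subset ?_
    simpa [add_assoc] using ih σ
  | tensorR _ _ ih ih' =>
    rw [semCtx_add]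
    exact (Set.add_subset_add (ih σ) (ih' σ)).trans subset_cl
  | oneL _ ih =>
    rw [semCtx_cons]
    refine sem_cl_add_subset ?_
    simpa using ih σ
  | oneR =>
    simp only [semCtx, Multiset.map_zero, Multiset.sum_zero, sem]
    exact subset_cl
  | @lolliL Γ Δ A B C _ _ ih ih' =>
    rw [semCtx_cons, semCtx_add]
    rintro _ ⟨f, hf, _, ⟨g, hg, d, hd, rfl⟩, rfl⟩
    have := ih' σ (by rw [semCtx_cons]; exact Set.add_mem_add (hf g (ih σ hg)) hd)
    simpa [add_assoc] using this
  | lolliR _ ih =>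
    intro g hg a ha
    rw [add_comm]
    exact ih σ (by rw [semCtx_cons]; exact Set.add_mem_add ha hg)
  | bangR _ ih =>
    exact (semCtx_map_bang _ σ).trans (cl_mono (Set.inter_subset_inter_left _ (ih σ)))
  | dereliction _ ih =>
    rw [semCtx_cons]
    refine sem_cl_add_subset ((Set.add_subset_add Set.inter_subset_left subset_rfl).trans ?_)
    simpa using ih σ
  | contraction _ ih =>
    rw [semCtx_cons]
    refine sem_cl_add_subset ?_
    rintro _ ⟨a, ha, g, hg, rfl⟩
    rw [← cl_sem]
    intro k hk
    change a + g + k ∈ pole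
    rw [add_assoc]
    refine ha.2.2 _ ?_
    have := hk _ (ih σ (a := a + (a + g)) (by
      rw [semCtx_cons, semCtx_cons]
      exact Set.add_mem_add (subset_cl ha) (Set.add_mem_add (subset_cl ha) hg)))
    simpa [add_assoc] using this
  | weakening _ ih =>
    rw [semCtx_cons]
    refine sem_cl_add_subset ?_
    rintro _ ⟨a, ha, g, hg, rfl⟩
    rw [← cl_sem]
    intro k hk
    change a + g + k ∈ pole
    rw [add_assoc]
    exact ha.2.1 _ (hk _ (ih σ hg))
  | withL₁ _ ih =>
    rw [semCtx_cons]
    refine (Set.add_subset_add Set.inter_subset_left subset_rfl).trans ?_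
    simpa using ih σ
  | withL₂ _ ih =>
    rw [semCtx_cons]
    refine (Set.add_subset_add Set.inter_subset_right subset_rfl).trans ?_
    simpa using ih σ
  | withR _ _ ih ih' => exact fun m hm => ⟨ih σ hm, ih' σ hm⟩
  | topR => exact fun _ _ => trivial
  | plusL _ _ ih ih' =>
    rw [semCtx_cons]
    refine sem_cl_add_subset ?_
    rw [Set.union_add]
    exact Set.union_subset (by simpa using ih σ) (by simpa using ih' σ)
  | plusR₁ _ ih => exact (ih σ).trans (Set.subset_union_left.trans subset_cl)
  | plusR₂ _ ih => exact (ih σ).trans (Set.subset_union_right.trans subset_cl)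
  | @zeroL A =>
    simp only [semCtx, Multiset.map_singleton, Multiset.sum_singleton, sem]
    rw [← cl_sem A]
    exact cl_mono (Set.empty_subset _)
  | allL t _ ih =>
    rw [semCtx_cons]
    refine (Set.add_subset_add (fun m hm => ?_) subset_rfl).trans
      (by simpa only [semCtx_cons] using ih σ)
    rw [sem_inst]
    exact hm _
  | allR _ ih =>
    intro m hm t
    exact ih _ (by rwa [semCtx_map_shift])
  | exL _ ih =>
    rw [semCtx_cons]
    refine sem_cl_add_subset ?_
    rintro _ ⟨a, ⟨t, ha⟩, g, hg, rfl⟩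
    rw [← sem_shift (t := t)]
    refine ih (consSubst t σ) ?_
    rw [semCtx_cons, semCtx_map_shift]
    exact Set.add_mem_add ha hg
  | exR t _ ih =>
    intro m hm
    refine subset_cl ⟨t.subst σ, ?_⟩
    rw [← sem_inst]
    exact ih σ hm

theorem sem_exVar (x : ℕ) (A : LForm L U) (σ : ℕ → L.Term ℕ) :
    sem pole (A.exVar x) σ = cl pole {m | ∃ t, m ∈ sem pole A (Function.update σ x t)} := by
  simp only [LForm.exVar, sem, sem_subst, bindSubst_consSubst]

theorem sem_allVar (x : ℕ) (A : LForm L U) (σ : ℕ → L.Term ℕ) :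
    sem pole (A.allVar x) σ = {m | ∀ t, m ∈ sem pole A (Function.update σ x t)} := by
  simp only [LForm.allVar, sem, sem_subst, bindSubst_consSubst]

theorem sem_foldr_exVar (l : List ℕ) (A : LForm L U) (σ : ℕ → L.Term ℕ) :
    sem pole (l.foldr LForm.exVar A) σ =
      cl pole {m | ∃ τ, (∀ x ∉ l, τ x = σ x) ∧ m ∈ sem pole A τ} := by
  induction l generalizing σ with
  | nil =>
    have : {m | ∃ τ, (∀ x ∉ ([] : List ℕ), τ x = σ x) ∧ m ∈ sem pole A τ} = sem pole A σ := by
      ext m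
      constructor
      · rintro ⟨τ, hτ, hm⟩
        rwa [← funext fun x => hτ x (by simp)]
      · exact fun hm => ⟨σ, fun _ _ => rfl, hm⟩
    rw [this, cl_sem]; rfl
  | cons x l ih =>
    rw [List.foldr, sem_exVar]
    refine (cl_subset_cl ?_).antisymm (cl_mono ?_)
    · rintro m ⟨t, hm⟩
      rw [ih] at hm
      refine cl_mono ?_ hm
      rintro m ⟨τ, hτ, hm⟩
      refine ⟨τ, fun y hy => ?_, hm⟩
      rw [List.mem_cons, not_or] at hy
      rw [hτ y hy.2, Function.update_of_ne hy.1]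
    · rintro m ⟨τ, hτ, hm⟩
      refine ⟨τ x, ?_⟩
      rw [ih]
      refine subset_cl ⟨τ, fun y hy => ?_, hm⟩
      by_cases hyx : y = x
      · simp [hyx]
      · rw [Function.update_of_ne hyx]
        exact hτ y (by simp [hyx, hy])

theorem sem_exVars (s : Finset ℕ) (A : LForm L U) (σ : ℕ → L.Term ℕ) :
    sem pole (A.exVars s) σ = cl pole {m | ∃ τ, (∀ x ∉ s, τ x = σ x) ∧ m ∈ sem pole A τ} := by
  rw [LForm.exVars, sem_foldr_exVar]
  simp only [Finset.mem_sort]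

theorem mem_sem_foldr_allVar {l : List ℕ} {A : LForm L U} {σ : ℕ → L.Term ℕ} {m : FlatGoal L U} :
    m ∈ sem pole (l.foldr LForm.allVar A) σ ↔
      ∀ τ, (∀ x ∉ l, τ x = σ x) → m ∈ sem pole A τ := by
  induction l generalizing σ with
  | nil =>
    refine ⟨fun h τ hτ => ?_, fun h => h σ fun _ _ => rfl⟩
    rwa [funext fun x => hτ x (by simp)]
  | cons x l ih =>
    rw [List.foldr, sem_allVar]
    constructor
    · intro h τ hτ
      refine ih.1 (h (τ x)) τ fun y hy => ?_
      by_cases hyx : y = x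
      · simp [hyx]
      · rw [Function.update_of_ne hyx]
        exact hτ y (by simp [hyx, hy])
    · intro h t
      refine ih.2 fun τ hτ => h τ fun y hy => ?_
      rw [List.mem_cons, not_or] at hy
      rw [hτ y hy.2, Function.update_of_ne hy.1]

theorem mem_sem_allVars {s : Finset ℕ} {A : LForm L U} {σ : ℕ → L.Term ℕ} {m : FlatGoal L U} :
    m ∈ sem pole (A.allVars s) σ ↔ ∀ τ, (∀ x ∉ s, τ x = σ x) → m ∈ sem pole A τ := by
  rw [LForm.allVars, mem_sem_foldr_allVar]
  simp only [Finset.mem_sort]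

/-- Validity is membership of `0`, which is always duplicable; so an outer `!` has no influence on
validity. -/
theorem zero_mem_sem_bang {A : LForm L U} {σ : ℕ → L.Term ℕ} :
    0 ∈ sem pole (.bang A) σ ↔ 0 ∈ sem pole A σ := by
  constructor
  · intro h
    rw [← cl_sem]
    exact cl_mono Set.inter_subset_left h
  · exact fun h => subset_cl ⟨h, zero_mem_duplicable⟩

theorem zero_mem_sem_lolli {A B : LForm L U} {σ : ℕ → L.Term ℕ} :
    0 ∈ sem pole (.lolli A B) σ ↔ sem pole A σ ⊆ sem pole B σ := by
  simp only [sem, Set.mem_ofPred_eq, zero_add]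
  rfl

theorem sem_bang_subset (A : LForm L U) (σ : ℕ → L.Term ℕ) :
    sem pole (.bang A) σ ⊆ cl pole {0} :=
  cl_subset_cl fun m hm k hk => hm.2.1 k (by simpa using hk 0 rfl)

/-- By weakening each factor lies in the closure of `{0}`. Hence all but one factor can be dropped
from a tensor that contains `0`. -/
theorem zero_mem_sem_bigTensor {l : List (LForm L U)} (hl : ∀ F ∈ l, ∃ A, F = .bang A)
    {σ : ℕ → L.Term ℕ} :
    0 ∈ sem pole (LForm.bigTensor l) σ ↔ ∀ F ∈ l, 0 ∈ sem pole F σ := by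
  have sub : ∀ l : List (LForm L U), (∀ F ∈ l, ∃ A, F = .bang A) →
      sem pole (LForm.bigTensor l) σ ⊆ cl pole {0} := by
    intro l
    induction l with
    | nil => exact fun _ => subset_rfl
    | cons F l ih =>
      intro hl
      obtain ⟨A, rfl⟩ := hl F (by simp)
      refine cl_subset_cl ((Set.add_subset_add (sem_bang_subset A σ)
        (ih fun F hF => hl F (by simp [hF]))).trans (cl_add_cl.trans ?_))
      simp
  have drop : ∀ {A B : LForm L U}, sem pole B σ ⊆ cl pole {0} →
      0 ∈ cl pole (sem pole A σ + sem pole B σ) → 0 ∈ sem pole A σ := by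
    intro A B hB h
    rw [← cl_sem]
    refine cl_subset_cl ?_ h
    rintro _ ⟨a, ha, b, hb, rfl⟩ k hk
    have := hB hb (a + k) (by simpa using hk a ha)
    change a + b + k ∈ pole
    convert this using 1; abel
  induction l with
  | nil =>
    simp only [List.not_mem_nil, false_imp_iff, implies_true, iff_true]
    exact subset_cl rfl
  | cons F l ih =>
    have ih := ih fun F hF => hl F (by simp [hF])
    rw [List.forall_mem_cons]
    refine Iff.trans ?_ (and_congr_right fun _ => ih)
    constructor
    · intro h
      obtain ⟨A, rfl⟩ := hl F (by simp)
      refine ⟨drop (sub l fun F hF => hl F (by simp [hF])) h, drop (sem_bang_subset A σ) ?_⟩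
      rw [add_comm]
      exact h
    · rintro ⟨h, h'⟩
      exact subset_cl ⟨0, h, 0, h', add_zero 0⟩

end Phase

/-! ## Interpretation of goals, constraint theories and rules -/

section Interpretation

variable {L : FirstOrder.Language.{u, v}} {U : ℕ → Type w}

/-- Built-in atoms may be weakened and contracted, and falsity is contradictory. -/
structure Adequate (pole : Set (FlatGoal L U)) : Prop where
  builtin : ∀ b : BC L, ((0, {b}) : FlatGoal L U) ∈ duplicable pole
  bot : ∀ k : FlatGoal L U, (0, {.bot}) + k ∈ pole

variable {pole : Set (FlatGoal L U)}

theorem Adequate.sem_bang_singleton (h : Adequate pole) {A : LForm L U} {σ : ℕ → L.Term ℕ}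
    {b : BC L} (hA : sem pole A σ = cl pole {(0, {b})}) :
    sem pole (.bang A) σ = cl pole {(0, {b})} := by
  simp only [sem, hA]
  refine (cl_subset_cl Set.inter_subset_left).antisymm (cl_mono ?_)
  rintro _ rfl
  exact ⟨subset_cl rfl, h.builtin b⟩

/-- Tensor and plus match the operations on disjunctive normal forms. Adequacy removes the `!` in
front of built-in atoms and identifies the atom `⊥` with the constant `0` of linear logic. -/
theorem Adequate.sem_goal (h : Adequate pole) (G : Goal L U) (σ : ℕ → L.Term ℕ) :
    sem pole G.toLL σ = cl pole {m | ∃ d ∈ G.dnf, m = d.subst σ} := by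
  induction G with
  | top =>
    simp only [Goal.dnf, Multiset.mem_singleton, exists_eq_left]
    rfl
  | user c ts =>
    simp only [Goal.dnf, Multiset.mem_singleton, exists_eq_left]
    rfl
  | bot =>
    simp only [Goal.dnf, Multiset.mem_singleton, exists_eq_left, Goal.toLL, sem]
    refine (cl_mono (Set.empty_subset _)).antisymm (cl_subset_cl ?_)
    rintro _ rfl k -
    exact h.bot k
  | eq s t =>
    simp only [Goal.dnf, Multiset.mem_singleton, exists_eq_left]
    exact h.sem_bang_singleton rfl
  | rel c ts =>
    simp only [Goal.dnf, Multiset.mem_singleton, exists_eq_left]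
    exact h.sem_bang_singleton rfl
  | and G G' ih ih' =>
    simp only [Goal.toLL, sem, ih, ih']
    refine (cl_subset_cl (cl_add_cl.trans (cl_mono ?_))).antisymm (cl_mono ?_)
    · rintro _ ⟨_, ⟨d, hd, rfl⟩, _, ⟨d', hd', rfl⟩, rfl⟩
      exact ⟨_, mem_msum.2 ⟨d, hd, d', hd', rfl⟩, by simp [FlatGoal.subst]⟩
    · rintro _ ⟨e, he, rfl⟩
      obtain ⟨d, hd, d', hd', rfl⟩ := mem_msum.1 he
      exact ⟨d.subst σ, subset_cl ⟨d, hd, rfl⟩, d'.subst σ, subset_cl ⟨d', hd', rfl⟩,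
        by simp [FlatGoal.subst]⟩
  | or G G' ih ih' =>
    simp only [Goal.toLL, sem, ih, ih']
    refine (cl_subset_cl (Set.union_subset (cl_mono ?_) (cl_mono ?_))).antisymm (cl_mono ?_)
    · rintro _ ⟨d, hd, rfl⟩
      exact ⟨d, Multiset.mem_add.2 (.inl hd), rfl⟩
    · rintro _ ⟨d, hd, rfl⟩
      exact ⟨d, Multiset.mem_add.2 (.inr hd), rfl⟩
    · rintro _ ⟨d, hd, rfl⟩
      rcases Multiset.mem_add.1 hd with hd | hd
      · exact .inl (subset_cl ⟨d, hd, rfl⟩)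
      · exact .inr (subset_cl ⟨d, hd, rfl⟩)

theorem BC.star_form (b : BC L) : b.form.star U = (b.goal U).toLL := by
  induction b with
  | top | bot | eq | rel => rfl
  | and b b' ih ih' => simp only [BC.form, IForm.star, BC.goal, Goal.toLL, ih, ih']

theorem IForm.star_subst (A : IForm L) (σ : ℕ → L.Term ℕ) :
    (A.subst σ).star U = (A.star U).subst σ := by
  induction A generalizing σ with
  | bot | top | eq | rel => rfl
  | and A B ih ih' | or A B ih ih' | imp A B ih ih' =>
    simp only [IForm.subst, IForm.star, LForm.subst, ih, ih']
  | all A ih | ex A ih => simp only [IForm.subst, IForm.star, LForm.subst, ih]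

theorem IForm.star_exVars (s : Finset ℕ) (A : IForm L) :
    (IForm.exVars s A).star U = LForm.exVars s (A.star U) := by
  rw [IForm.exVars, LForm.exVars]
  induction (s.sort (· ≤ ·)) with
  | nil => rfl
  | cons x l ih =>
    simp only [List.foldr, IForm.exVar, IForm.star, IForm.star_subst, ih]
    rfl

theorem zero_mem_sem_star_allVars {A : IForm L} (s : Finset ℕ)
    (h : ∀ σ, 0 ∈ sem pole (A.star U) σ) (σ : ℕ → L.Term ℕ) :
    0 ∈ sem pole ((IForm.allVars s A).star U) σ := by
  rw [IForm.allVars]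
  induction (s.sort (· ≤ ·)) generalizing σ with
  | nil => exact h σ
  | cons x l ih =>
    simp only [List.foldr, IForm.allVar, IForm.star, IForm.star_subst]
    refine zero_mem_sem_bang.2 fun t => ?_
    rw [sem_subst]
    exact ih _

theorem Adequate.sem_builtin (h : Adequate pole) (b : BC L) (σ : ℕ → L.Term ℕ) :
    sem pole (b.goal U).toLL σ = cl pole {(0, bsubst b.atoms σ)} := by
  rw [h.sem_goal, b.dnf_goal]
  simp only [Multiset.mem_singleton, exists_eq_left]
  rfl

theorem Adequate.sem_user (h : Adequate pole) (a : UC L U) (σ : ℕ → L.Term ℕ) :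
    sem pole a.goal.toLL σ = cl pole {(usubst a.atoms σ, 0)} := by
  rw [h.sem_goal, a.dnf_goal]
  simp only [Multiset.mem_singleton, exists_eq_left]
  rfl

/-- The hypothesis is the axiom as a closure property of the pole, read backward: a context that
leads all instances of the conclusion into the pole also leads the instance of the premise into it.
-/
theorem Adequate.sem_axiom (h : Adequate pole) {α : CTAxiom L}
    (hα : ∀ (σ τ : ℕ → L.Term ℕ) (k : FlatGoal L U), (∀ x ∉ α.xs, τ x = σ x) →
      (∀ τ' : ℕ → L.Term ℕ, (∀ x ∉ α.xs', τ' x = σ x) → (0, bsubst α.B'.atoms τ') + k ∈ pole) →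
      (0, bsubst α.B.atoms τ) + k ∈ pole) (σ : ℕ → L.Term ℕ) :
    0 ∈ sem pole (α.form.star U) σ := by
  refine zero_mem_sem_star_allVars _ (fun σ => ?_) σ
  refine zero_mem_sem_bang.2 (zero_mem_sem_lolli.2 ?_)
  rw [IForm.star_exVars, IForm.star_exVars, sem_exVars, sem_exVars]
  simp only [BC.star_form, h.sem_builtin]
  refine cl_subset_cl ?_
  rintro m ⟨τ, hτ, hm⟩
  refine cl_subset_cl ?_ hm
  rintro _ rfl k hk
  exact hα σ τ k hτ fun τ' hτ' => hk _ ⟨τ', hτ', subset_cl rfl⟩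

theorem Adequate.sem_userEqAxiom (h : Adequate pole) {n : ℕ} (c : U n) (j : Fin n)
    (hc : ∀ (ts : Fin n → L.Term ℕ) (t : L.Term ℕ) (k : FlatGoal L U),
      ({.atom c (Function.update ts j t)}, {.eq (ts j) t}) + k ∈ pole →
      ({.atom c ts}, {.eq (ts j) t}) + k ∈ pole) (σ : ℕ → L.Term ℕ) :
    0 ∈ sem pole (ConstraintTheory.userEqAxiom c j) σ := by
  refine zero_mem_sem_bang.2 (mem_sem_allVars.2 fun τ _ => zero_mem_sem_lolli.2 ?_)
  have key : ∀ (ts : Fin n → L.Term ℕ) (s t : L.Term ℕ),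
      sem pole (.tensor (.user c ts) (.bang (.eq s t))) τ =
        cl pole {({.atom c fun i => (ts i).subst τ}, {.eq (s.subst τ) (t.subst τ)})} := by
    intro ts s t
    have := h.sem_goal (.and (.user c ts) (.eq s t)) τ
    simpa [Goal.dnf, singleton_msum, FlatGoal.subst, usubst, bsubst, UC.subst, BC.subst,
      Goal.toLL] using this
  rw [key, key]
  refine cl_subset_cl ?_
  rintro _ rfl k hk
  have h1 := hk _ rfl
  have h2 : (fun i => (Function.update (fun i : Fin n => (.var (i : ℕ) : L.Term ℕ)) j (.var n) i).subst τ)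
      = Function.update (fun i : Fin n => τ i) j (τ n) := by
    funext i
    by_cases hi : i = j
    · subst hi; simp
    · simp [hi]
  rw [h2] at h1
  exact hc _ _ k h1

/-- A rule is valid if the instances of its left-hand side are in the closure of the instances of
its right-hand side. -/
def RuleValid (pole : Set (FlatGoal L U)) (R : Rule L U) : Prop :=
  ∀ (σ : ℕ → L.Term ℕ) (k : FlatGoal L U),
    (∀ τ : ℕ → L.Term ℕ, (∀ x ∉ R.localVars, τ x = σ x) → ∀ d ∈ R.B.dnf,
      (usubst R.H₁.atoms σ + usubst d.1 τ, bsubst R.G.atoms τ + bsubst d.2 τ) + k ∈ pole) →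
    (usubst R.H₁.atoms σ + usubst R.H₂.atoms σ, bsubst R.G.atoms σ) + k ∈ pole

/-- Both directions are used: validity of the rules of one program makes its reading true, and truth
of the other program's reading is turned back into validity of its rules. -/
theorem Adequate.sem_rule (h : Adequate pole) (R : Rule L U) :
    (∀ σ, 0 ∈ sem pole R.toLL σ) ↔ RuleValid pole R := by
  have lhs : ∀ σ, sem pole (.tensor (.tensor R.H₁.goal.toLL R.H₂.goal.toLL) (R.G.goal U).toLL) σ =
      cl pole {(usubst R.H₁.atoms σ + usubst R.H₂.atoms σ, bsubst R.G.atoms σ)} := by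
    intro σ
    have := h.sem_goal (.and (.and R.H₁.goal R.H₂.goal) (R.G.goal U)) σ
    simpa [Goal.dnf, singleton_msum, FlatGoal.subst, UC.dnf_goal, BC.dnf_goal, Goal.toLL] using this
  -- On this side the guard stands under the existential quantifier, so its local variables are
  -- evaluated by `τ` and not by `σ`.
  have rhs : ∀ σ, sem pole (.tensor R.H₁.goal.toLL (.exVars R.localVars
      (.tensor R.B.toLL (R.G.goal U).toLL))) σ = cl pole {m | ∃ τ : ℕ → L.Term ℕ,
        (∀ x ∉ R.localVars, τ x = σ x) ∧ ∃ d ∈ R.B.dnf,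
          m = (usubst R.H₁.atoms σ + usubst d.1 τ, bsubst R.G.atoms τ + bsubst d.2 τ)} := by
    intro σ
    have body : ∀ τ, sem pole (.tensor R.B.toLL (R.G.goal U).toLL) τ =
        cl pole {m | ∃ d ∈ R.B.dnf, m = (usubst d.1 τ, bsubst R.G.atoms τ + bsubst d.2 τ)} := by
      intro τ
      have := h.sem_goal (.and (R.G.goal U) R.B) τ
      simp only [Goal.dnf, BC.dnf_goal, singleton_msum, Multiset.mem_map, Goal.toLL] at this
      simp only [sem] at this ⊢
      rw [add_comm, this]
      congr 1
      ext m
      constructor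
      · rintro ⟨_, ⟨d, hd, rfl⟩, rfl⟩
        exact ⟨d, hd, by simp [FlatGoal.subst]⟩
      · rintro ⟨d, hd, rfl⟩
        exact ⟨_, ⟨d, hd, rfl⟩, by simp [FlatGoal.subst]⟩
    rw [sem, h.sem_user, sem_exVars]
    simp only [body]
    refine (cl_subset_cl (cl_add_cl.trans (cl_subset_cl ?_))).antisymm (cl_mono ?_)
    · rintro _ ⟨_, rfl, m, ⟨τ, hτ, hm⟩, rfl⟩ k hk
      change (usubst R.H₁.atoms σ, 0) + m + k ∈ pole
      rw [add_comm _ m, add_assoc]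
      refine hm _ ?_
      rintro _ ⟨d, hd, rfl⟩
      have := hk _ ⟨τ, hτ, d, hd, rfl⟩
      rw [← add_assoc]
      convert this using 2
      ext1 <;> simp [add_comm]
    · rintro _ ⟨τ, hτ, d, hd, rfl⟩
      refine ⟨_, subset_cl rfl, _, subset_cl ⟨τ, hτ, subset_cl ⟨d, hd, rfl⟩⟩, ?_⟩
      simp
  constructor
  · intro h0 σ k hk
    have h1 := zero_mem_sem_bang.1 (h0 σ)
    have h2 := zero_mem_sem_lolli.1 (mem_sem_allVars.1 h1 σ fun _ _ => rfl)
    rw [lhs, rhs] at h2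
    refine h2 (subset_cl rfl) k ?_
    rintro _ ⟨τ, hτ, d, hd, rfl⟩
    exact hk τ hτ d hd
  · intro hR σ
    refine zero_mem_sem_bang.2 (mem_sem_allVars.2 fun τ _ => zero_mem_sem_lolli.2 ?_)
    rw [lhs, rhs]
    refine cl_subset_cl ?_
    rintro _ rfl k hk
    exact hR τ k fun τ' hτ' d hd => hk _ ⟨τ', hτ', d, hd, rfl⟩

/-- Validity of rules transfers along derivability. -/
theorem Adequate.ruleValid_of_derives {CT : ConstraintTheory L} {P₁ P₂ : Program L U}
    (h : Adequate pole)
    (hd : LForm.DerivesFrom (CT.toLL U) (.lolli P₂.tensorLL P₁.tensorLL))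
    (hCT : ∀ F ∈ CT.toLL U, ∀ σ, 0 ∈ sem pole F σ) (hP : ∀ R ∈ P₂, RuleValid pole R) :
    ∀ R ∈ P₁, RuleValid pole R := by
  obtain ⟨Γ, hΓ, hd⟩ := hd
  have bangs : ∀ P : Program L U, ∀ F ∈ P.toList.map Rule.toLL, ∃ A, F = .bang A := by
    intro P F hF
    obtain ⟨R, -, rfl⟩ := List.mem_map.1 hF
    exact ⟨_, rfl⟩
  intro R hR
  refine (h.sem_rule R).1 fun σ => ?_
  have h0 : 0 ∈ semCtx pole Γ σ := by
    clear hd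
    induction Γ using Multiset.induction_on with
    | empty => simp [semCtx]
    | cons F Γ ih =>
      rw [semCtx_cons]
      exact ⟨0, hCT F (hΓ F (by simp)) σ, 0, ih fun F hF => hΓ F (by simp [hF]), add_zero 0⟩
  have h1 := zero_mem_sem_lolli.1 (hd.sound σ h0)
  have h2 : 0 ∈ sem pole P₂.tensorLL σ := by
    refine (zero_mem_sem_bigTensor (bangs P₂)).2 fun F hF => ?_
    obtain ⟨R, hR, rfl⟩ := List.mem_map.1 hF
    exact (h.sem_rule R).2 (hP R (by simpa using hR)) σ
  exact (zero_mem_sem_bigTensor (bangs P₁)).1 (h1 h2) _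
    (List.mem_map.2 ⟨R, by simpa using hR, rfl⟩)

end Interpretation

/-! ## The phase model of a program -/

section Variants

variable {L : FirstOrder.Language.{u, v}} {U : ℕ → Type w}

theorem Goal.mem_vars_subst {G : Goal L U} {σ : ℕ → L.Term ℕ} {x : ℕ} :
    x ∈ (G.subst σ).vars ↔ ∃ y ∈ G.vars, x ∈ (σ y).varFinset := by
  induction G with
  | top | bot => simp [Goal.subst, Goal.vars]
  | eq s t =>
    simp only [Goal.subst, Goal.vars, Finset.mem_union, mem_varFinset_subst]
    grind
  | rel c ts | user c ts =>
    simp only [Goal.subst, Goal.vars, mem_tupleVars, mem_varFinset_subst]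
    grind
  | and b b' ih ih' | or b b' ih ih' =>
    simp only [Goal.subst, Goal.vars, Finset.mem_union, ih, ih']
    grind

theorem Rule.exists_of_mem_localVars_rename {R : Rule L U} {ρ : ℕ → ℕ} {y : ℕ}
    (h : y ∈ (R.rename ρ).localVars) : ∃ x ∈ R.localVars, ρ x = y := by
  simp only [Rule.localVars, Rule.rename, Finset.mem_sdiff, Finset.mem_union,
    Goal.mem_vars_subst, BC.mem_vars_subst, UC.mem_vars_subst, mem_varFinset_var] at h ⊢
  grind

theorem Rule.mem_localVars_rename {R : Rule L U} {ρ : ℕ → ℕ}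
    (hρ : Set.InjOn ρ (R.vars : Set ℕ)) {x : ℕ} (h : x ∈ R.localVars) :
    ρ x ∈ (R.rename ρ).localVars := by
  have inj : ∀ a ∈ R.vars, ∀ b ∈ R.vars, ρ a = ρ b → a = b := fun a ha b hb => hρ ha hb
  simp only [Rule.localVars, Rule.rename, Rule.vars, Finset.mem_sdiff, Finset.mem_union,
    Goal.mem_vars_subst, BC.mem_vars_subst, UC.mem_vars_subst, mem_varFinset_var] at h inj ⊢
  grind

theorem Rule.localVars_subset (R : Rule L U) : R.localVars ⊆ R.vars := by
  intro x hx
  simp only [Rule.localVars, Rule.vars, Finset.mem_sdiff, Finset.mem_union] at hx ⊢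
  tauto

theorem mem_stateNF_rule {CT : ConstraintTheory L} {H A : UC L U} {G B : BC L} {K : Goal L U}
    {V : Finset ℕ} {s : StateClass CT U} :
    s ∈ stateNF CT ⟨.and (.and (.and H.goal (G.goal U)) K) (.and A.goal (B.goal U)), V⟩ ↔
      ∃ d ∈ K.dnf, ¬ CT.Unsat (G.atoms + d.2 + B.atoms) ∧
        cls CT (H.atoms + d.1 + A.atoms) (G.atoms + d.2 + B.atoms) V = s := by
  rw [mem_stateNF]
  have h1 : (Goal.and (.and (.and H.goal (G.goal U)) K) (.and A.goal (B.goal U))).dnf =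
      K.dnf.map fun d => (H.atoms + d.1 + A.atoms, G.atoms + d.2 + B.atoms) := by
    rw [Goal.dnf, Goal.dnf, dnf_normal_goal, dnf_normal_goal, singleton_msum, msum_comm,
      singleton_msum, Multiset.map_map]
    refine Multiset.map_congr rfl fun d _ => ?_
    ext1 <;> simp [add_comm]
  simp only [h1, Multiset.mem_map]
  constructor
  · rintro ⟨_, ⟨d, hd, rfl⟩, hm⟩; exact ⟨d, hd, hm⟩
  · rintro ⟨d, hd, hm⟩; exact ⟨_, ⟨d, hd, rfl⟩, hm⟩

end Variants

/-! ### The pole given by a property of states; validity of the constraint theory and of rules. -/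

section Pole

variable {L : FirstOrder.Language.{u, v}} {U : ℕ → Type w} {CT : ConstraintTheory L}

/-- The flat goals all of whose satisfiable extensions by built-in constraints are in `Q`. -/
def statePole (Q : StateClass CT U → Prop) (V : Finset ℕ) : Set (FlatGoal L U) :=
  {m | ∀ B, ¬ CT.Unsat (m.2 + B) → Q (cls CT m.1 (m.2 + B) V)}

variable {Q : StateClass CT U → Prop} {V : Finset ℕ}

/-- The pole is used modulo equality of classes; satisfiability of the store transfers along such an
equality and need only be known for one representative. -/
theorem of_mem_statePole {m : FlatGoal L U} (h : m ∈ statePole Q V) {A : Multiset (UC L U)}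
    {B B' : Multiset (BC L)} (he : cls CT A B' V = cls CT m.1 (m.2 + B) V)
    (hB' : ¬ CT.Unsat B') : Q (cls CT A B' V) := by
  rw [he]
  refine h B (live_cls_iff (U := U) (A := m.1) (V := V) |>.1 ?_)
  rw [← he]
  exact live_cls_iff.2 hB'

/-- Weakening holds because members of the pole are tested on all extensions, contraction because
repeating a constraint does not change the class. A store containing `⊥` has no satisfiable
extension to be tested. -/
theorem adequate_statePole : Adequate (statePole Q V) where
  builtin b := by
    constructor
    · intro k hk B hB
      refine of_mem_statePole hk (B := {b} + B) ?_ hB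
      simp only [Prod.fst_add, Prod.snd_add, zero_add]
      rw [add_left_comm, add_assoc]
    · intro k hk B hB
      refine of_mem_statePole hk (B := B) ?_ hB
      simp only [Prod.fst_add, Prod.snd_add, zero_add]
      rw [add_assoc {b} ({b} + k.2), add_comm {b} ({b} + k.2 + B)]
      exact cls_add_of_ent fun c hc => .of_mem (by simp at hc; simp [hc])
  bot k B hB := (hB (ConstraintTheory.Ent.of_mem (b := .bot) (by simp))).elim

open ConstraintTheory in
-- A store containing the premise of an axiom implies its conclusion. With fresh names for the
-- witnesses, the conclusion is added without changing the class, and the hypothesis on that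
-- instance applies.
theorem statePole_axiom {α : CTAxiom L} (hα : α ∈ CT.axioms) (σ : ℕ → L.Term ℕ) :
    0 ∈ sem (statePole Q V) (α.form.star U) σ := by
  refine adequate_statePole.sem_axiom (fun σ τ k hτ hk B hB => ?_) σ
  set S := bsubst α.B.atoms τ + k.2 + B with hS
  have h1 : CT.Ent S ((IForm.exVars α.xs α.B.form).subst σ) := by
    refine IForm.Derives.exVars_intro hτ ?_
    rw [← BC.form_subst]
    refine ent_atoms.2 fun b hb => .of_mem ?_
    rw [BC.atoms_subst] at hb
    simp [hS, hb]
  obtain ⟨f, hf, hfF⟩ := exists_fresh_injection (V ∪ uvars k.1 ∪ bvars S ∪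
    α.B'.vars.biUnion fun z => (σ z).varFinset)
  simp only [Finset.mem_union, not_or, Finset.mem_biUnion, not_exists, not_and] at hfF
  set τ' : ℕ → L.Term ℕ := fun x => if x ∈ α.xs' then .var (f x) else σ x with hτ'
  have h2 := (h1.apply_theory hα).exVars_subst (τ := τ') hf (fun x hx => by simp [hτ', hx])
    (fun x hx => by simp [hτ', hx]) fun z hz _ x => (hfF x).2 z hz
  have h3 : cls CT k.1 S V = cls CT k.1 (S + (α.B'.subst τ').atoms) V := by
    refine cls_add_of_exVars (fun y hy => ?_) h2
    obtain ⟨x, -, rfl⟩ := Finset.mem_image.1 hy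
    exact ⟨(hfF x).1.1.1, (hfF x).1.1.2, (hfF x).1.2⟩
  refine of_mem_statePole (hk τ' fun x hx => by simp [hτ', hx]) (B := bsubst α.B.atoms τ + B) ?_ hB
  simp only [Prod.fst_add, Prod.snd_add, zero_add]
  rw [← hS, h3, BC.atoms_subst, hS]
  congr 1
  abel

theorem statePole_userEqAxiom (hEq : CT.HasEquality) {n : ℕ} (c : U n) (j : Fin n)
    (σ : ℕ → L.Term ℕ) :
    0 ∈ sem (statePole Q V) (ConstraintTheory.userEqAxiom c j) σ := by
  refine adequate_statePole.sem_userEqAxiom c j (fun ts t k hk B hB => ?_) σ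
  refine of_mem_statePole hk (B := B) ?_ hB
  simp only [Prod.fst_add, Prod.snd_add]
  -- An atom is presented as an instance of the atom with arguments `0, …, n - 1`, the form in which
  -- `cls_congr_user` exchanges equal terms.
  set val : (Fin n → L.Term ℕ) → ℕ → L.Term ℕ := fun ts x =>
    if h : x < n then ts ⟨x, h⟩ else .var x with hval
  have hA : ∀ ts : Fin n → L.Term ℕ,
      ({.atom c ts} : Multiset (UC L U)) = usubst {.atom c fun i => .var i} (val ts) := by
    intro ts
    simp only [usubst, Multiset.map_singleton, UC.subst, subst_var_apply, hval, Fin.is_lt,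
      dif_pos]
  rw [hA ts, hA (Function.update ts j t)]
  refine cls_congr_user hEq fun x hx => ?_
  have hxn : x < n := by
    simp only [mem_uvars, Multiset.mem_singleton, exists_eq_left, UC.vars, mem_tupleVars,
      mem_varFinset_var] at hx
    obtain ⟨i, rfl⟩ := hx
    exact i.2
  simp only [hval, hxn, dif_pos]
  by_cases hj : (⟨x, hxn⟩ : Fin n) = j
  · rw [hj, Function.update_self]
    exact .of_mem (by simp)
  · rw [Function.update_of_ne hj]
    exact hEq.refl _ _

theorem statePole_toLL (hEq : CT.HasEquality) :
    ∀ F ∈ CT.toLL U, ∀ σ, 0 ∈ sem (statePole Q V) F σ := by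
  rintro F (⟨α, hα, rfl⟩ | ⟨n, c, j, rfl⟩) σ
  · exact statePole_axiom hα σ
  · exact statePole_userEqAxiom hEq c j σ

theorem rule_vars_cases {R : Rule L U} {x : ℕ} (hx : x ∈ R.vars) :
    x ∈ R.H₁.vars ∪ R.H₂.vars ∨ x ∈ R.localVars := by
  simp only [Rule.vars, Rule.localVars, Finset.mem_union, Finset.mem_sdiff] at hx ⊢
  tauto

open ConstraintTheory in
/-- The rules of a program are valid if `Q` is closed under backward transitions. -/
theorem statePole_rule (hEq : CT.HasEquality) {P : Program L U}
    (hQ : ∀ s m', FlatStep CT P {s} m' → (∀ d ∈ m', Q d) → Q s) {R : Rule L U} (hR : R ∈ P) :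
    RuleValid (statePole Q V) R := by
  classical
  intro σ k hk B₀ hsat
  set S := bsubst R.G.atoms σ + k.2 + B₀ with hS
  -- The names `f x` define the variant of the rule that will be applied.
  obtain ⟨f, hf, hfF⟩ := exists_fresh_injection (V ∪ uvars k.1 ∪ bvars S ∪
    uvars (usubst R.H₁.atoms σ + usubst R.H₂.atoms σ) ∪
    R.vars.biUnion fun z => (σ z).varFinset)
  simp only [Finset.mem_union, not_or, Finset.mem_biUnion, not_exists, not_and] at hfF
  set ρ : ℕ → L.Term ℕ := fun x => .var (f x) with hρ
  -- Only head variables receive an equation: the local variables of the variant must not occur in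
  -- the rest of the state.
  set E : Multiset (BC L) := (R.H₁.vars ∪ R.H₂.vars).val.map fun x => .eq (ρ x) (σ x) with hE
  have hmemE : ∀ x ∈ R.H₁.vars ∪ R.H₂.vars, BC.eq (ρ x) (σ x) ∈ E := fun x hx =>
    Multiset.mem_map_of_mem _ hx
  have headVars : ∀ x ∈ R.H₁.vars ∪ R.H₂.vars, x ∈ R.vars := fun x hx => by
    simp only [Rule.vars, Finset.mem_union] at hx ⊢; tauto
  set Gρ := bsubst R.G.atoms ρ with hGρ
  -- `θ` undoes the renaming by sending `f x` to `σ x`. It witnesses that the equations `E` and the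
  -- renamed guard hold in `S` for suitable values of the fresh local variables.
  set θ : ℕ → L.Term ℕ := fun y => if y ∈ Set.range f then σ (Function.invFun f y) else .var y
    with hθ
  have hθf : ∀ x, θ (f x) = σ x := fun x => by
    simp [hθ, Function.leftInverse_invFun hf x]
  have hθid : ∀ y, (∀ x, f x ≠ y) → θ y = .var y := fun y hy => by
    simp only [hθ, Set.mem_range]
    rw [if_neg]
    rintro ⟨x, hx⟩
    exact hy x hx
  have e1 : cls CT (usubst R.H₁.atoms σ + usubst R.H₂.atoms σ + k.1) S V =
      cls CT (usubst R.H₁.atoms σ + usubst R.H₂.atoms σ + k.1) (S + (E + Gρ)) V := by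
    refine cls_add_of_subst (σ := θ) (fun y hy _ => hθid y ?_) fun b hb => ?_
    · rintro x rfl
      rw [uvars_add, Finset.mem_union] at hy
      have := hfF x
      tauto
    · rw [bsubst_add] at hb
      rcases Multiset.mem_add.1 hb with hb | hb
      · obtain ⟨c, hc, rfl⟩ := mem_bsubst.1 hb
        obtain ⟨x, hx, rfl⟩ := Multiset.mem_map.1 hc
        have : (σ x).subst θ = σ x := term_subst_eq_self fun y hy => hθid y (by
          rintro z rfl
          exact (hfF z).2 x (headVars x hx) hy)
        simp only [BC.subst, hρ, subst_var_apply, hθf, this]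
        exact hEq.refl _ _
      · rw [hGρ, bsubst_bsubst, hρ] at hb
        simp only [subst_var_apply, hθf] at hb
        exact .of_mem (by simp [hS, hb])
  have entE : ∀ (Z : Multiset (BC L)), E ⊆ Z → ∀ x ∈ R.H₁.vars ∪ R.H₂.vars,
      CT.Ent Z (BC.eq (ρ x) (σ x)).form := fun Z hZ x hx => .of_mem (hZ (hmemE x hx))
  -- Modulo the equations, the instance of the head under `σ` becomes the head of the variant, so
  -- the rule is applicable.
  have e2 : cls CT (usubst R.H₁.atoms σ + usubst R.H₂.atoms σ + k.1) (S + (E + Gρ)) V =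
      cls CT (usubst R.H₁.atoms ρ + usubst R.H₂.atoms ρ + k.1) (S + (E + Gρ)) V := by
    rw [← usubst_add, ← usubst_add]
    refine cls_congr_user hEq fun x hx => hEq.symm (entE _ (fun b hb => by simp [hb]) x ?_)
    rwa [uvars_add, UC.uvars_atoms, UC.uvars_atoms] at hx
  have e3 : cls CT (usubst R.H₁.atoms ρ + usubst R.H₂.atoms ρ + k.1) (S + (E + Gρ)) V =
      cls CT ((R.rename f).H₁.atoms + (R.rename f).H₂.atoms + (conjU k.1).atoms)
        ((R.rename f).G.atoms + (conjB (S + E)).atoms) V := by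
    simp only [Rule.rename, UC.atoms_subst, BC.atoms_subst]
    rw [← cls_flatten, ← add_assoc, add_comm (S + E)]
  simp only [Prod.fst_add, Prod.snd_add]
  have elive : ¬ CT.Unsat ((R.rename f).G.atoms + (conjB (S + E)).atoms) := by
    rw [← live_cls_iff (U := U), ← e3, ← e2, ← e1]
    exact live_cls_iff.2 hsat
  rw [← hS, e1, e2, e3]
  refine hQ _ _ ⟨R, hR, R.rename f, ⟨f, hf.injOn, rfl⟩, conjU k.1, conjB (S + E), V, 0, ?_,
    elive, rfl, rfl⟩ fun d' hd' => ?_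
  · rw [Finset.disjoint_left]
    intro y hy hy'
    obtain ⟨x, hx, rfl⟩ := Rule.exists_of_mem_localVars_rename hy
    have hyH := (Finset.mem_sdiff.1 hy).2
    have hxH := (Finset.mem_sdiff.1 hx).2
    have hfx := hfF x
    rw [vars_conjU, vars_conjB, bvars_add] at hy'
    have hEv : f x ∉ bvars E := by
      intro hxE
      obtain ⟨c, hc, hxc⟩ := mem_bvars.1 hxE
      obtain ⟨z, hz, rfl⟩ := Multiset.mem_map.1 hc
      simp only [BC.vars, Finset.mem_union, hρ, mem_varFinset_var] at hxc
      rcases hxc with hxc | hxc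
      · exact hxH (hf hxc ▸ hz)
      · exact hfx.2 z (headVars z hz) hxc
    simp only [Finset.mem_union] at hy' hyH
    tauto
  · rw [add_zero, mem_stateNF_rule] at hd'
    obtain ⟨_, hd, hu, rfl⟩ := hd'
    simp only [Rule.rename, Goal.dnf_subst, Multiset.mem_map] at hd
    obtain ⟨d, hd, rfl⟩ := hd
    -- The instance of the body to which `hk` is applied: local variables of the rule keep their
    -- fresh names, all others have their values under `σ`.
    set τ : ℕ → L.Term ℕ := fun x => if x ∈ R.localVars then .var (f x) else σ x with hτ
    have hdv := Goal.vars_of_mem_dnf hd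
    set Z := Gρ + bsubst d.2 ρ + (S + E) with hZ
    have entZ : ∀ x ∈ R.vars, CT.Ent Z (BC.eq (ρ x) (τ x)).form := by
      intro x hx
      by_cases hxl : x ∈ R.localVars
      · simp only [hτ, if_pos hxl]
        exact hEq.refl _ _
      · simp only [hτ, if_neg hxl]
        exact entE _ (fun b hb => by simp [hZ, hb]) x ((rule_vars_cases hx).resolve_right hxl)
    have hH₁ : usubst R.H₁.atoms τ = usubst R.H₁.atoms σ := usubst_congr fun x hx => by
      rw [UC.uvars_atoms] at hx
      simp [hτ, Rule.localVars, hx]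
    -- `B` collects the constraints of the resulting store beyond that instance and `k`. The
    -- instance itself is entailed by the store modulo `E` and may be added.
    refine of_mem_statePole (hk τ (fun x hx => by simp [hτ, hx]) d hd)
      (B := bsubst R.G.atoms σ + B₀ + E + Gρ + bsubst d.2 ρ) ?_ hu
    simp only [Rule.rename, UC.atoms_subst, BC.atoms_subst, FlatGoal.subst, Prod.fst_add,
      Prod.snd_add]
    rw [← cls_flatten]
    change cls CT (usubst R.H₁.atoms ρ + usubst d.1 ρ + k.1) Z V = _
    rw [← usubst_add, cls_congr_user hEq (τ := τ), usubst_add, hH₁]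
    · rw [cls_add_of_ent (B' := bsubst R.G.atoms τ + bsubst d.2 τ)]
      · congr 1
        rw [hZ, hS]
        abel
      · rw [← bsubst_add]
        intro c hc
        obtain ⟨b, hb, rfl⟩ := mem_bsubst.1 hc
        have hbv : ∀ x ∈ b.vars, x ∈ R.vars := by
          intro x hx
          have hx' := mem_bvars.2 ⟨b, hb, hx⟩
          rw [bvars_add, BC.bvars_atoms, Finset.mem_union] at hx'
          simp only [Rule.vars, Finset.mem_union]
          rcases hx' with hx' | hx'
          · exact .inl (.inr hx')
          · exact .inr (hdv (by simp [hx']))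
        refine hEq.congr (σ := ρ) (fun x hx => entZ x (hbv x hx)) (.of_mem ?_)
        rcases Multiset.mem_add.1 hb with hb | hb
        · have : b.subst ρ ∈ Gρ := mem_bsubst.2 ⟨b, hb, rfl⟩
          simp [hZ, this]
        · have : b.subst ρ ∈ bsubst d.2 ρ := mem_bsubst.2 ⟨b, hb, rfl⟩
          simp [hZ, this]
    · intro x hx
      rw [uvars_add, UC.uvars_atoms, Finset.mem_union] at hx
      refine entZ x ?_
      simp only [Rule.vars, Finset.mem_union]
      rcases hx with hx | hx
      · exact .inl (.inl (.inl hx))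
      · exact .inr (hdv (by simp [hx]))

end Pole

/-! ### Backward propagation along transitions, and simulation of one program by the other. -/

section Backward

variable {L : FirstOrder.Language.{u, v}} {U : ℕ → Type w} {CT : ConstraintTheory L}

/-- All satisfiable states refining `s` are in `Q`. -/
def Stable (Q : StateClass CT U → Prop) (s : StateClass CT U) : Prop :=
  ∀ s₀, Live s₀ → Le s₀ s → Q s₀

/-- Stability is preserved by backward transitions of a program with valid rules. -/
theorem FlatStep.stable (hEq : CT.HasEquality) {Q : StateClass CT U → Prop} {P : Program L U}
    (hP : ∀ V, ∀ R ∈ P, RuleValid (statePole Q V) R) {m m' : Multiset (StateClass CT U)}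
    (h : FlatStep CT P m m') (hm' : ∀ d ∈ m', Stable Q d) : ∀ d ∈ m, Stable Q d := by
  obtain ⟨R, hR, _, ⟨ρ, hρ, rfl⟩, A, B, V, c, hd, -, rfl, rfl⟩ := h
  intro d hd'
  rcases Multiset.mem_cons.1 hd' with rfl | hd'
  swap
  · exact hm' d (by simp [hd'])
  -- The refining state has its own set `V₁` of globals, which is why rules are assumed valid for
  -- the poles over all sets of globals.
  intro s₀ hs₀ hle
  obtain ⟨σ, B₁, V₁, hV, hV₁, rfl, hB₁⟩ := hle.refines hEq hs₀
  set τ₀ : ℕ → L.Term ℕ := fun x => σ (ρ x) with hτ₀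
  have hH₁ : usubst (R.rename ρ).H₁.atoms σ = usubst R.H₁.atoms τ₀ := by
    simp only [Rule.rename, UC.atoms_subst, usubst_usubst]; rfl
  have hH₂ : usubst (R.rename ρ).H₂.atoms σ = usubst R.H₂.atoms τ₀ := by
    simp only [Rule.rename, UC.atoms_subst, usubst_usubst]; rfl
  have hG : bsubst (R.rename ρ).G.atoms σ = bsubst R.G.atoms τ₀ := by
    simp only [Rule.rename, BC.atoms_subst, bsubst_bsubst]; rfl
  rw [bsubst_add, hG] at hB₁
  -- The context for the rule consists of the instance of the untouched user-defined constraints and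
  -- the whole store `B₁`, which already implies the guard.
  have hvalid := hP V₁ R hR τ₀ (usubst A.atoms σ, B₁) ?_
  · refine of_mem_statePole hvalid (B := 0) ?_ (live_cls_iff.1 hs₀)
    simp only [Prod.fst_add, Prod.snd_add, usubst_add, hH₁, hH₂, add_zero]
    rw [add_comm _ B₁]
    exact cls_add_of_ent fun b hb => hB₁ b (by simp [hb])
  intro τ hτ d hd₁ B₀ hsat
  simp only [Prod.fst_add, Prod.snd_add] at hsat ⊢
  have hlocal : ∀ y ∈ R.localVars.image ρ, y ∈ (R.rename ρ).localVars := by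
    intro y hy
    obtain ⟨x, hx, rfl⟩ := Finset.mem_image.1 hy
    exact Rule.mem_localVars_rename hρ hx
  -- `θ` follows `τ` on the local variables of the variant and `σ` elsewhere. The two fit together
  -- because these local variables occur neither in the context nor among the globals.
  set θ : ℕ → L.Term ℕ := fun y => if y ∈ R.localVars.image ρ then
    τ (Function.invFunOn ρ (R.vars : Set ℕ) y) else σ y with hθ
  have hθρ : ∀ x ∈ R.vars, θ (ρ x) = τ x := by
    intro x hx
    by_cases hxl : x ∈ R.localVars
    · have : ρ x ∈ R.localVars.image ρ := Finset.mem_image_of_mem _ hxl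
      simp only [hθ, if_pos this]
      rw [hρ.leftInvOn_invFunOn hx]
    · have : ρ x ∉ R.localVars.image ρ := by
        intro h
        obtain ⟨z, hz, he⟩ := Finset.mem_image.1 h
        exact hxl (hρ (R.localVars_subset hz) hx he ▸ hz)
      simp only [hθ, if_neg this]
      exact (hτ x hxl).symm
  have hθσ : ∀ y, y ∈ A.vars ∨ y ∈ B.vars ∨ y ∈ V → θ y = σ y := by
    intro y hy
    have : y ∉ R.localVars.image ρ := fun h => by
      refine Finset.disjoint_left.1 hd (hlocal y h) ?_
      simp only [Finset.mem_union]
      tauto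
    simp only [hθ, if_neg this]
  have hdv := Goal.vars_of_mem_dnf hd₁
  have hRB : ∀ x ∈ R.B.vars, x ∈ R.vars := fun x hx => by simp [Rule.vars, hx]
  have k1 : usubst (R.rename ρ).H₁.atoms θ = usubst R.H₁.atoms τ₀ := by
    simp only [Rule.rename, UC.atoms_subst, usubst_usubst, subst_var_apply]
    refine usubst_congr fun x hx => ?_
    rw [UC.uvars_atoms] at hx
    rw [hθρ x (by simp [Rule.vars, hx]), hτ x (by simp [Rule.localVars, hx])]
  have k2 : usubst (usubst d.1 fun n => .var (ρ n)) θ = usubst d.1 τ := by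
    simp only [usubst_usubst, subst_var_apply]
    exact usubst_congr fun x hx => hθρ x (hRB x (hdv (by simp [hx])))
  have k3 : bsubst (bsubst d.2 fun n => .var (ρ n)) θ = bsubst d.2 τ := by
    simp only [bsubst_bsubst, subst_var_apply]
    exact bsubst_congr fun x hx => hθρ x (hRB x (hdv (by simp [hx])))
  have k4 : bsubst (R.rename ρ).G.atoms θ = bsubst R.G.atoms τ := by
    simp only [Rule.rename, BC.atoms_subst, bsubst_bsubst, subst_var_apply]
    refine bsubst_congr fun x hx => ?_
    rw [BC.bvars_atoms] at hx
    exact hθρ x (by simp [Rule.vars, hx])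
  have k5 : usubst A.atoms θ = usubst A.atoms σ := usubst_congr fun x hx => by
    rw [UC.uvars_atoms] at hx; exact hθσ x (.inl hx)
  have k6 : bsubst B.atoms θ = bsubst B.atoms σ := bsubst_congr fun x hx => by
    rw [BC.bvars_atoms] at hx; exact hθσ x (.inr (.inl hx))
  -- The state to be shown in `Q` refines the disjunct of the transition's result that stems from
  -- `d`, so stability of that disjunct finishes the proof.
  have href : Refines (cls CT (usubst R.H₁.atoms τ₀ + usubst d.1 τ + usubst A.atoms σ)
      (bsubst R.G.atoms τ + bsubst d.2 τ + B₁ + B₀) V₁)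
      ((R.rename ρ).H₁.atoms + usubst d.1 (fun n => .var (ρ n)) + A.atoms)
      ((R.rename ρ).G.atoms + bsubst d.2 (fun n => .var (ρ n)) + B.atoms) V := by
    refine ⟨θ, bsubst R.G.atoms τ + bsubst d.2 τ + B₁ + B₀, V₁, fun x hx => (hθσ x (.inr (.inr hx))).trans (hV x hx), hV₁, ?_, ?_⟩
    · rw [usubst_add, usubst_add, k1, k2, k5]
    · rw [bsubst_add, bsubst_add, k3, k4, k6]
      intro b hb
      rcases Multiset.mem_add.1 hb with hb | hb
      · exact .of_mem (by rw [add_assoc]; exact Multiset.mem_add.2 (.inl hb))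
      · exact (hB₁ b (Multiset.mem_add.2 (.inr hb))).mono fun c hc => by simp [hc]
  have hlive : Live (cls CT (usubst R.H₁.atoms τ₀ + usubst d.1 τ + usubst A.atoms σ)
      (bsubst R.G.atoms τ + bsubst d.2 τ + B₁ + B₀) V₁) := live_cls_iff.2 hsat
  refine hm' _ (Multiset.mem_add.2 (.inl (mem_stateNF_rule.2
    ⟨d.subst fun n => .var (ρ n), ?_, href.not_unsat hlive, rfl⟩))) _ hlive ⟨_, _, _, rfl, href⟩
  simp only [Rule.rename, Goal.dnf_subst]
  exact Multiset.mem_map_of_mem _ hd₁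

theorem FlatSteps.stable (hEq : CT.HasEquality) {Q : StateClass CT U → Prop} {P : Program L U}
    (hP : ∀ V, ∀ R ∈ P, RuleValid (statePole Q V) R) {m m' : Multiset (StateClass CT U)}
    (h : FlatSteps CT P m m') (hm' : ∀ d ∈ m', Stable Q d) : ∀ d ∈ m, Stable Q d := by
  induction h with
  | refl => exact hm'
  | tail _ h ih => exact ih (h.stable hEq hP hm')

/-- From `s`, the program reaches a disjunction of refinements of elements of `T`. -/
def Reaches (CT : ConstraintTheory L) (P : Program L U) (T : Multiset (StateClass CT U))
    (s : StateClass CT U) : Prop :=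
  ∃ m, FlatSteps CT P {s} m ∧ ∀ d ∈ m, ∃ t ∈ T, Le d t

/-- Runs from the successors are placed side by side. This is the backward closure that makes the
rules of the program valid in the associated phase model. -/
theorem Reaches.of_flatStep {P : Program L U} {T : Multiset (StateClass CT U)}
    {s : StateClass CT U} {m : Multiset (StateClass CT U)} (h : FlatStep CT P {s} m)
    (hm : ∀ d ∈ m, Reaches CT P T d) : Reaches CT P T s := by
  classical
  have h' : ∀ d, ∃ n, d ∈ m → FlatSteps CT P {d} n ∧ ∀ e ∈ n, ∃ t ∈ T, Le e t := fun d => by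
    by_cases hd : d ∈ m
    · obtain ⟨n, hn⟩ := hm d hd
      exact ⟨n, fun _ => hn⟩
    · exact ⟨0, fun h => (hd h).elim⟩
  choose g hg using h'
  refine ⟨m.bind g, .head h ?_, fun e he => ?_⟩
  · have := FlatSteps.bind (X := m) (f := fun d => {d}) (g := g) fun d hd => (hg d hd).1
    rwa [Multiset.bind_singleton, Multiset.map_id'] at this
  · obtain ⟨d, hd, he⟩ := Multiset.mem_bind.1 he
    exact (hg d hd).2 e he

/-- A transition sequence of one program to `T` is matched by a logically stronger program, up to
refinement. -/
theorem FlatSteps.reaches (hEq : CT.HasEquality) {P₁ P₂ : Program L U}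
    (hd : LForm.DerivesFrom (CT.toLL U) (.lolli P₂.tensorLL P₁.tensorLL))
    {m T : Multiset (StateClass CT U)} (h : FlatSteps CT P₁ m T) (hm : ∀ s ∈ m, Live s) :
    ∀ s ∈ m, Reaches CT P₂ T s := by
  have hP : ∀ V, ∀ R ∈ P₁, RuleValid (statePole (Reaches CT P₂ T) V) R := fun V =>
    adequate_statePole.ruleValid_of_derives hd (statePole_toLL hEq)
      fun R hR => statePole_rule hEq (fun s m' => Reaches.of_flatStep) hR
  have hT : ∀ d ∈ T, Stable (Reaches CT P₂ T) d := fun d hdT s₀ _ hle =>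
    ⟨{s₀}, .refl, fun e he => ⟨d, hdT, Multiset.mem_singleton.1 he ▸ hle⟩⟩
  exact fun s hs => h.stable hEq hP hT s hs s (hm s hs) (.refl (hm s hs))

end Backward

/-! ## Data-sufficient answers -/

section Answers

variable {L : FirstOrder.Language.{u, v}} {U : ℕ → Type w} {CT : ConstraintTheory L}

theorem UC.goal_flat (a : UC L U) : a.goal.Flat := by
  induction a with
  | top | atom => trivial
  | and a a' ih ih' => exact ⟨ih, ih'⟩

theorem BC.goal_flat (b : BC L) : (b.goal U).Flat := by
  induction b with
  | top | bot | eq | rel => trivial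
  | and a a' ih ih' => exact ⟨ih, ih'⟩

theorem State.normal_flat (A : UC L U) (B : BC L) (V : Finset ℕ) :
    (State.normal A B V).goal.Flat := ⟨A.goal_flat, B.goal_flat⟩

/-- No transition is possible from states with an empty user-defined store. -/
theorem not_flatStep_of_pure {P : Program L U} {m m' : Multiset (StateClass CT U)}
    (hm : ∀ s ∈ m, Pure s) : ¬ FlatStep CT P m m' := by
  rintro ⟨R, -, R', ⟨ρ, -, rfl⟩, A, B, V, c, -, hs, rfl, -⟩
  have h := mk_normal (CT := CT) (((R.rename ρ).H₁.and (R.rename ρ).H₂).and A)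
    ((R.rename ρ).G.and B) V
  have h0 := Pure.atoms_eq_zero (h ▸ hm _ (Multiset.mem_cons_self _ _)) hs
  simp only [UC.atoms, add_eq_zero] at h0
  rcases (R.rename ρ).head_nonempty with hH | hH
  · exact UC.atoms_ne_zero hH h0.1.1
  · exact UC.atoms_ne_zero hH h0.1.2

theorem FlatSteps.eq_of_pure {P : Program L U} {m m' : Multiset (StateClass CT U)}
    (hm : ∀ s ∈ m, Pure s) (h : FlatSteps CT P m m') : m' = m := by
  rcases h.cases_head with h | ⟨n, h, -⟩
  · exact h.symm
  · exact (not_flatStep_of_pure hm h).elim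

/-- Two pure outcomes of a live state agree if the program is confluent. -/
theorem FlatSteps.unique (hC : CT.IsComplete) {P : Program L U} (hP : Confluent CT P)
    {m T W : Multiset (StateClass CT U)} (hm : ∀ s ∈ m, Live s) (hT : FlatSteps CT P m T)
    (hW : FlatSteps CT P m W) (hTp : ∀ s ∈ T, Pure s) (hWp : ∀ s ∈ W, Pure s) : T = W := by
  obtain ⟨q, h₁, h₂⟩ := hP _ _ _ (hT.steps hC hm) (hW.steps hC hm)
  have e₁ := h₁.flatSteps
  have e₂ := h₂.flatSteps
  rw [classNF_ofNF (hT.live hm)] at e₁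
  rw [classNF_ofNF (hW.live hm)] at e₂
  rw [← e₁.eq_of_pure hTp, ← e₂.eq_of_pure hWp]

/-- No element of the multiset is below another one. -/
def Antichain (T : Multiset (StateClass CT U)) : Prop :=
  ∀ s t R, T = s ::ₘ t ::ₘ R → ¬ Le s t

/-- Two comparable members would be satisfiable flat states related by state entailment, against the
compactness of configurations reached from a flat state. -/
theorem FlatSteps.antichain (hEq : CT.HasEquality) (hC : CT.IsComplete) {P : Program L U}
    (hP : Analytic CT P) {s : StateClass CT U} {T : Multiset (StateClass CT U)} (hs : Live s)
    (h : FlatSteps CT P {s} T) (hT : ∀ t ∈ T, Pure t) : Antichain T := by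
  rintro t₁ t₂ R rfl hle
  have hm : ∀ d ∈ ({s} : Multiset (StateClass CT U)), Live d := fun d hd => by
    rwa [Multiset.mem_singleton.1 hd]
  have hlive := h.live hm
  have hsteps := h.steps hC hm
  obtain ⟨A, B, V, rfl, hB⟩ := hs
  have e : ofNF {cls CT A B V} = classOf CT {.normal (conjU A) (conjB B) V} := by
    rw [classOf_eq_ofNF]
    congr 1
    rw [← stateNF_normal_conj hB, configNF, Multiset.singleton_bind]
  rw [e] at hsteps
  obtain ⟨B₁, B₂, V', h₁, h₂, hent⟩ := hle.stateEntails hEq (hlive _ (by simp)) (hT _ (by simp))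
    (hT _ (by simp))
  refine hP _ _ (State.normal_flat _ _ _) hsteps ⟨_, _, R.map Quotient.out, ?_,
    State.normal_flat _ _ _, State.normal_flat _ _ _, ?_, hent⟩
  · rw [Multiset.map_cons, Multiset.map_cons]
    refine .trans (.stateEquiv _ (S' := .normal (conjU 0) (conjB B₁) V') ?_) ?_
    · rw [h₁]
      exact Quotient.mk_out (s := stateSetoid CT U) _
    · rw [Multiset.cons_swap, Multiset.cons_swap (State.normal _ _ _) (State.normal _ _ _)]
      refine .stateEquiv _ ?_
      rw [h₂]
      exact Quotient.mk_out (s := stateSetoid CT U) _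
  · exact not_stateEquiv_failed (h₁ ▸ hlive t₁ (by simp) : Live (cls CT 0 B₁ V'))

theorem Antichain.of_cons {s : StateClass CT U} {T : Multiset (StateClass CT U)}
    (h : Antichain (s ::ₘ T)) : Antichain T := by
  rintro a b R rfl
  exact h a b (s ::ₘ R) (by rw [Multiset.cons_swap s, Multiset.cons_swap s])

theorem Antichain.not_le_of_mem {s t : StateClass CT U} {T : Multiset (StateClass CT U)}
    (h : Antichain (s ::ₘ T)) (ht : t ∈ T) : ¬ Le s t ∧ ¬ Le t s := by
  obtain ⟨R, rfl⟩ := Multiset.exists_cons_of_mem ht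
  exact ⟨h s t R rfl, h t s R (Multiset.cons_swap _ _ _)⟩

/-- Antichains of pure states that refine each other are equal. -/
theorem Antichain.eq (hEq : CT.HasEquality) {T W : Multiset (StateClass CT U)}
    (hT : Antichain T) (hW : Antichain W) (hTl : ∀ t ∈ T, Live t) (hWl : ∀ t ∈ W, Live t)
    (hTp : ∀ t ∈ T, Pure t) (hWp : ∀ t ∈ W, Pure t) (h : ∀ t ∈ T, ∃ w ∈ W, Le t w)
    (h' : ∀ w ∈ W, ∃ t ∈ T, Le w t) : T = W := by
  induction T using Multiset.induction_on generalizing W with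
  | empty =>
    refine (Multiset.eq_zero_of_forall_notMem fun w hw => ?_).symm
    obtain ⟨t, ht, -⟩ := h' w hw
    exact absurd ht (Multiset.notMem_zero t)
  | cons s T ih =>
    -- `s` is below some `w` in `W`, which is below some `t`. The antichain property of `s ::ₘ T`
    -- forces `t` to be `s` itself, and antisymmetry gives `w = s`.
    have hsW : s ∈ W := by
      obtain ⟨w, hw, hsw⟩ := h s (Multiset.mem_cons_self _ _)
      obtain ⟨t, ht, hwt⟩ := h' w hw
      have hst := hsw.trans hEq (hTl s (by simp)) hwt
      rcases Multiset.mem_cons.1 ht with rfl | ht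
      · exact hsw.antisymm hEq (hTl _ (by simp)) (hWl _ hw) (hTp _ (by simp)) (hWp _ hw) hwt ▸ hw
      · exact ((hT.not_le_of_mem ht).1 hst).elim
    obtain ⟨W, rfl⟩ := Multiset.exists_cons_of_mem hsW
    rw [ih hT.of_cons hW.of_cons (fun t ht => hTl t (by simp [ht])) (fun t ht => hWl t (by simp [ht]))
      (fun t ht => hTp t (by simp [ht])) fun t ht => hWp t (by simp [ht])]
    · intro t ht
      obtain ⟨w, hw, htw⟩ := h t (by simp [ht])
      rcases Multiset.mem_cons.1 hw with rfl | hw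
      · exact ((hT.not_le_of_mem ht).2 htw).elim
      · exact ⟨w, hw, htw⟩
    · intro w hw
      obtain ⟨t, ht, hwt⟩ := h' w (by simp [hw])
      rcases Multiset.mem_cons.1 ht with rfl | ht
      · exact ((hW.not_le_of_mem hw).2 hwt).elim
      · exact ⟨t, ht, hwt⟩

/-- The pure outcome of a live flat state under `P₁` is also its outcome under `P₂`. -/
theorem FlatSteps.transfer (hEq : CT.HasEquality) (hC : CT.IsComplete) {P₁ P₂ : Program L U}
    (hA₁ : Analytic CT P₁) (hA₂ : Analytic CT P₂) (hC₁ : Confluent CT P₁)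
    (h₁₂ : LForm.DerivesFrom (CT.toLL U) (.lolli P₁.tensorLL P₂.tensorLL))
    (h₂₁ : LForm.DerivesFrom (CT.toLL U) (.lolli P₂.tensorLL P₁.tensorLL))
    {s : StateClass CT U} {T : Multiset (StateClass CT U)} (hs : Live s)
    (h : FlatSteps CT P₁ {s} T) (hT : ∀ t ∈ T, Pure t) : FlatSteps CT P₂ {s} T := by
  have hm : ∀ d ∈ ({s} : Multiset (StateClass CT U)), Live d := fun d hd => by
    rwa [Multiset.mem_singleton.1 hd]
  have hmem : s ∈ ({s} : Multiset (StateClass CT U)) := Multiset.mem_singleton_self s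
  obtain ⟨W, hW, hWT⟩ := h.reaches hEq h₂₁ hm s hmem
  have hWl := hW.live hm
  have hWp : ∀ w ∈ W, Pure w := fun w hw => by
    obtain ⟨t, ht, hle⟩ := hWT w hw
    exact hle.pure hEq (hWl w hw) (hT t ht)
  obtain ⟨X, hX, hXW⟩ := hW.reaches hEq h₁₂ hm s hmem
  have hXp : ∀ x ∈ X, Pure x := fun x hx => by
    obtain ⟨w, hw, hle⟩ := hXW x hx
    exact hle.pure hEq (hX.live hm x hx) (hWp w hw)
  -- `X` and `T` are irreducible outcomes of the same state under `P₁`, hence equal; so `hXW` now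
  -- says that the members of `T` are below members of `W`.
  obtain rfl := FlatSteps.unique hC hC₁ hm h hX hT hXp
  rw [Antichain.eq hEq (h.antichain hEq hC hA₁ hs hT) (hW.antichain hEq hC hA₂ hs hWp)
    (h.live hm) hWl hT hWp hXW hWT]
  exact hW

/-- The pure outcomes of live flat states under `P₁` are also outcomes under `P₂`. -/
theorem FlatSteps.transfer_multiset (hEq : CT.HasEquality) (hC : CT.IsComplete)
    {P₁ P₂ : Program L U}
    (hA₁ : Analytic CT P₁) (hA₂ : Analytic CT P₂) (hC₁ : Confluent CT P₁)
    (h₁₂ : LForm.DerivesFrom (CT.toLL U) (.lolli P₁.tensorLL P₂.tensorLL))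
    (h₂₁ : LForm.DerivesFrom (CT.toLL U) (.lolli P₂.tensorLL P₁.tensorLL))
    {m T : Multiset (StateClass CT U)} (hm : ∀ s ∈ m, Live s)
    (h : FlatSteps CT P₁ m T) (hT : ∀ t ∈ T, Pure t) : FlatSteps CT P₂ m T := by
  induction m using Multiset.induction_on generalizing T with
  | empty => rw [h.eq_of_pure (by simp)]
  | cons s m ih =>
    rw [← Multiset.singleton_add] at h ⊢
    obtain ⟨T₁, T₂, rfl, h₁, h₂⟩ := h.of_add
    exact FlatSteps.add
      (h₁.transfer hEq hC hA₁ hA₂ hC₁ h₁₂ h₂₁ (hm s (by simp)) fun t ht => hT t (by simp [ht]))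
      (ih (fun t ht => hm t (by simp [ht])) h₂ fun t ht => hT t (by simp [ht]))

theorem DataSufficient.pure {C : Config L U} (h : DataSufficient C) :
    ∀ s ∈ configNF CT C, Pure s := by
  intro s hs
  obtain ⟨S, hS, hs⟩ := Multiset.mem_bind.1 hs
  obtain ⟨B, V, rfl⟩ := h S hS
  obtain ⟨m, hm, -, rfl⟩ := mem_stateNF.1 hs
  rw [State.normal, dnf_normal_goal, Multiset.mem_singleton] at hm
  subst hm
  exact ⟨_, _, rfl⟩

/-- The normal form of an arbitrary state, possibly with disjunctions, is a multiset of live flat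
classes, to which the transfer applies member by member. -/
theorem dataSufficientAnswers_subset (hEq : CT.HasEquality) (hC : CT.IsComplete)
    {P₁ P₂ : Program L U}
    (hA₁ : Analytic CT P₁) (hA₂ : Analytic CT P₂) (hC₁ : Confluent CT P₁)
    (h₁₂ : LForm.DerivesFrom (CT.toLL U) (.lolli P₁.tensorLL P₂.tensorLL))
    (h₂₁ : LForm.DerivesFrom (CT.toLL U) (.lolli P₂.tensorLL P₁.tensorLL)) (S : State L U) :
    dataSufficientAnswers CT P₁ S ⊆ dataSufficientAnswers CT P₂ S := by
  rintro _ ⟨C, hCd, rfl, hsteps⟩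
  refine ⟨C, hCd, rfl, ?_⟩
  have hl : ∀ s ∈ classNF (classOf CT {S}), Live s := fun s hs => live_of_mem_classNF hs
  have h := hsteps.flatSteps.transfer_multiset hEq hC hA₁ hA₂ hC₁ h₁₂ h₂₁ hl hCd.pure
  have := h.steps hC hl
  rwa [ofNF_classNF, ofNF_classNF] at this

theorem LForm.DerivesFrom.of_with {Φ : Set (LForm L U)} {A B : LForm L U}
    (h : LForm.DerivesFrom Φ (.with_ A B)) : LForm.DerivesFrom Φ A ∧ LForm.DerivesFrom Φ B := by
  obtain ⟨Γ, hΓ, h⟩ := h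
  exact ⟨⟨Γ, hΓ, by simpa using h.cut (.withL₁ (Γ := 0) .identity)⟩,
    ⟨Γ, hΓ, by simpa using h.cut (.withL₂ (Γ := 0) .identity)⟩⟩

end Answers

end CHR

theorem mainTheorem9 {L : FirstOrder.Language.{u, v}} {U : ℕ → Type w}
    (CT : CHR.ConstraintTheory L) (hEq : CT.HasEquality) (hComplete : CT.IsComplete)
    (P₁ P₂ : CHR.Program L U)
    (hA₁ : CHR.Analytic CT P₁) (hA₂ : CHR.Analytic CT P₂)
    (hC₁ : CHR.Confluent CT P₁) (hC₂ : CHR.Confluent CT P₂)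
    (h : CHR.LogicallyEquivalent CT P₁ P₂) :
    CHR.OperationallySEquivalent CT P₁ P₂ := by
  obtain ⟨h₁₂, h₂₁⟩ := CHR.LForm.DerivesFrom.of_with h
  exact fun S => Set.Subset.antisymm
    (CHR.dataSufficientAnswers_subset hEq hComplete hA₁ hA₂ hC₁ h₁₂ h₂₁ S)
    (CHR.dataSufficientAnswers_subset hEq hComplete hA₂ hA₁ hC₂ h₂₁ h₁₂ S)
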